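/- Fix an integer $m\ge 0$ and real constants $d_k>1$, $\lambda_k\ge 0$ $(1\le k\le m)$, $\mu\ge 0$, $\gamma\in(0,\infty)$, put $a_k=d_k+\lambda_k\sqrt{d_k}$ and $b_k=d_k-\lambda_k\sqrt{d_k}$, and assume $b_k\ge 0$ for all $k$. Let $p=p_n$ be positive integers (for all large $n$) with $n/p_n\to\gamma$ as $n\to\infty$. For $n\ge\max_k a_k$ let $\mathbb P_{\boldsymbol\lambda,\mu}=\mathbb P^{(n)}_{\boldsymbol\lambda,\mu}$ be the joint law of the simple graphs $G_1,\dots,G_m$ on the vertex set $\{1,\dots,n\}$ and the $n\times p$ real matrix $B$ generated as follows. The label vector $\sigma$ is uniform on $\{-1,+1\}^n$. Conditionally on $\sigma$, the objects $G_1,\dots,G_m,B$ are independent; in $G_k$ each pair $i<j$ is an edge, independently of the other pairs, with probability $a_k/n$ if $\sigma_i=\sigma_j$ and $b_k/n$ if $\sigma_i\ne\sigma_j$; and $$B_{ij}=\sqrt{\mu/n}\;\sigma_i u_j+R_{ij},$$ where all the $u_j$ and $R_{ij}$ are independent $\mathrm N(0,1)$ variables. Let $\mathbb P_{\mathbf 0,0}$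 be the law obtained with the same $d_k$ but with $\lambda_1=\dots=\lambda_m=0$ and $\mu=0$. 1. If $\lambda_1^2+\cdots+\lambda_m^2+\mu^2/\gamma<1$, then $\mathbb P_{\boldsymbol\lambda,\mu}$ is contiguous to $\mathbb P_{\mathbf 0,0}$: for every sequence of measurable events $E_n$ with $\mathbb P^{(n)}_{\mathbf 0,0}(E_n)\to 0$, also $\mathbb P^{(n)}_{\boldsymbol\lambda,\mu}(E_n)\to 0$. 2. If $\lambda_1^2+\cdots+\lambda_m^2+\mu^2/\gamma>1$, then $\mathbb P_{\boldsymbol\lambda,\mu}$ and $\mathbb P_{\mathbf 0,0}$ are asymptotically mutually singular: there are measurable events $E_n$ with $\mathbb P^{(n)}_{\mathbf 0,0}(E_n)\to 0$ and $\mathbb P^{(n)}_{\boldsymbol\lambda,\mu}(E_n)\to 1$. -/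

import Mathlib

open MeasureTheory ProbabilityTheory Filter Topology

namespace ContextualSBM

noncomputable section

/-- The community label of a subject, `+1` or `-1`, as a real number. -/
def spin (s : ℤˣ) : ℝ := ((s : ℤ) : ℝ)

/-- The probability of an edge between subjects with labels `s` and `t`: it is `a / n` with
`a = d + lam * √d` when the labels agree and `b / n` with `b = d - lam * √d` when they differ.
The projection to the unit interval is the identity when `0 ≤ b` and `a ≤ n`; it only serves to
give a probability for the finitely many `n < a` as well. -/
def edgeProb (d lam : ℝ) (n : ℕ) (s t : ℤˣ) : unitInterval :=
  Set.projIcc (0 : ℝ) 1 zero_le_one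
    ((if s = t then d + lam * √d else d - lam * √d) / (n : ℝ))

/-- The unordered pairs of distinct elements of `Fin n`, each written as `(i, j)` with `i < j`. -/
abbrev Pairs (n : ℕ) : Type := {e : Fin n × Fin n // e.1 < e.2}

/-- The simple graph on `Fin n` whose edges are the pairs with indicator `true`. -/
def graphOf {n : ℕ} (x : Pairs n → Bool) : SimpleGraph (Fin n) :=
  SimpleGraph.fromEdgeSet {e | ∃ q : Pairs n, x q = true ∧ e = s(q.1.1, q.1.2)}

/-- The conditional law of one network given the labels `σ`: every pair `i < j` is an edge
independently, with probability `edgeProb d lam n (σ i) (σ j)`. -/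
def sbmLaw (d lam : ℝ) {n : ℕ} (σ : Fin n → ℤˣ) : Measure (SimpleGraph (Fin n)) :=
  (Measure.pi fun q : Pairs n =>
    bernoulliMeasure true false (edgeProb d lam n (σ q.1.1) (σ q.1.2))).map graphOf

/-- The conditional law of the covariate matrix `B` given the labels `σ`:
`B i j = √(μ / n) * σ i * u j + R i j` with all `u j` and all `R i j` independent standard
normal. -/
def covariateLaw (μ : ℝ) {n : ℕ} (p : ℕ) (σ : Fin n → ℤˣ) : Measure (Fin n → Fin p → ℝ) :=
  ((Measure.pi fun _ : Fin p => gaussianReal 0 1).prod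
    (Measure.pi fun _ : Fin n => Measure.pi fun _ : Fin p => gaussianReal 0 1)).map
      fun w : (Fin p → ℝ) × (Fin n → Fin p → ℝ) =>
        fun i j => √(μ / (n : ℝ)) * spin (σ i) * w.1 j + w.2 i j

/-- The observed data: `m` networks on `n` subjects and an `n × p` real matrix. -/
abbrev Data (m n p : ℕ) : Type :=
  (Fin m → SimpleGraph (Fin n)) × (Fin n → Fin p → ℝ)

/-- The conditional law of the data given the labels: the networks and the covariate matrix are
independent. -/
def condLaw {m : ℕ} (d lam : Fin m → ℝ) (μ : ℝ) {n : ℕ} (p : ℕ) (σ : Fin n → ℤˣ) :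
    Measure (Data m n p) :=
  (Measure.pi fun k => sbmLaw (d k) (lam k) σ).prod (covariateLaw μ p σ)

/-- The law of the data (the labels and `u` are not observed): the average of the conditional laws
over the `2 ^ n` label vectors. The null law is the case `lam = 0`, `μ = 0`. -/
def dataLaw {m : ℕ} (d lam : Fin m → ℝ) (μ : ℝ) (n p : ℕ) : Measure (Data m n p) :=
  ((2 : ENNReal) ^ n)⁻¹ • ∑ σ : Fin n → ℤˣ, condLaw d lam μ p σ

/-- The sequence of laws `Q` is contiguous to the sequence `P`: events whose probabilities under
`P` tend to `0` have probabilities under `Q` that tend to `0`. -/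
def Contiguous {X : ℕ → Type*} [∀ n, MeasurableSpace (X n)] (Q P : ∀ n, Measure (X n)) : Prop :=
  ∀ E : ∀ n, Set (X n), (∀ n, MeasurableSet (E n)) →
    Tendsto (fun n => P n (E n)) atTop (𝓝 0) → Tendsto (fun n => Q n (E n)) atTop (𝓝 0)

/-- The sequences of laws `Q` and `P` are asymptotically mutually singular: there are events whose
probabilities tend to `0` under `P` and to `1` under `Q`. -/
def AsympMutuallySingular {X : ℕ → Type*} [∀ n, MeasurableSpace (X n)]
    (Q P : ∀ n, Measure (X n)) : Prop :=
  ∃ E : ∀ n, Set (X n), (∀ n, MeasurableSet (E n)) ∧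
    Tendsto (fun n => P n (E n)) atTop (𝓝 0) ∧ Tendsto (fun n => Q n (E n)) atTop (𝓝 1)

end

end ContextualSBM

/-!
# Detecting communities from several networks and covariates

Both halves are second moment arguments, and the threshold is the point where each of them breaks
down.

Below the threshold, condition on the labels `σ` and on the vector `u`: the data then have a
density `labelDensity` with respect to the null law, because the graphs are products of Bernoulli
laws and the covariates are products of Gaussian laws. If the second moment of the mixture of these
densities over `σ` and `u` is bounded, a rare event of the null law is rare under the alternative
(`mixture_le_of_second_moment`). For two independent copies `(σ, u)` and `(τ, v)` the graphs
contribute at most `exp (∑ lam² S² / 2n)` and the covariates `exp (μ S ⟨u, v⟩ / n)`, up to lower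
order, where `S = ∑ σ_i τ_i` is the overlap of the labels (`lintegral_labelDensity_mul_le`).
Integrating over `v` turns the second factor into `exp (μ² S² |u|² / 2n²)`. The integral over `u` of
this may diverge, so the second moment is truncated to the event `|u|² ≤ (1 + ε) p`, which is
likely; there the exponent is at most `c S² / 2n` with a constant `c < 1` as soon as
`∑ lam² + μ² / γ < 1` (`truncated_second_moment_le`). Finally `S` is a sum of `n` random signs, and
its exponential moment is at most the one of a Gaussian of variance `n`, which is finite
(`sum_exp_sq_le`, `gaussSqConst_lt_top`).

Above the threshold, put `Λ = ∑ lam² + μ² / γ > 1`. Take the factor graph with a node for every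
subject and every covariate, with `m` layers of edges between subjects, and with edges between
subjects and covariates. A mixed cycle of length `k` visits `k` distinct subjects, each step being
an edge of a layer or a passage through a covariate. The test statistic `cycleSum` adds, over all
mixed cycles, the products of suitably weighted centred variables along the cycle. Under the
alternative each step has a mean whose sign is given by the labels of its end points, and these
signs cancel around a cycle; the mean of the statistic tends to at least `Λ ^ k`
(`le_sum_cycleMean`), and it is `0` under the null law. Under both laws the variance is at most
`4 k² Λ ^ k` in the limit (`integral_cycleSum_sq_le`, `sum_stepVar_le`):

* node-disjoint cycles are uncorrelated (`integral_cycleStat_mul_of_disjoint`);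
* cycles which meet without having the same edges have fewer nodes than edges in their union
  (`card_nodes_union_lt`), and this excess costs a factor `1 / n`, while the weighted number of
  such pairs stays bounded (`sum_pow_card_nodes_le`);
* each cycle has the same edges as at most `2 k²` cycles (`card_edges_eq_le`), and the sum of the
  second moments of all the cycles, averaged over the labels (`sum_integral_cycleStat_sq_le`), is
  at most `2 Λ ^ k` in the limit.

So Chebyshev's inequality gives a test with errors of order `k² / Λ ^ k` for each fixed `k`, and
tests with arbitrarily small errors combine into one sequence (`asympMutuallySingular_of_tests`).
-/

namespace ContextualSBM

noncomputable section

/-! ### Mixed cycles -/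

/-- The factor graph has a node for every subject and a node for every covariate. -/
abbrev Node (n p : ℕ) : Type := Fin n ⊕ Fin p

/-- An edge of the factor graph is either a pair of subjects in one of the `m` layers, or a
subject together with a covariate. Degenerate pairs in `Sym2` are allowed here but never occur in
a mixed cycle. -/
abbrev Edge (m n p : ℕ) : Type := (Fin m × Sym2 (Fin n)) ⊕ (Fin n × Fin p)

/-- A closed walk through the subjects `f 0, f 1, …, f (k - 1)`. The step from `f t` to `f (t + 1)`
is an edge of layer `l` when `c t = inl l`, and passes through the covariate `j` when
`c t = inr j`. No subject and no covariate is visited twice. -/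
def IsMixedCycle {m n p k : ℕ} (f : ZMod k → Fin n) (c : ZMod k → Fin m ⊕ Fin p) : Prop :=
  Function.Injective f ∧ ∀ t t' j, c t = Sum.inr j → c t' = Sum.inr j → t = t'

/-- The mixed cycles of length `k`, with a starting point and a direction. -/
abbrev MixedCycle (m n p k : ℕ) : Type :=
  {α : (ZMod k → Fin n) × (ZMod k → Fin m ⊕ Fin p) // IsMixedCycle α.1 α.2}

instance (m n p k : ℕ) [NeZero k] : Fintype (MixedCycle m n p k) := Fintype.ofFinite _

/-- The edges used by a step from `i` to `i'`. -/
def stepEdges {m n p : ℕ} (i i' : Fin n) : Fin m ⊕ Fin p → Finset (Edge m n p)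
  | Sum.inl l => {Sum.inl (l, s(i, i'))}
  | Sum.inr j => {Sum.inr (i, j), Sum.inr (i', j)}

/-- The nodes visited by a step that leaves `i`, without its endpoint. -/
def stepNodes {m n p : ℕ} (i : Fin n) : Fin m ⊕ Fin p → Finset (Node n p)
  | Sum.inl _ => {Sum.inl i}
  | Sum.inr j => {Sum.inl i, Sum.inr j}

namespace MixedCycle

variable {m n p k : ℕ}

/-- The subject visited at time `t`. -/
def f (α : MixedCycle m n p k) (t : ZMod k) : Fin n := α.1.1 t

/-- The layer or covariate used by the step that starts at time `t`. -/
def c (α : MixedCycle m n p k) (t : ZMod k) : Fin m ⊕ Fin p := α.1.2 t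

lemma f_inj (α : MixedCycle m n p k) : Function.Injective α.f := α.2.1

lemma c_inj (α : MixedCycle m n p k) {t t' : ZMod k} {j : Fin p} (h : α.c t = Sum.inr j)
    (h' : α.c t' = Sum.inr j) : t = t' := α.2.2 t t' j h h'

lemma ext' {α β : MixedCycle m n p k} (hf : ∀ t, α.f t = β.f t) (hc : ∀ t, α.c t = β.c t) :
    α = β :=
  Subtype.ext (Prod.ext (funext hf) (funext hc))

variable [NeZero k]

/-- The edges of a mixed cycle. -/
def edges (α : MixedCycle m n p k) : Finset (Edge m n p) :=
  Finset.univ.biUnion fun t => stepEdges (α.f t) (α.f (t + 1)) (α.c t)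

/-- The nodes of a mixed cycle. -/
def nodes (α : MixedCycle m n p k) : Finset (Node n p) :=
  Finset.univ.biUnion fun t => stepNodes (α.f t) (α.c t)

end MixedCycle

lemma zmod_add_one_ne {k : ℕ} (hk : 3 ≤ k) (t : ZMod k) : t + 1 ≠ t := by
  intro h
  have h1 : ((1 : ℕ) : ZMod k) = 0 := by simpa using h
  rw [ZMod.natCast_eq_zero_iff] at h1
  have := Nat.le_of_dvd one_pos h1
  omega

lemma zmod_add_one_add_one_ne {k : ℕ} (hk : 3 ≤ k) (t : ZMod k) : t + 1 + 1 ≠ t := by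
  intro h
  have h1 : ((2 : ℕ) : ZMod k) = 0 := by
    have h2 : t + 2 = t := by rw [← one_add_one_eq_two, ← add_assoc, h]
    simpa using h2
  rw [ZMod.natCast_eq_zero_iff] at h1
  have := Nat.le_of_dvd two_pos h1
  omega

/-- A property that passes from each element of `ZMod k` to the next one holds everywhere as soon
as it holds somewhere. -/
lemma zmod_forall_of_step {k : ℕ} [NeZero k] {P : ZMod k → Prop} (h : ∀ t, P t → P (t + 1))
    {t₀ : ZMod k} (h0 : P t₀) (t : ZMod k) : P t := by
  have key : ∀ i : ℕ, P (t₀ + i) := by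
    intro i
    induction i with
    | zero => simpa using h0
    | succ i ih => simpa [add_assoc] using h _ ih
  have := key (t - t₀).val
  simpa using this

namespace MixedCycle

variable {m n p k : ℕ}

lemma f_ne_succ (hk : 3 ≤ k) (α : MixedCycle m n p k) (t : ZMod k) : α.f t ≠ α.f (t + 1) :=
  fun h => zmod_add_one_ne hk t (α.f_inj h).symm

lemma pair_inj (hk : 3 ≤ k) (α : MixedCycle m n p k) {t t' : ZMod k}
    (h : s(α.f t, α.f (t + 1)) = s(α.f t', α.f (t' + 1))) : t = t' := by
  rw [Sym2.eq_iff] at h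
  rcases h with ⟨h, -⟩ | ⟨h1, h2⟩
  · exact α.f_inj h
  · have h1 := α.f_inj h1
    have h2 := α.f_inj h2
    rw [h1] at h2
    exact absurd h2 (zmod_add_one_add_one_ne hk t')

/-- The first edge of the step that starts at time `t`. -/
def firstEdge (α : MixedCycle m n p k) (t : ZMod k) : Edge m n p :=
  Sum.elim (fun l => Sum.inl (l, s(α.f t, α.f (t + 1)))) (fun j => Sum.inr (α.f t, j)) (α.c t)

lemma c_eq_of_firstEdge_eq {α β : MixedCycle m n p k} {t : ZMod k}
    (he : α.firstEdge t = β.firstEdge t) : α.c t = β.c t := by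
  rcases h : α.c t with l | j <;> rcases h' : β.c t with l' | j' <;>
    simp_all [firstEdge]

variable [NeZero k]

lemma mem_edges_layer {α : MixedCycle m n p k} {l : Fin m} {s : Sym2 (Fin n)} :
    Sum.inl (l, s) ∈ α.edges ↔ ∃ t, α.c t = Sum.inl l ∧ s = s(α.f t, α.f (t + 1)) := by
  simp only [edges, Finset.mem_biUnion, Finset.mem_univ, true_and]
  refine exists_congr fun t => ?_
  rcases h : α.c t with l' | j
  · simp only [stepEdges, Finset.mem_singleton, Sum.inl.injEq, Prod.mk.injEq]
    tauto
  · simp [stepEdges]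

lemma mem_edges_cov {α : MixedCycle m n p k} {i : Fin n} {j : Fin p} :
    Sum.inr (i, j) ∈ α.edges ↔ ∃ t, α.c t = Sum.inr j ∧ (i = α.f t ∨ i = α.f (t + 1)) := by
  simp only [edges, Finset.mem_biUnion, Finset.mem_univ, true_and]
  refine exists_congr fun t => ?_
  rcases h : α.c t with l' | j'
  · simp [stepEdges]
  · simp only [stepEdges, Finset.mem_insert, Finset.mem_singleton, Sum.inr.injEq, Prod.mk.injEq]
    constructor
    · rintro (⟨h1, h2⟩ | ⟨h1, h2⟩) <;> simp [h1, h2]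
    · rintro ⟨h2, h1 | h1⟩ <;> simp [h1, h2]

lemma mem_nodes_subject {α : MixedCycle m n p k} {i : Fin n} :
    Sum.inl i ∈ α.nodes ↔ ∃ t, i = α.f t := by
  simp only [nodes, Finset.mem_biUnion, Finset.mem_univ, true_and]
  refine exists_congr fun t => ?_
  rcases h : α.c t with l' | j' <;> simp [stepNodes]

lemma mem_nodes_cov {α : MixedCycle m n p k} {j : Fin p} :
    Sum.inr j ∈ α.nodes ↔ ∃ t, α.c t = Sum.inr j := by
  simp only [nodes, Finset.mem_biUnion, Finset.mem_univ, true_and]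
  refine exists_congr fun t => ?_
  rcases h : α.c t with l' | j'
  · simp [stepNodes]
  · simp [stepNodes, eq_comm]

lemma layer_not_isDiag (hk : 3 ≤ k) (α : MixedCycle m n p k) {l : Fin m} {s : Sym2 (Fin n)}
    (h : Sum.inl (l, s) ∈ α.edges) : ¬ s.IsDiag := by
  obtain ⟨t, -, rfl⟩ := mem_edges_layer.1 h
  simpa using α.f_ne_succ hk t

lemma stepEdges_disjoint (hk : 3 ≤ k) (α : MixedCycle m n p k) :
    ((Finset.univ : Finset (ZMod k)) : Set (ZMod k)).PairwiseDisjoint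
      fun t => stepEdges (α.f t) (α.f (t + 1)) (α.c t) := by
  intro t _ t' _ htt'
  rw [Function.onFun, Finset.disjoint_left]
  intro e he he'
  apply htt'
  rcases h : α.c t with l | j <;> rcases h' : α.c t' with l' | j' <;>
    simp only [h, h', stepEdges, Finset.mem_singleton, Finset.mem_insert] at he he'
  · rw [he] at he'
    simp only [Sum.inl.injEq, Prod.mk.injEq] at he'
    exact α.pair_inj hk he'.2
  · rcases he' with he' | he' <;> rw [he] at he' <;> simp at he'
  · rcases he with he | he <;> rw [he] at he' <;> simp at he'
  · have : j = j' := by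
      rcases he with he | he <;> rcases he' with he' | he' <;> rw [he] at he' <;>
        simp only [Sum.inr.injEq, Prod.mk.injEq] at he' <;> exact he'.2
    subst this
    exact α.c_inj h h'

lemma stepNodes_disjoint (α : MixedCycle m n p k) :
    ((Finset.univ : Finset (ZMod k)) : Set (ZMod k)).PairwiseDisjoint
      fun t => stepNodes (α.f t) (α.c t) := by
  intro t _ t' _ htt'
  rw [Function.onFun, Finset.disjoint_left]
  intro e he he'
  apply htt'
  rcases e with i | j
  · have h1 : i = α.f t := by
      rcases h : α.c t with l | j <;> simpa [h, stepNodes] using he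
    have h2 : i = α.f t' := by
      rcases h : α.c t' with l | j <;> simpa [h, stepNodes] using he'
    exact α.f_inj (h1.symm.trans h2)
  · have h1 : α.c t = Sum.inr j := by
      rcases h : α.c t with l | j <;> simp_all [stepNodes]
    have h2 : α.c t' = Sum.inr j := by
      rcases h : α.c t' with l | j <;> simp_all [stepNodes]
    exact α.c_inj h1 h2

lemma prod_edges {M : Type*} [CommMonoid M] (hk : 3 ≤ k) (α : MixedCycle m n p k)
    (g : Edge m n p → M) :
    ∏ e ∈ α.edges, g e = ∏ t, ∏ e ∈ stepEdges (α.f t) (α.f (t + 1)) (α.c t), g e :=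
  Finset.prod_biUnion (α.stepEdges_disjoint hk)

lemma card_edges_le (α : MixedCycle m n p k) : α.edges.card ≤ 2 * k := by
  refine (Finset.card_biUnion_le).trans ?_
  calc _ ≤ ∑ _t : ZMod k, 2 := Finset.sum_le_sum fun t _ => by
        rcases α.c t with l | j
        · simp [stepEdges]
        · exact Finset.card_le_two
    _ = 2 * k := by simp [ZMod.card, mul_comm]

lemma card_nodes_le (α : MixedCycle m n p k) : α.nodes.card ≤ 2 * k := by
  refine (Finset.card_biUnion_le).trans ?_
  calc _ ≤ ∑ _t : ZMod k, 2 := Finset.sum_le_sum fun t _ => by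
        rcases α.c t with l | j
        · simp [stepNodes]
        · exact Finset.card_le_two
    _ = 2 * k := by simp [ZMod.card, mul_comm]

lemma card_stepNodes (i : Fin n) (c : Fin m ⊕ Fin p) :
    (stepNodes (m := m) i c).card = Sum.elim (fun _ => 1) (fun _ => 2) c := by
  rcases c with l | j <;> simp [stepNodes]

lemma card_stepEdges {i i' : Fin n} (h : i ≠ i') (c : Fin m ⊕ Fin p) :
    (stepEdges (m := m) i i' c).card = Sum.elim (fun _ => 1) (fun _ => 2) c := by
  rcases c with l | j
  · simp [stepEdges]
  · simp only [stepEdges, Sum.elim_inr]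
    rw [Finset.card_pair]
    simpa using h

lemma card_edges_eq_card_nodes (hk : 3 ≤ k) (α : MixedCycle m n p k) :
    α.edges.card = α.nodes.card := by
  rw [edges, nodes, Finset.card_biUnion (fun x hx y hy h => α.stepEdges_disjoint hk hx hy h),
    Finset.card_biUnion (fun x hx y hy h => α.stepNodes_disjoint hx hy h)]
  exact Finset.sum_congr rfl fun t _ => by
    rw [card_stepNodes, card_stepEdges (α.f_ne_succ hk t)]

/-- Each node of `α` outside a cycle `β` is left by an edge of `α` outside `β`, and if `α` meets
`β` without running inside it, some edge of `α` outside `β` leaves a node of `β`. -/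
lemma card_sdiff_lt (hk : 3 ≤ k) {α β : MixedCycle m n p k} (hmeet : ¬ Disjoint α.nodes β.nodes)
    (hne : ¬ α.edges ⊆ β.edges) : (α.nodes \ β.nodes).card < (α.edges \ β.edges).card := by
  have hE : α.edges \ β.edges = Finset.univ.biUnion
      fun t => stepEdges (α.f t) (α.f (t + 1)) (α.c t) \ β.edges := by
    ext e; simp [edges]
  have hN : α.nodes \ β.nodes = Finset.univ.biUnion
      fun t => stepNodes (α.f t) (α.c t) \ β.nodes := by
    ext e; simp [nodes]
  rw [hE, hN,
    Finset.card_biUnion (fun x hx y hy h => (α.stepEdges_disjoint hk hx hy h).mono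
      Finset.sdiff_subset Finset.sdiff_subset),
    Finset.card_biUnion (fun x hx y hy h => (α.stepNodes_disjoint hx hy h).mono
      Finset.sdiff_subset Finset.sdiff_subset)]
  have e1 : ∀ {l s v}, Sum.inl (l, s) ∈ β.edges → v ∈ s → Sum.inl v ∈ β.nodes := by
    intro l s v h hv
    obtain ⟨t, -, rfl⟩ := mem_edges_layer.1 h
    rcases Sym2.mem_iff.1 hv with rfl | rfl
    · exact mem_nodes_subject.2 ⟨_, rfl⟩
    · exact mem_nodes_subject.2 ⟨_, rfl⟩
  have e2 : ∀ {i j}, Sum.inr (i, j) ∈ β.edges → Sum.inl i ∈ β.nodes := by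
    intro i j h
    obtain ⟨t, -, rfl | rfl⟩ := mem_edges_cov.1 h
    · exact mem_nodes_subject.2 ⟨_, rfl⟩
    · exact mem_nodes_subject.2 ⟨_, rfl⟩
  have e3 : ∀ {i j}, Sum.inr (i, j) ∈ β.edges → Sum.inr j ∈ β.nodes := by
    intro i j h
    obtain ⟨t, ht, -⟩ := mem_edges_cov.1 h
    exact mem_nodes_cov.2 ⟨_, ht⟩
  -- a step has at most as many nodes as edges outside `β`
  have hle : ∀ t, (stepNodes (α.f t) (α.c t) \ β.nodes).card ≤
      (stepEdges (α.f t) (α.f (t + 1)) (α.c t) \ β.edges).card := by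
    intro t
    rcases h : α.c t with l | j
    · by_cases hv : Sum.inl (α.f t) ∈ β.nodes
      · simp [stepNodes, Finset.sdiff_eq_empty_iff_subset.2 (Finset.singleton_subset_iff.2 hv)]
      · have : Sum.inl (l, s(α.f t, α.f (t + 1))) ∉ β.edges := fun h => hv (e1 h (by simp))
        simp only [stepNodes, stepEdges]
        rw [Finset.sdiff_eq_self_of_disjoint (by simpa using hv),
          Finset.sdiff_eq_self_of_disjoint (by simpa using this)]
        simp
    · have hf := α.f_ne_succ hk t
      simp only [stepNodes, stepEdges]
      by_cases hv : Sum.inl (α.f t) ∈ β.nodes <;> by_cases hj : Sum.inr j ∈ β.nodes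
      · rw [Finset.sdiff_eq_empty_iff_subset.2
          (Finset.insert_subset hv (Finset.singleton_subset_iff.2 hj))]
        simp
      · have h2 : Sum.inr (α.f (t + 1), j) ∉ β.edges := fun h => hj (e3 h)
        rw [Finset.insert_sdiff_of_mem _ hv]
        refine (Finset.card_le_card Finset.sdiff_subset).trans ?_
        rw [Finset.card_singleton]
        exact Finset.card_pos.2 ⟨Sum.inr (α.f (t + 1), j), by simp [h2]⟩
      · have h1 : Sum.inr (α.f t, j) ∉ β.edges := fun h => hv (e2 h)
        rw [Finset.insert_sdiff_of_notMem _ hv,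
          Finset.sdiff_eq_empty_iff_subset.2 (Finset.singleton_subset_iff.2 hj)]
        exact Finset.card_pos.2 ⟨Sum.inr (α.f t, j), by simp [h1]⟩
      · have h1 : Sum.inr (α.f t, j) ∉ β.edges := fun h => hv (e2 h)
        have h2 : Sum.inr (α.f (t + 1), j) ∉ β.edges := fun h => hj (e3 h)
        rw [Finset.sdiff_eq_self_of_disjoint (s := {Sum.inr (α.f t, j), _}) (by simp [h1, h2])]
        refine (Finset.card_le_card Finset.sdiff_subset).trans ?_
        rw [Finset.card_pair (by simp), Finset.card_pair (by simpa using hf)]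
  by_contra hlt
  have heq : ∀ t, (stepNodes (α.f t) (α.c t) \ β.nodes).card =
      (stepEdges (α.f t) (α.f (t + 1)) (α.c t) \ β.edges).card := by
    intro t
    by_contra hcon
    exact hlt (Finset.sum_lt_sum (fun t _ => hle t)
      ⟨t, Finset.mem_univ _, lt_of_le_of_ne (hle t) hcon⟩)
  have hstep : ∀ t, (¬ Disjoint (stepNodes (α.f t) (α.c t)) β.nodes) →
      stepEdges (α.f t) (α.f (t + 1)) (α.c t) ⊆ β.edges ∨
      (Sum.inl (α.f t) ∉ β.nodes ∧ Sum.inl (α.f (t + 1)) ∈ β.nodes) := by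
    intro t ht
    have hh := heq t
    have hf := α.f_ne_succ hk t
    rcases h : α.c t with l | j
    · left
      simp only [h, stepNodes, stepEdges, Finset.disjoint_singleton_left, not_not] at hh ht ⊢
      rw [Finset.sdiff_eq_empty_iff_subset.2 (Finset.singleton_subset_iff.2 ht),
        Finset.card_empty] at hh
      exact Finset.sdiff_eq_empty_iff_subset.1 (Finset.card_eq_zero.1 hh.symm)
    · simp only [h, stepNodes, stepEdges] at hh ht ⊢
      by_cases hv : Sum.inl (α.f t) ∈ β.nodes
      · left
        by_cases hj : Sum.inr j ∈ β.nodes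
        · rw [Finset.sdiff_eq_empty_iff_subset.2
            (Finset.insert_subset hv (Finset.singleton_subset_iff.2 hj)), Finset.card_empty] at hh
          exact Finset.sdiff_eq_empty_iff_subset.1 (Finset.card_eq_zero.1 hh.symm)
        · have h1 : Sum.inr (α.f t, j) ∉ β.edges := fun h => hj (e3 h)
          have h2 : Sum.inr (α.f (t + 1), j) ∉ β.edges := fun h => hj (e3 h)
          rw [Finset.insert_sdiff_of_mem _ hv,
            Finset.sdiff_eq_self_of_disjoint (s := {Sum.inr (α.f t, j), _}) (by simp [h1, h2]),
            Finset.sdiff_eq_self_of_disjoint (by simpa using hj), Finset.card_singleton,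
            Finset.card_pair (by simpa using hf)] at hh
          omega
      · right
        refine ⟨hv, ?_⟩
        have hj : Sum.inr j ∈ β.nodes := by
          by_contra hj
          exact ht (by simp [hv, hj])
        have h1 : Sum.inr (α.f t, j) ∉ β.edges := fun h => hv (e2 h)
        by_contra hv'
        have h2 : Sum.inr (α.f (t + 1), j) ∉ β.edges := fun h => hv' (e2 h)
        rw [Finset.insert_sdiff_of_notMem _ hv,
          Finset.sdiff_eq_self_of_disjoint (s := {Sum.inr (α.f t, j), _}) (by simp [h1, h2]),
          Finset.sdiff_eq_empty_iff_subset.2 (Finset.singleton_subset_iff.2 hj),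
          Finset.card_pair (by simpa using hf)] at hh
        simp at hh
  have hnext : ∀ t, stepEdges (α.f t) (α.f (t + 1)) (α.c t) ⊆ β.edges →
      Sum.inl (α.f (t + 1)) ∈ β.nodes := by
    intro t ht
    rcases h : α.c t with l | j
    · simp only [h, stepEdges, Finset.singleton_subset_iff] at ht
      exact e1 ht (by simp)
    · simp only [h, stepEdges, Finset.insert_subset_iff, Finset.singleton_subset_iff] at ht
      exact e2 ht.2
  have hself : ∀ t, Sum.inl (α.f t) ∈ stepNodes (p := p) (α.f t) (α.c t) := by
    intro t
    rcases h : α.c t with l | j <;> simp [stepNodes]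
  have hnd : ∀ t, Sum.inl (α.f t) ∈ β.nodes → ¬ Disjoint (stepNodes (α.f t) (α.c t)) β.nodes :=
    fun t ht hd => Finset.disjoint_left.1 hd (hself t) ht
  have hkey : ∀ t, Sum.inl (α.f t) ∈ β.nodes →
      stepEdges (α.f t) (α.f (t + 1)) (α.c t) ⊆ β.edges := by
    intro t ht
    rcases hstep t (hnd t ht) with h | h
    · exact h
    · exact absurd ht h.1
  obtain ⟨v, hvα, hvβ⟩ := Finset.not_disjoint_iff.1 hmeet
  obtain ⟨t, -, htv⟩ := Finset.mem_biUnion.1 hvα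
  have ht1 : Sum.inl (α.f (t + 1)) ∈ β.nodes := by
    rcases hstep t (Finset.not_disjoint_iff.2 ⟨v, htv, hvβ⟩) with h | h
    · exact hnext t h
    · exact h.2
  have hall := zmod_forall_of_step (P := fun t => Sum.inl (α.f t) ∈ β.nodes)
    (fun t ht => hnext t (hkey t ht)) ht1
  exact hne (Finset.biUnion_subset.2 fun t _ => hkey t (hall t))

/-- The union of two different cycles that meet has more edges than nodes. -/
lemma card_nodes_union_lt (hk : 3 ≤ k) {α β : MixedCycle m n p k}
    (hmeet : ¬ Disjoint α.nodes β.nodes) (hne : α.edges ≠ β.edges) :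
    (α.nodes ∪ β.nodes).card + 1 ≤ (α.edges ∪ β.edges).card := by
  have key : ∀ {α β : MixedCycle m n p k}, ¬ Disjoint α.nodes β.nodes → ¬ α.edges ⊆ β.edges →
      (α.nodes ∪ β.nodes).card + 1 ≤ (α.edges ∪ β.edges).card := by
    intro α β h1 h2
    have h3 := card_sdiff_lt hk h1 h2
    have h4 := β.card_edges_eq_card_nodes hk
    rw [← Finset.card_sdiff_add_card, ← Finset.card_sdiff_add_card]
    omega
  by_cases h : α.edges ⊆ β.edges
  · rw [Finset.union_comm, Finset.union_comm α.edges]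
    refine key (fun hd => hmeet hd.symm) fun h' => hne (h.antisymm h')
  · exact key hmeet h

lemma firstEdge_mem (α : MixedCycle m n p k) (t : ZMod k) : α.firstEdge t ∈ α.edges := by
  refine Finset.mem_biUnion.2 ⟨t, Finset.mem_univ _, ?_⟩
  rcases h : α.c t with l | j <;> simp [firstEdge, stepEdges, h]

/-- A cycle is determined by its edges, its starting point and its first edge: every node meets
just two edges, so the walk can only go on by the edge through which it did not arrive. -/
lemma eq_of_edges_eq (hk : 3 ≤ k) {α β : MixedCycle m n p k} (hE : α.edges = β.edges)
    (h0 : α.f 0 = β.f 0) (h1 : α.firstEdge 0 = β.firstEdge 0) : α = β := by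
  have key : ∀ t, α.f t = β.f t ∧ α.firstEdge t = β.firstEdge t := by
    intro t
    refine zmod_forall_of_step (P := fun t => α.f t = β.f t ∧ α.firstEdge t = β.firstEdge t)
      ?_ ⟨h0, h1⟩ t
    rintro t ⟨hf, he⟩
    have hc := c_eq_of_firstEdge_eq he
    have hf1 : α.f (t + 1) = β.f (t + 1) := by
      rcases h : α.c t with l | j
      · have h' := hc ▸ h
        simp only [firstEdge, h, h', Sum.elim_inl, Sum.inl.injEq, Prod.mk.injEq, true_and, hf] at he
        exact Sym2.congr_right.1 he
      · have hmem : Sum.inr (α.f (t + 1), j) ∈ β.edges :=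
          hE ▸ mem_edges_cov.2 ⟨t, h, Or.inr rfl⟩
        obtain ⟨s, hs, hs'⟩ := mem_edges_cov.1 hmem
        obtain rfl := β.c_inj hs (hc ▸ h)
        rcases hs' with hs' | hs'
        · exact absurd (hf.trans hs'.symm) (α.f_ne_succ hk s)
        · exact hs'
    refine ⟨hf1, ?_⟩
    have hmem : α.firstEdge (t + 1) ∈ β.edges := hE ▸ α.firstEdge_mem _
    rcases h : α.c (t + 1) with l | j
    · simp only [firstEdge, h, Sum.elim_inl] at hmem ⊢
      obtain ⟨s, hs, hs'⟩ := mem_edges_layer.1 hmem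
      rcases Sym2.eq_iff.1 hs' with ⟨h2, h3⟩ | ⟨h2, h3⟩
      · rw [hf1] at h2
        obtain rfl := β.f_inj h2
        simp [hs, hs']
      · rw [hf1] at h2
        obtain rfl : t = s := add_right_cancel (β.f_inj h2)
        rw [← hf] at h3
        exact absurd (α.f_inj h3) (zmod_add_one_add_one_ne hk t)
    · simp only [firstEdge, h, Sum.elim_inr] at hmem ⊢
      obtain ⟨s, hs, hs' | hs'⟩ := mem_edges_cov.1 hmem
      · rw [hf1] at hs'
        obtain rfl := β.f_inj hs'
        simp [hs, hf1]
      · rw [hf1] at hs'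
        obtain rfl : t = s := add_right_cancel (β.f_inj hs')
        exact absurd (α.c_inj h (hc.trans hs)) (zmod_add_one_ne hk t)
  exact ext' (fun t => (key t).1) fun t => c_eq_of_firstEdge_eq (key t).2

open Classical in
/-- A cycle with the edges of `α` is given by its starting point, one of at most `k`, and its
first edge, one of at most `2 * k`. -/
lemma card_edges_eq_le (hk : 3 ≤ k) (α : MixedCycle m n p k) :
    (Finset.univ.filter fun β : MixedCycle m n p k => α.edges = β.edges).card ≤ 2 * k ^ 2 := by
  have h1 : (Finset.univ.filter fun β : MixedCycle m n p k => α.edges = β.edges).card ≤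
      ((Finset.univ.image α.f) ×ˢ α.edges).card := by
    refine Finset.card_le_card_of_injOn (fun β => (β.f 0, β.firstEdge 0)) ?_ ?_
    · intro β hβ
      have hβ : α.edges = β.edges := by simpa using hβ
      simp only [Finset.coe_product, Set.mem_prod, Finset.mem_coe, Finset.mem_image,
        Finset.mem_univ, true_and]
      refine ⟨?_, hβ ▸ β.firstEdge_mem 0⟩
      have hm := β.firstEdge_mem 0
      rw [← hβ] at hm
      rcases h : β.c 0 with l | j
      · simp only [firstEdge, h, Sum.elim_inl] at hm
        obtain ⟨t, -, ht⟩ := mem_edges_layer.1 hm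
        rcases Sym2.eq_iff.1 ht with ⟨h1, -⟩ | ⟨h1, -⟩
        · exact ⟨_, h1.symm⟩
        · exact ⟨_, h1.symm⟩
      · simp only [firstEdge, h, Sum.elim_inr] at hm
        obtain ⟨t, -, h1 | h1⟩ := mem_edges_cov.1 hm
        · exact ⟨_, h1.symm⟩
        · exact ⟨_, h1.symm⟩
    · intro β hβ β' hβ' h
      have hβ : α.edges = β.edges := by simpa using hβ
      have hβ' : α.edges = β'.edges := by simpa using hβ'
      simp only [Prod.mk.injEq] at h
      exact eq_of_edges_eq hk (hβ.symm.trans hβ') h.1 h.2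
  refine h1.trans ?_
  rw [Finset.card_product]
  have h2 : (Finset.univ.image α.f).card ≤ k :=
    Finset.card_image_le.trans (by simp [ZMod.card])
  calc _ ≤ k * (2 * k) := Nat.mul_le_mul h2 α.card_edges_le
    _ = 2 * k ^ 2 := by ring

end MixedCycle

/-! ### Counting pairs of mixed cycles by their nodes -/

lemma MixedCycle.card_nodes_subset_le {m n p k : ℕ} [NeZero k] (W : Finset (Node n p)) :
    Fintype.card {α : MixedCycle m n p k // α.nodes ⊆ W} ≤ W.card ^ k * (m + W.card) ^ k := by
  let φ : {α : MixedCycle m n p k // α.nodes ⊆ W} → (ZMod k → W) × (ZMod k → Fin m ⊕ W) :=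
    fun α => (fun t => ⟨Sum.inl (α.1.f t), α.2 (mem_nodes_subject.2 ⟨t, rfl⟩)⟩,
      fun t => match h : α.1.c t with
        | Sum.inl l => Sum.inl l
        | Sum.inr j => Sum.inr ⟨Sum.inr j, α.2 (mem_nodes_cov.2 ⟨t, h⟩)⟩)
  have hφ : Function.Injective φ := by
    intro α β h
    rw [Prod.ext_iff] at h
    refine Subtype.ext (MixedCycle.ext' (fun t => ?_) fun t => ?_)
    · have := congrFun h.1 t
      simpa [φ] using this
    · have := congrFun h.2 t
      simp only [φ] at this
      split at this <;> split at this <;> simp_all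
  refine (Fintype.card_le_of_injective φ hφ).trans (le_of_eq ?_)
  simp [ZMod.card]

/-- Pairs of mixed cycles weighted by `x` to the number of their nodes: the weight of all finite
sets of nodes is `(1 + x) ^ (n + p)`, and a set of nodes carries boundedly many pairs. -/
lemma MixedCycle.sum_pow_card_nodes_le {m n p k : ℕ} [NeZero k] {x : ℝ} (hx : 0 ≤ x) :
    ∑ α : MixedCycle m n p k, ∑ β : MixedCycle m n p k, x ^ (α.nodes ∪ β.nodes).card ≤
      (((4 * k) ^ k * (m + 4 * k) ^ k) ^ 2 : ℕ) * (1 + x) ^ (n + p) := by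
  classical
  rw [← Fintype.sum_prod_type']
  have h1 := Finset.sum_fiberwise (s := (Finset.univ : Finset (MixedCycle m n p k × MixedCycle m n p k)))
    (g := fun q => q.1.nodes ∪ q.2.nodes) (f := fun q => x ^ (q.1.nodes ∪ q.2.nodes).card)
  rw [← h1]
  have h2 : (1 + x) ^ (n + p) = ∑ W : Finset (Node n p), x ^ W.card := by
    have := Fintype.sum_pow_mul_eq_add_pow (Node n p) x 1
    simp only [one_pow, mul_one, Fintype.card_sum, Fintype.card_fin] at this
    rw [this, add_comm]
  rw [h2, Finset.mul_sum]
  refine Finset.sum_le_sum fun W _ => ?_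
  have h3 : ∑ q : MixedCycle m n p k × MixedCycle m n p k with q.1.nodes ∪ q.2.nodes = W,
      x ^ (q.1.nodes ∪ q.2.nodes).card =
      ((Finset.univ.filter fun q : MixedCycle m n p k × MixedCycle m n p k =>
        q.1.nodes ∪ q.2.nodes = W).card : ℝ) * x ^ W.card := by
    rw [Finset.sum_congr rfl (g := fun _ => x ^ W.card), Finset.sum_const, nsmul_eq_mul]
    intro q hq
    rw [(Finset.mem_filter.1 hq).2]
  rw [h3]
  refine mul_le_mul_of_nonneg_right ?_ (pow_nonneg hx _)
  rw [Nat.cast_le]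
  by_cases hW : W.card ≤ 4 * k
  · have h4 : (Finset.univ.filter fun q : MixedCycle m n p k × MixedCycle m n p k =>
        q.1.nodes ∪ q.2.nodes = W) ⊆
        (Finset.univ.filter fun α : MixedCycle m n p k => α.nodes ⊆ W) ×ˢ
        (Finset.univ.filter fun α : MixedCycle m n p k => α.nodes ⊆ W) := by
      intro q hq
      have := (Finset.mem_filter.1 hq).2
      simp only [Finset.mem_product, Finset.mem_filter, Finset.mem_univ, true_and]
      exact ⟨this ▸ Finset.subset_union_left, this ▸ Finset.subset_union_right⟩
    refine (Finset.card_le_card h4).trans ?_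
    rw [Finset.card_product, ← pow_two]
    refine Nat.pow_le_pow_left ?_ 2
    rw [← Fintype.card_subtype]
    exact (card_nodes_subset_le W).trans (by gcongr)
  · rw [Finset.card_eq_zero.2]
    · exact Nat.zero_le _
    · refine Finset.filter_eq_empty_iff.2 fun q _ hq => hW ?_
      rw [← hq]
      have := q.1.card_nodes_le
      have := q.2.card_nodes_le
      exact (Finset.card_union_le _ _).trans (by omega)

/-! ### Sums over sequences without repetitions in a class -/

open Classical in
/-- Lower bound for a sum over sequences in which the letters of a class `P` are used at most
once: choosing the letters one after the other, at most `L` letters are forbidden each time. -/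
lemma pow_le_sum_exclusive_fin {C : Type*} [Fintype C] (P : C → Prop) (w : C → ℝ)
    (hw : ∀ c, 0 ≤ w c) {w₀ : ℝ} (hw₀ : 0 ≤ w₀) (hP : ∀ c, P c → w c ≤ w₀) {N : ℝ} (L : ℕ)
    (hN : L ≤ N) (hW : N * w₀ ≤ ∑ c, w c) :
    (∑ c, w c - N * w₀) ^ L ≤
      ∑ c : Fin L → C, if ∀ t t', c t = c t' → P (c t) → t = t' then ∏ t, w (c t) else 0 := by
  induction L with
  | zero => simp
  | succ L ih =>
    have ih := ih (le_trans (by push_cast; linarith) hN)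
    have hnn : 0 ≤ ∑ c, w c - N * w₀ := by linarith
    rw [← Equiv.sum_comp (Fin.consEquiv fun _ : Fin (L + 1) => C), Fintype.sum_prod_type_right,
      pow_succ]
    refine (mul_le_mul_of_nonneg_right ih hnn).trans ?_
    rw [Finset.sum_mul]
    refine Finset.sum_le_sum fun c _ => ?_
    split_ifs with hc
    swap
    · rw [zero_mul]
      refine Finset.sum_nonneg fun x _ => ?_
      split_ifs
      · exact Finset.prod_nonneg fun _ _ => hw _
      · exact le_rfl
    have h1 : ∀ x, (if ¬ (P x ∧ ∃ t, c t = x) then (∏ t, w (c t)) * w x else 0) ≤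
        (if ∀ t t', (Fin.consEquiv fun _ : Fin (L + 1) => C) (x, c) t =
            (Fin.consEquiv fun _ : Fin (L + 1) => C) (x, c) t' →
            P ((Fin.consEquiv fun _ : Fin (L + 1) => C) (x, c) t) → t = t' then
          ∏ t, w ((Fin.consEquiv fun _ : Fin (L + 1) => C) (x, c) t) else 0) := by
      intro x
      by_cases hx : P x ∧ ∃ t, c t = x
      · rw [if_neg (not_not.2 hx)]
        split_ifs
        · exact Finset.prod_nonneg fun _ _ => hw _
        · exact le_rfl
      · rw [if_pos hx, if_pos]
        · simp only [Fin.consEquiv, Equiv.coe_fn_mk, Fin.prod_univ_succ, Fin.cons_zero,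
            Fin.cons_succ]
          rw [mul_comm]
        · intro t t'
          simp only [Fin.consEquiv, Equiv.coe_fn_mk]
          refine Fin.cases ?_ (fun t => ?_) t <;> refine Fin.cases ?_ (fun t' => ?_) t'
          · simp
          · simp only [Fin.cons_zero, Fin.cons_succ]
            exact fun h hp => absurd ⟨hp, t', h.symm⟩ hx
          · simp only [Fin.cons_zero, Fin.cons_succ]
            exact fun h hp => absurd ⟨h ▸ hp, t, h⟩ hx
          · simp only [Fin.cons_succ, Fin.succ_inj]
            exact hc t t'
    refine le_trans ?_ (Finset.sum_le_sum fun x _ => h1 x)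
    have h2 : ∀ x, (∏ t, w (c t)) * w x - (∏ t, w (c t)) * (∑ t : Fin L, if c t = x then w₀ else 0)
        ≤ if ¬ (P x ∧ ∃ t, c t = x) then (∏ t, w (c t)) * w x else 0 := by
      intro x
      have hpn : 0 ≤ ∏ t, w (c t) := Finset.prod_nonneg fun _ _ => hw _
      have hsn : ∀ t ∈ (Finset.univ : Finset (Fin L)), (0 : ℝ) ≤ if c t = x then w₀ else 0 := by
        intro t _
        split_ifs
        · exact hw₀
        · exact le_rfl
      by_cases hx : P x ∧ ∃ t, c t = x
      · rw [if_neg (not_not.2 hx), ← mul_sub]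
        obtain ⟨hp, t, ht⟩ := hx
        have h3 := Finset.single_le_sum hsn (Finset.mem_univ t)
        rw [if_pos ht] at h3
        exact mul_nonpos_of_nonneg_of_nonpos hpn (by linarith [hP x hp])
      · rw [if_pos hx]
        have := mul_nonneg hpn (Finset.sum_nonneg hsn)
        linarith
    refine le_trans ?_ (Finset.sum_le_sum fun x _ => h2 x)
    rw [Finset.sum_sub_distrib, ← Finset.mul_sum, ← Finset.mul_sum, ← mul_sub, Finset.sum_comm]
    refine mul_le_mul_of_nonneg_left ?_ (Finset.prod_nonneg fun _ _ => hw _)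
    simp only [Finset.sum_ite_eq, Finset.mem_univ, if_true, Finset.sum_const, Finset.card_univ,
      Fintype.card_fin, nsmul_eq_mul]
    have : (L : ℝ) * w₀ ≤ N * w₀ :=
      mul_le_mul_of_nonneg_right (le_trans (by push_cast; linarith) hN) hw₀
    linarith

open Classical in
lemma pow_le_sum_exclusive {ι C : Type*} [Fintype ι] [DecidableEq ι] [Fintype C] (P : C → Prop)
    (w : C → ℝ)
    (hw : ∀ c, 0 ≤ w c) {w₀ : ℝ} (hw₀ : 0 ≤ w₀) (hP : ∀ c, P c → w c ≤ w₀)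
    (hW : Fintype.card ι * w₀ ≤ ∑ c, w c) :
    (∑ c, w c - Fintype.card ι * w₀) ^ Fintype.card ι ≤
      ∑ c : ι → C, if ∀ t t', c t = c t' → P (c t) → t = t' then ∏ t, w (c t) else 0 := by
  refine (pow_le_sum_exclusive_fin P w hw hw₀ hP (Fintype.card ι) le_rfl hW).trans (le_of_eq ?_)
  refine Fintype.sum_equiv ((Fintype.equivFin ι).symm.arrowCongr (Equiv.refl C)) _ _ fun c => ?_
  have h1 : (∀ t t', c t = c t' → P (c t) → t = t') ↔
      ∀ t t', ((Fintype.equivFin ι).symm.arrowCongr (Equiv.refl C)) c t =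
        ((Fintype.equivFin ι).symm.arrowCongr (Equiv.refl C)) c t' →
        P (((Fintype.equivFin ι).symm.arrowCongr (Equiv.refl C)) c t) → t = t' := by
    simp only [Equiv.arrowCongr_apply, Equiv.symm_symm, Equiv.coe_refl, Function.comp_apply, id]
    constructor
    · intro h t t' h1 h2
      exact (Fintype.equivFin ι).injective (h _ _ h1 h2)
    · intro h t t' h1 h2
      have := h ((Fintype.equivFin ι).symm t) ((Fintype.equivFin ι).symm t')
      simp only [Equiv.apply_symm_apply, EmbeddingLike.apply_eq_iff_eq] at this
      exact this h1 h2
  have h2 : ∏ t, w (c t) = ∏ t, w (((Fintype.equivFin ι).symm.arrowCongr (Equiv.refl C)) c t) :=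
    (Equiv.prod_comp (Fintype.equivFin ι) fun t => w (c t)).symm
  rw [h2]
  simp only [h1]

/-! ### Products of labels along a cycle -/

lemma spin_mul_self (s : ℤˣ) : spin s * spin s = 1 := by
  rcases Int.units_eq_one_or s with rfl | rfl <;> simp [spin]

lemma spin_neg (s : ℤˣ) : spin (-s) = -spin s := by simp [spin]

lemma spin_eq_or (s : ℤˣ) : spin s = 1 ∨ spin s = -1 := by
  rcases Int.units_eq_one_or s with rfl | rfl <;> simp [spin]

lemma abs_spin (s : ℤˣ) : |spin s| = 1 := by
  rcases spin_eq_or s with h | h <;> simp [h]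

/-- Summed over the labels, the product of the labels along a set of steps of a cycle vanishes
unless the set is empty or the whole cycle: otherwise some label occurs exactly once. -/
lemma sum_prod_spin_eq_zero {n k : ℕ} [NeZero k] {f : ZMod k → Fin n} (hf : Function.Injective f)
    {T : Finset (ZMod k)} (h0 : T ≠ ∅) (h1 : T ≠ Finset.univ) :
    ∑ σ : Fin n → ℤˣ, ∏ t ∈ T, (spin (σ (f t)) * spin (σ (f (t + 1)))) = 0 := by
  obtain ⟨t, htT, ht⟩ : ∃ t ∈ T, t + 1 ∉ T := by
    by_contra! hcon
    obtain ⟨t₀, h₀⟩ := Finset.nonempty_iff_ne_empty.2 h0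
    exact h1 (Finset.eq_univ_iff_forall.2
      (zmod_forall_of_step (P := fun t => t ∈ T) hcon h₀))
  have hne : t ≠ t + 1 := fun h => ht (h ▸ htT)
  let φ : (Fin n → ℤˣ) → (Fin n → ℤˣ) :=
    fun σ => Function.update σ (f (t + 1)) (-σ (f (t + 1)))
  have hφ : ∀ σ s, s ≠ t + 1 → φ σ (f s) = σ (f s) := fun σ s hs =>
    Function.update_of_ne (fun h => hs (hf h)) _ _
  have hφ' : ∀ σ, φ σ (f (t + 1)) = -σ (f (t + 1)) := fun σ => Function.update_self _ _ _
  refine Finset.sum_involution (fun σ _ => φ σ) ?_ ?_ (fun _ _ => Finset.mem_univ _) ?_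
  · intro σ _
    rw [← Finset.mul_prod_erase _ _ htT, ← Finset.mul_prod_erase _ _ htT, hφ σ t hne, hφ' σ,
      spin_neg]
    have : ∏ s ∈ T.erase t, (spin (φ σ (f s)) * spin (φ σ (f (s + 1)))) =
        ∏ s ∈ T.erase t, (spin (σ (f s)) * spin (σ (f (s + 1)))) := by
      refine Finset.prod_congr rfl fun s hs => ?_
      obtain ⟨hst, hsT⟩ := Finset.mem_erase.1 hs
      rw [hφ σ s fun h => ht (h ▸ hsT), hφ σ (s + 1) fun h => hst (add_right_cancel h)]
    rw [this]
    ring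
  · intro σ _ _ h
    have h2 := hφ' σ
    rw [h] at h2
    exact units_ne_neg_self _ h2
  · intro σ _
    simp [φ]

/-- Expanding the product, only the empty set of steps and the full cycle survive the sum over the
labels. -/
lemma sum_prod_one_add_spin_le {n k : ℕ} [NeZero k] {f : ZMod k → Fin n}
    (hf : Function.Injective f) {x : ZMod k → ℝ} (hx0 : ∀ t, 0 ≤ x t) (hx1 : ∀ t, x t ≤ 1) :
    ∑ σ : Fin n → ℤˣ, ∏ t, (1 + x t * (spin (σ (f t)) * spin (σ (f (t + 1))))) ≤ 2 * 2 ^ n := by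
  classical
  simp_rw [Finset.prod_one_add, Finset.powerset_univ]
  rw [Finset.sum_comm]
  have hcard : ∑ _σ : Fin n → ℤˣ, (1 : ℝ) = 2 ^ n := by simp
  have h1 : ∀ T : Finset (ZMod k), ∑ σ : Fin n → ℤˣ,
      ∏ t ∈ T, x t * (spin (σ (f t)) * spin (σ (f (t + 1)))) ≤
      (if T = ∅ then 2 ^ n else 0) + (if T = Finset.univ then 2 ^ n else 0) := by
    intro T
    by_cases h0 : T = ∅
    · rw [if_pos h0, h0]
      simp only [Finset.prod_empty, hcard]
      split_ifs <;> simp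
    by_cases h1 : T = Finset.univ
    · rw [if_neg h0, if_pos h1, zero_add, ← hcard]
      refine Finset.sum_le_sum fun σ _ => (le_abs_self _).trans ?_
      rw [Finset.abs_prod]
      refine Finset.prod_le_one (fun _ _ => abs_nonneg _) fun t _ => ?_
      rw [abs_mul, abs_mul, abs_spin, abs_spin, abs_of_nonneg (hx0 t)]
      simpa using hx1 t
    · rw [if_neg h0, if_neg h1, add_zero]
      simp_rw [Finset.prod_mul_distrib (f := x)]
      rw [← Finset.mul_sum, sum_prod_spin_eq_zero hf h0 h1, mul_zero]
  refine (Finset.sum_le_sum fun T _ => h1 T).trans (le_of_eq ?_)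
  rw [Finset.sum_add_distrib]
  simp
  ring

/-! ### Moments of the edge variables -/

lemma integrable_one_add_sq_pow_gaussian (N : ℕ) :
    Integrable (fun z : ℝ => (1 + z ^ 2) ^ N) (gaussianReal 0 1) := by
  have h1 : Integrable (fun z : ℝ => z ^ (2 * N)) (gaussianReal 0 1) := by
    rcases Nat.eq_zero_or_pos N with rfl | hN
    · simp
    have h := (memLp_id_gaussianReal (μ := 0) (v := 1) ((2 * N : ℕ) : NNReal))
    have h2 := MemLp.integrable_norm_pow (p := 2 * N) (by simpa using h) (by omega)
    refine h2.congr (Eventually.of_forall fun z => ?_)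
    simp [pow_mul]
  refine Integrable.mono' (((integrable_const (1 : ℝ)).add h1).const_mul (2 ^ (N - 1))) (by fun_prop)
    (Eventually.of_forall fun z => ?_)
  rw [Real.norm_of_nonneg (by positivity)]
  have := add_pow_le (zero_le_one' ℝ) (sq_nonneg z) N
  simpa [pow_mul] using this

lemma integrable_id_gaussian : Integrable (fun z : ℝ => z) (gaussianReal 0 1) := by
  refine Integrable.mono' (integrable_one_add_sq_pow_gaussian 1) (by fun_prop)
    (Eventually.of_forall fun z => ?_)
  rw [Real.norm_eq_abs, abs_le]
  constructor <;> nlinarith [sq_nonneg (z + 1), sq_nonneg (z - 1)]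

lemma integrable_sq_gaussian : Integrable (fun z : ℝ => z ^ 2) (gaussianReal 0 1) := by
  refine Integrable.mono' (integrable_one_add_sq_pow_gaussian 1) (by fun_prop)
    (Eventually.of_forall fun z => ?_)
  rw [Real.norm_of_nonneg (by positivity)]
  linarith

lemma integral_sq_gaussian : ∫ z : ℝ, z ^ 2 ∂(gaussianReal 0 1) = 1 := by
  have h := variance_fun_id_gaussianReal (μ := 0) (v := 1)
  rw [variance_of_integral_eq_zero (by fun_prop) (by simp)] at h
  simpa using h

lemma integral_add_gaussian (a : ℝ) : ∫ z : ℝ, (a + z) ∂(gaussianReal 0 1) = a := by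
  rw [integral_add (integrable_const _) integrable_id_gaussian]
  simp

lemma integral_add_sq_gaussian (a : ℝ) :
    ∫ z : ℝ, (a + z) ^ 2 ∂(gaussianReal 0 1) = a ^ 2 + 1 := by
  have : ∀ z : ℝ, (a + z) ^ 2 = (a ^ 2 + 2 * a * z) + z ^ 2 := fun z => by ring
  simp_rw [this]
  rw [integral_add (f := fun z => a ^ 2 + 2 * a * z)
    ((integrable_const _).add (integrable_id_gaussian.const_mul _))
    integrable_sq_gaussian, integral_add (integrable_const _) (integrable_id_gaussian.const_mul _),
    integral_const_mul, integral_sq_gaussian]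
  simp

lemma edgeProb_comm (d lam : ℝ) (n : ℕ) (s t : ℤˣ) :
    edgeProb d lam n s t = edgeProb d lam n t s := by
  simp [edgeProb, eq_comm]

/-- The projection in `edgeProb` does nothing when the degrees are admissible, and the two cases
are one formula in the labels. -/
lemma edgeProb_val {d lam : ℝ} {n : ℕ} (hd : 1 < d) (h0 : 0 ≤ lam) (h1 : lam ≤ √d)
    (hn : 2 * d ≤ n) (s t : ℤˣ) :
    (edgeProb d lam n s t : ℝ) = d / n * (1 + lam / √d * (spin s * spin t)) := by
  have hn0 : (0 : ℝ) < n := by linarith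
  have hs : 0 < √d := Real.sqrt_pos.2 (by linarith)
  have hss : √d * √d = d := Real.mul_self_sqrt (by linarith)
  have hl : lam * √d ≤ d := by nlinarith
  have hl0 : 0 ≤ lam * √d := by positivity
  have hv : (if s = t then d + lam * √d else d - lam * √d) =
      d * (1 + lam / √d * (spin s * spin t)) := by
    have h2 : d * (lam / √d) = lam * √d := by
      field_simp
      rw [pow_two, hss]
      ring
    rcases Int.units_eq_one_or s with rfl | rfl <;> rcases Int.units_eq_one_or t with rfl | rfl <;>
      simp [spin, mul_add, h2] <;> ring
  rw [edgeProb, Set.projIcc_of_mem]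
  · simp only
    rw [hv]
    ring
  · constructor
    · apply div_nonneg _ hn0.le
      split_ifs <;> linarith
    · rw [div_le_one hn0]
      split_ifs <;> linarith

/-- `edgeProb` as a function of an unordered pair of subjects. -/
def pairProb (d lam : ℝ) {n : ℕ} (σ : Fin n → ℤˣ) : Sym2 (Fin n) → unitInterval :=
  Sym2.lift ⟨fun i j => edgeProb d lam n (σ i) (σ j), fun _ _ => edgeProb_comm _ _ _ _ _⟩

/-- The product of the two labels of an unordered pair of subjects. -/
def pairSpin {n : ℕ} (σ : Fin n → ℤˣ) : Sym2 (Fin n) → ℝ :=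
  Sym2.lift ⟨fun i j => spin (σ i) * spin (σ j), fun _ _ => mul_comm _ _⟩

@[simp] lemma pairSpin_mk {n : ℕ} (σ : Fin n → ℤˣ) (i j : Fin n) :
    pairSpin σ s(i, j) = spin (σ i) * spin (σ j) := rfl

@[simp] lemma pairProb_mk (d lam : ℝ) {n : ℕ} (σ : Fin n → ℤˣ) (i j : Fin n) :
    pairProb d lam σ s(i, j) = edgeProb d lam n (σ i) (σ j) := rfl

lemma abs_pairSpin {n : ℕ} (σ : Fin n → ℤˣ) (s : Sym2 (Fin n)) : |pairSpin σ s| = 1 := by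
  induction s with
  | _ i j => simp [abs_mul, abs_spin]

lemma pairProb_val {d lam : ℝ} {n : ℕ} (hd : 1 < d) (h0 : 0 ≤ lam) (h1 : lam ≤ √d)
    (hn : 2 * d ≤ n) (σ : Fin n → ℤˣ) (s : Sym2 (Fin n)) :
    (pairProb d lam σ s : ℝ) = d / n * (1 + lam / √d * pairSpin σ s) := by
  induction s with
  | _ i j => simp [edgeProb_val hd h0 h1 hn]

/-- The variable attached to an edge of the factor graph: the centred and weighted edge indicator
in a layer, or the weighted covariate entry. -/
def edgeStat {m n p : ℕ} (d lam : Fin m → ℝ) (μ : ℝ) (D : Data m n p) : Edge m n p → ℝ :=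
  open Classical in
  Sum.elim
    (fun e => lam e.1 / √(d e.1) * ((if e.2 ∈ (D.1 e.1).edgeSet then 1 else 0) - d e.1 / n))
    (fun e => √(μ / n) * D.2 e.1 e.2)

/-- The conditional moment of order `r` of the variable of an edge, given the labels `σ` and the
vector `u`, when the data have the parameters `lam'` and `μ'`. -/
def edgeMoment {m n p : ℕ} (d lam : Fin m → ℝ) (μ : ℝ) (lam' : Fin m → ℝ) (μ' : ℝ)
    (σ : Fin n → ℤˣ) (u : Fin p → ℝ) : Edge m n p → ℕ → ℝ :=
  Sum.elim
    (fun e r => ∫ b, (lam e.1 / √(d e.1) * ((if b = true then 1 else 0) - d e.1 / n)) ^ r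
      ∂(bernoulliMeasure true false (pairProb (d e.1) (lam' e.1) σ e.2)))
    (fun e r => ∫ z, (√(μ / n) * (√(μ' / n) * spin (σ e.1) * u e.2 + z)) ^ r ∂(gaussianReal 0 1))

section moments

variable {m n p : ℕ} {d lam lam' : Fin m → ℝ} {μ μ' : ℝ} {σ : Fin n → ℤˣ}

lemma edgeMoment_zero (u : Fin p → ℝ) (e : Edge m n p) :
    edgeMoment d lam μ lam' μ' σ u e 0 = 1 := by
  rcases e with e | e <;> simp [edgeMoment]

lemma edgeMoment_inr_one (u : Fin p → ℝ) (i : Fin n) (j : Fin p) :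
    edgeMoment d lam μ lam' μ' σ u (Sum.inr (i, j)) 1 =
      √(μ / n) * √(μ' / n) * spin (σ i) * u j := by
  simp only [edgeMoment, Sum.elim_inr, pow_one]
  rw [integral_const_mul, integral_add_gaussian]
  ring

lemma edgeMoment_inr_two (hμ : 0 ≤ μ) (hμ' : 0 ≤ μ') (u : Fin p → ℝ) (i : Fin n) (j : Fin p) :
    edgeMoment d lam μ lam' μ' σ u (Sum.inr (i, j)) 2 = μ / n * (1 + μ' / n * u j ^ 2) := by
  simp only [edgeMoment, Sum.elim_inr, mul_pow √(μ / n)]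
  rw [integral_const_mul, integral_add_sq_gaussian, Real.sq_sqrt (by positivity), mul_pow, mul_pow,
    Real.sq_sqrt (by positivity), pow_two (spin (σ i)), spin_mul_self]
  ring

lemma edgeMoment_inl_one {l : Fin m} (hd : 1 < d l) (h0 : 0 ≤ lam' l) (h1 : lam' l ≤ √(d l))
    (hn : 2 * d l ≤ n) (u : Fin p → ℝ) (s : Sym2 (Fin n)) :
    edgeMoment d lam μ lam' μ' σ u (Sum.inl (l, s)) 1 = lam l * lam' l / n * pairSpin σ s := by
  have hn0 : (0 : ℝ) < n := by linarith
  have hs : 0 < √(d l) := Real.sqrt_pos.2 (by linarith)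
  have hss : √(d l) ^ 2 = d l := Real.sq_sqrt (by linarith)
  simp only [edgeMoment, Sum.elim_inl, pow_one]
  rw [integral_bernoulliMeasure]
  simp only [pairProb_val hd h0 h1 hn, smul_eq_mul]
  simp only [if_true, Bool.false_eq_true, if_false]
  field_simp
  rw [hss]
  ring

/-- The second moment of an edge indicator depends on the labels to first order; this is why the
second moment of a whole cycle has to be averaged over the labels. -/
lemma edgeMoment_inl_two {l : Fin m} (hd : 1 < d l) (h0 : 0 ≤ lam' l) (h1 : lam' l ≤ √(d l))
    (hn : 2 * d l ≤ n) (u : Fin p → ℝ) (s : Sym2 (Fin n)) :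
    edgeMoment d lam μ lam' μ' σ u (Sum.inl (l, s)) 2 =
      lam l ^ 2 / n * (1 - d l / n + lam' l / √(d l) * (1 - 2 * d l / n) * pairSpin σ s) := by
  have hn0 : (0 : ℝ) < n := by linarith
  have hs : 0 < √(d l) := Real.sqrt_pos.2 (by linarith)
  have hss : √(d l) ^ 2 = d l := Real.sq_sqrt (by linarith)
  simp only [edgeMoment, Sum.elim_inl]
  rw [integral_bernoulliMeasure]
  simp only [pairProb_val hd h0 h1 hn, smul_eq_mul]
  simp only [if_true, Bool.false_eq_true, if_false]
  rw [mul_pow, mul_pow, div_pow, hss]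
  field_simp
  ring

lemma measurable_edgeStat (e : Edge m n p) :
    Measurable fun D : Data m n p => edgeStat d lam μ D e := by
  rcases e with ⟨l, s⟩ | ⟨i, j⟩
  · simp only [edgeStat, Sum.elim_inl]
    refine Measurable.const_mul (Measurable.sub_const (Measurable.ite ?_ measurable_const
      measurable_const) _) _
    have h1 : Measurable fun D : Data m n p => (D.1 l).edgeSet :=
      SimpleGraph.measurable_edgeSet.comp ((measurable_pi_apply l).comp measurable_fst)
    exact (measurable_set_mem s).comp h1 |>.setOf
  · simp only [edgeStat, Sum.elim_inr]
    fun_prop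

/-- The data as a function of the edge indicators, of `u` and of the noise. -/
def dataOf (μ' : ℝ) (σ : Fin n → ℤˣ)
    (ω : (Fin m → Pairs n → Bool) × ((Fin p → ℝ) × (Fin n → Fin p → ℝ))) : Data m n p :=
  (fun l => graphOf (ω.1 l), fun i j => √(μ' / (n : ℝ)) * spin (σ i) * ω.2.1 j + ω.2.2 i j)

/-- The law of the edge indicators given the labels. -/
def indicatorLaw (d lam' : Fin m → ℝ) (σ : Fin n → ℤˣ) : Measure (Fin m → Pairs n → Bool) :=
  Measure.pi fun l => Measure.pi fun q : Pairs n =>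
    bernoulliMeasure true false (edgeProb (d l) (lam' l) n (σ q.1.1) (σ q.1.2))

/-- The law of `u` and the noise. -/
def noiseLaw (n p : ℕ) : Measure ((Fin p → ℝ) × (Fin n → Fin p → ℝ)) :=
  (Measure.pi fun _ : Fin p => gaussianReal 0 1).prod
    (Measure.pi fun _ : Fin n => Measure.pi fun _ : Fin p => gaussianReal 0 1)

instance : IsProbabilityMeasure (indicatorLaw d lam' σ) := by
  unfold indicatorLaw; infer_instance

instance : IsProbabilityMeasure (noiseLaw n p) := by
  unfold noiseLaw; infer_instance

lemma measurable_graphOf : Measurable (graphOf : (Pairs n → Bool) → SimpleGraph (Fin n)) :=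
  Measurable.of_discrete

lemma measurable_dataOf : Measurable (dataOf (m := m) (p := p) μ' σ) := by
  unfold dataOf
  refine Measurable.prodMk (measurable_pi_lambda _ fun l =>
    measurable_graphOf.comp ((measurable_pi_apply l).comp measurable_fst)) ?_
  fun_prop

lemma condLaw_eq_map : condLaw d lam' μ' p σ =
    ((indicatorLaw d lam' σ).prod (noiseLaw n p)).map (dataOf μ' σ) := by
  have h1 : (Measure.pi fun k => sbmLaw (d k) (lam' k) σ) =
      (indicatorLaw d lam' σ).map fun x l => graphOf (x l) := by
    unfold indicatorLaw sbmLaw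
    exact (Measure.pi_map_pi fun l => measurable_graphOf.aemeasurable).symm
  have h2 : Measurable fun (x : Fin m → Pairs n → Bool) l => graphOf (x l) :=
    measurable_pi_lambda _ fun l => measurable_graphOf.comp (measurable_pi_apply l)
  rw [condLaw, h1, covariateLaw, Measure.map_prod_map _ _ h2 (by fun_prop)]
  rfl

instance : IsProbabilityMeasure (condLaw d lam' μ' p σ) := by
  rw [condLaw_eq_map]
  exact Measure.isProbabilityMeasure_map measurable_dataOf.aemeasurable

lemma mem_edgeSet_graphOf (x : Pairs n → Bool) (q : Pairs n) :
    s(q.1.1, q.1.2) ∈ (graphOf x).edgeSet ↔ x q = true := by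
  rw [graphOf, SimpleGraph.edgeSet_fromEdgeSet]
  constructor
  · rintro ⟨⟨q', hq', h⟩, -⟩
    rcases Sym2.eq_iff.1 h with ⟨h1, h2⟩ | ⟨h1, h2⟩
    · rwa [Subtype.ext (Prod.ext h1 h2)]
    · have h3 := q.2
      have h4 := q'.2
      rw [h1, h2] at h3
      exact absurd h3 (not_lt.2 h4.le)
  · intro h
    refine ⟨⟨q, h, rfl⟩, ?_⟩
    simpa using q.2.ne

/-- A product over unordered pairs is a product over ordered ones. -/
lemma prod_sym2_eq_prod_pairs (g : Sym2 (Fin n) → ℝ) (hg : ∀ s, s.IsDiag → g s = 1) :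
    ∏ s, g s = ∏ q : Pairs n, g s(q.1.1, q.1.2) := by
  symm
  refine Fintype.prod_of_injective (fun q : Pairs n => s(q.1.1, q.1.2)) ?_ _ _ ?_ fun _ => rfl
  · intro q q' h
    rcases Sym2.eq_iff.1 h with ⟨h1, h2⟩ | ⟨h1, h2⟩
    · exact Subtype.ext (Prod.ext h1 h2)
    · have h3 := q.2
      have h4 := q'.2
      rw [h1, h2] at h3
      exact absurd h3 (not_lt.2 h4.le)
  · intro s hs
    apply hg
    induction s with
    | _ i j =>
      by_contra hij
      apply hs
      rcases lt_or_gt_of_ne (show i ≠ j by simpa using hij) with h | h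
      · exact ⟨⟨(i, j), h⟩, rfl⟩
      · exact ⟨⟨(j, i), h⟩, Sym2.eq_swap⟩

lemma prod_edgeStat_dataOf (r : Edge m n p → ℕ) (hr : ∀ l s, s.IsDiag → r (Sum.inl (l, s)) = 0)
    (ω : (Fin m → Pairs n → Bool) × ((Fin p → ℝ) × (Fin n → Fin p → ℝ))) :
    ∏ e, edgeStat d lam μ (dataOf μ' σ ω) e ^ r e =
      (∏ l, ∏ q : Pairs n, (lam l / √(d l) * ((if ω.1 l q = true then 1 else 0) - d l / n)) ^
        r (Sum.inl (l, s(q.1.1, q.1.2)))) *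
      ∏ i, ∏ j, (√(μ / n) * (√(μ' / n) * spin (σ i) * ω.2.1 j + ω.2.2 i j)) ^
        r (Sum.inr (i, j)) := by
  rw [Fintype.prod_sum_type, Fintype.prod_prod_type, Fintype.prod_prod_type]
  congr 1
  refine Finset.prod_congr rfl fun l _ => ?_
  rw [prod_sym2_eq_prod_pairs]
  · refine Finset.prod_congr rfl fun q _ => ?_
    have h := mem_edgeSet_graphOf (ω.1 l) q
    simp only [edgeStat, dataOf, Sum.elim_inl]
    congr 4
    exact propext h
  · intro s hs
    rw [hr l s hs, pow_zero]

lemma abs_affine_le (a s u z : ℝ) (hs : |s| = 1) :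
    |a * s * u + z| ≤ (|a| + 1) * ((1 + u ^ 2) * (1 + z ^ 2)) := by
  have hu : |u| ≤ 1 + u ^ 2 := by rw [← sq_abs]; nlinarith [sq_nonneg (|u| - 1)]
  have hz : |z| ≤ 1 + z ^ 2 := by rw [← sq_abs]; nlinarith [sq_nonneg (|z| - 1)]
  calc |a * s * u + z| ≤ |a * s * u| + |z| := abs_add_le _ _
    _ = |a| * |u| + |z| := by rw [abs_mul, abs_mul, hs, mul_one]
    _ ≤ |a| * ((1 + u ^ 2) * (1 + z ^ 2)) + (1 + u ^ 2) * (1 + z ^ 2) := by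
        gcongr
        · nlinarith [mul_nonneg (sq_nonneg u) (sq_nonneg z), sq_nonneg z]
        · nlinarith [mul_nonneg (sq_nonneg u) (sq_nonneg z), sq_nonneg u]
    _ = _ := by ring

lemma integrable_noise_prod (a b : ℝ) (r : Fin n → Fin p → ℕ) :
    Integrable (fun w : (Fin p → ℝ) × (Fin n → Fin p → ℝ) =>
      ∏ i, ∏ j, (b * (a * spin (σ i) * w.1 j + w.2 i j)) ^ r i j) (noiseLaw n p) := by
  have h1 : Integrable (fun u : Fin p → ℝ => ∏ j, (1 + u j ^ 2) ^ (∑ i, r i j))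
      (Measure.pi fun _ : Fin p => gaussianReal 0 1) :=
    Integrable.fintype_prod (f := fun j (z : ℝ) => (1 + z ^ 2) ^ (∑ i, r i j)) fun j =>
      integrable_one_add_sq_pow_gaussian _
  have h2 : Integrable (fun R : Fin n → Fin p → ℝ =>
      ∏ i, ∏ j, ((|b| * (|a| + 1)) ^ r i j * (1 + R i j ^ 2) ^ r i j))
      (Measure.pi fun _ : Fin n => Measure.pi fun _ : Fin p => gaussianReal 0 1) :=
    Integrable.fintype_prod (f := fun i (x : Fin p → ℝ) =>
      ∏ j, ((|b| * (|a| + 1)) ^ r i j * (1 + x j ^ 2) ^ r i j)) fun i =>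
      Integrable.fintype_prod (f := fun j (z : ℝ) =>
        ((|b| * (|a| + 1)) ^ r i j * (1 + z ^ 2) ^ r i j)) fun j =>
        (integrable_one_add_sq_pow_gaussian _).const_mul _
  refine Integrable.mono' (h1.mul_prod h2) (by fun_prop) (Eventually.of_forall fun w => ?_)
  rw [Real.norm_eq_abs, Finset.abs_prod]
  have h3 : ∏ j, (1 + w.1 j ^ 2) ^ (∑ i, r i j) = ∏ i, ∏ j, (1 + w.1 j ^ 2) ^ r i j := by
    rw [Finset.prod_comm]
    exact Finset.prod_congr rfl fun j _ => (Finset.prod_pow_eq_pow_sum _ _ _).symm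
  rw [h3, ← Finset.prod_mul_distrib]
  refine Finset.prod_le_prod (fun _ _ => abs_nonneg _) fun i _ => ?_
  rw [Finset.abs_prod, ← Finset.prod_mul_distrib]
  refine Finset.prod_le_prod (fun _ _ => abs_nonneg _) fun j _ => ?_
  rw [abs_pow, ← mul_pow, ← mul_pow, abs_mul]
  refine pow_le_pow_left₀ (by positivity) ?_ _
  refine (mul_le_mul_of_nonneg_left (abs_affine_le a _ (w.1 j) (w.2 i j) (abs_spin _))
    (abs_nonneg b)).trans (le_of_eq ?_)
  ring

lemma integrable_prod_edgeStat (r : Edge m n p → ℕ)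
    (hr : ∀ l s, s.IsDiag → r (Sum.inl (l, s)) = 0) :
    Integrable (fun D => ∏ e, edgeStat d lam μ D e ^ r e) (condLaw d lam' μ' p σ) := by
  rw [condLaw_eq_map, integrable_map_measure
    (Finset.measurable_prod _ fun e _ =>
      (measurable_edgeStat e).pow_const _).aestronglyMeasurable measurable_dataOf.aemeasurable]
  simp only [Function.comp_def, prod_edgeStat_dataOf r hr]
  exact Integrable.mul_prod
    (f := fun x : Fin m → Pairs n → Bool => ∏ l, ∏ q : Pairs n,
      (lam l / √(d l) * ((if x l q = true then 1 else 0) - d l / n)) ^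
        r (Sum.inl (l, s(q.1.1, q.1.2)))) .of_finite
    (integrable_noise_prod _ _ fun i j => r (Sum.inr (i, j)))

/-- Given the labels and `u`, all the edge variables are independent. -/
lemma integral_prod_edgeStat (r : Edge m n p → ℕ)
    (hr : ∀ l s, s.IsDiag → r (Sum.inl (l, s)) = 0) :
    ∫ D, ∏ e, edgeStat d lam μ D e ^ r e ∂(condLaw d lam' μ' p σ) =
      ∫ u : Fin p → ℝ, ∏ e, edgeMoment d lam μ lam' μ' σ u e (r e)
        ∂(Measure.pi fun _ => gaussianReal 0 1) := by
  rw [condLaw_eq_map, integral_map measurable_dataOf.aemeasurable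
    (Finset.measurable_prod _ fun e _ =>
      (measurable_edgeStat e).pow_const _).aestronglyMeasurable]
  simp only [prod_edgeStat_dataOf r hr]
  rw [integral_prod_mul (f := fun x : Fin m → Pairs n → Bool => ∏ l, ∏ q : Pairs n,
      (lam l / √(d l) * ((if x l q = true then 1 else 0) - d l / n)) ^
        r (Sum.inl (l, s(q.1.1, q.1.2))))
    (g := fun w : (Fin p → ℝ) × (Fin n → Fin p → ℝ) =>
      ∏ i, ∏ j, (√(μ / n) * (√(μ' / n) * spin (σ i) * w.1 j + w.2 i j)) ^ r (Sum.inr (i, j)))]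
  have h1 : ∫ x, ∏ l, ∏ q : Pairs n,
      (lam l / √(d l) * ((if x l q = true then 1 else 0) - d l / n)) ^
        r (Sum.inl (l, s(q.1.1, q.1.2))) ∂(indicatorLaw d lam' σ) =
      ∏ e : Fin m × Sym2 (Fin n), edgeMoment d lam μ lam' μ' σ (0 : Fin p → ℝ) (Sum.inl e)
        (r (Sum.inl e)) := by
    unfold indicatorLaw
    rw [integral_fintype_prod_eq_prod (f := fun l (x : Pairs n → Bool) => ∏ q : Pairs n,
      (lam l / √(d l) * ((if x q = true then 1 else 0) - d l / n)) ^
        r (Sum.inl (l, s(q.1.1, q.1.2)))), Fintype.prod_prod_type]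
    refine Finset.prod_congr rfl fun l _ => ?_
    rw [integral_fintype_prod_eq_prod (f := fun (q : Pairs n) (b : Bool) =>
      (lam l / √(d l) * ((if b = true then 1 else 0) - d l / n)) ^
        r (Sum.inl (l, s(q.1.1, q.1.2)))), prod_sym2_eq_prod_pairs]
    · simp [edgeMoment]
    · intro s hs
      rw [hr l s hs, edgeMoment_zero]
  have h2 : ∫ w : (Fin p → ℝ) × (Fin n → Fin p → ℝ), ∏ i, ∏ j,
      (√(μ / n) * (√(μ' / n) * spin (σ i) * w.1 j + w.2 i j)) ^ r (Sum.inr (i, j))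
        ∂(noiseLaw n p) =
      ∫ u : Fin p → ℝ, ∏ e : Fin n × Fin p, edgeMoment d lam μ lam' μ' σ u (Sum.inr e)
        (r (Sum.inr e)) ∂(Measure.pi fun _ => gaussianReal 0 1) := by
    have hi := integrable_noise_prod (σ := σ) √(μ' / n) √(μ / n) fun i j => r (Sum.inr (i, j))
    unfold noiseLaw at hi ⊢
    rw [integral_prod _ hi]
    congr 1
    ext u
    rw [Fintype.prod_prod_type, integral_fintype_prod_eq_prod (f := fun i (x : Fin p → ℝ) => ∏ j,
      (√(μ / n) * (√(μ' / n) * spin (σ i) * u j + x j)) ^ r (Sum.inr (i, j)))]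
    refine Finset.prod_congr rfl fun i _ => ?_
    rw [integral_fintype_prod_eq_prod (f := fun j (z : ℝ) =>
      (√(μ / n) * (√(μ' / n) * spin (σ i) * u j + z)) ^ r (Sum.inr (i, j)))]
    simp [edgeMoment]
  rw [h1, h2, ← integral_const_mul]
  congr 1
  ext u
  rw [Fintype.prod_sum_type]
  rfl

end moments

/-! ### Moments of the cycle statistic -/

/-- The statistic is built with the weights `lam`, `μ`, and evaluated under a law with smaller
parameters `lam'`, `μ'`: the alternative (`lam' = lam`, `μ' = μ`) and the null (both zero) are
the cases of interest. The condition `2 * d l ≤ n` makes the edge probabilities genuine. -/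
structure Admissible {m : ℕ} (d lam lam' : Fin m → ℝ) (μ μ' : ℝ) (n : ℕ) : Prop where
  one_lt : ∀ l, 1 < d l
  nonneg : ∀ l, 0 ≤ lam' l
  le : ∀ l, lam' l ≤ lam l
  le_sqrt : ∀ l, lam l ≤ √(d l)
  two_mul_le : ∀ l, 2 * d l ≤ n
  cov_nonneg : 0 ≤ μ'
  cov_le : μ' ≤ μ
  one_le : (1 : ℝ) ≤ n

/-- The product of the edge variables along a mixed cycle. -/
def cycleStat {m n p k : ℕ} [NeZero k] (d lam : Fin m → ℝ) (μ : ℝ) (α : MixedCycle m n p k)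
    (D : Data m n p) : ℝ :=
  ∏ e ∈ α.edges, edgeStat d lam μ D e

/-- The mean of the variables of one step (a layer edge, or two covariate entries), up to the sign
given by the labels of its endpoints. -/
def stepMean {m p : ℕ} (lam lam' : Fin m → ℝ) (μ μ' : ℝ) (n : ℕ) : Fin m ⊕ Fin p → ℝ :=
  Sum.elim (fun l => lam l * lam' l / n) (fun _ => μ / n * (μ' / n))

/-- An upper bound, up to the effect of the labels, for the second moment of one step. -/
def stepVar {m p : ℕ} (lam : Fin m → ℝ) (μ μ' : ℝ) (n : ℕ) : Fin m ⊕ Fin p → ℝ :=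
  Sum.elim (fun l => lam l ^ 2 / n)
    (fun _ => ∫ z, (μ / n * (1 + μ' / n * z ^ 2)) ^ 2 ∂(gaussianReal 0 1))

/-- The mean of the cycle statistic attached to `α`. -/
def cycleMean {m n p k : ℕ} [NeZero k] (lam lam' : Fin m → ℝ) (μ μ' : ℝ)
    (α : MixedCycle m n p k) : ℝ :=
  ∏ t, stepMean lam lam' μ μ' n (α.c t)

/-- In a family of steps that use every covariate at most once, the factors depending on different
covariates are independent. -/
lemma integral_prod_steps {ι : Type*} [Fintype ι] {m p : ℕ} {c : ι → Fin m ⊕ Fin p}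
    (hc : ∀ t t' j, c t = Sum.inr j → c t' = Sum.inr j → t = t') (A : ι → Fin m → ℝ)
    (φ : ℝ → ℝ) :
    ∫ u : Fin p → ℝ, ∏ t, Sum.elim (A t) (fun j => φ (u j)) (c t)
      ∂(Measure.pi fun _ => gaussianReal 0 1) =
    ∏ t, Sum.elim (A t) (fun _ => ∫ z, φ z ∂(gaussianReal 0 1)) (c t) := by
  classical
  have hsplit : ∀ v : Fin p → ℝ, ∏ t, Sum.elim (A t) v (c t) =
      (∏ t, Sum.elim (A t) (fun _ => 1) (c t)) *
        ∏ j, ∏ t, (if c t = Sum.inr j then v j else 1) := by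
    intro v
    rw [Finset.prod_comm, ← Finset.prod_mul_distrib]
    refine Finset.prod_congr rfl fun t _ => ?_
    rcases c t with l | j <;> simp
  have hone : ∀ j, (∃ t₀, c t₀ = Sum.inr j ∧ ∀ x : ℝ,
      ∏ t, (if c t = Sum.inr j then x else 1) = x) ∨
      ∀ x : ℝ, ∏ t, (if c t = Sum.inr j then x else 1) = 1 := by
    intro j
    by_cases h : ∃ t₀, c t₀ = Sum.inr j
    · obtain ⟨t₀, h₀⟩ := h
      refine Or.inl ⟨t₀, h₀, fun x => ?_⟩
      rw [Finset.prod_eq_single t₀]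
      · simp [h₀]
      · intro t _ ht
        rw [if_neg fun h => ht (hc _ _ _ h h₀)]
      · simp
    · push Not at h
      exact Or.inr fun x => Finset.prod_eq_one fun t _ => by rw [if_neg (h t)]
  rw [hsplit]
  simp_rw [fun u : Fin p → ℝ => hsplit fun j => φ (u j)]
  rw [integral_const_mul, integral_fintype_prod_eq_prod
    (f := fun j (z : ℝ) => ∏ t, (if c t = Sum.inr j then φ z else 1))]
  congr 1
  refine Finset.prod_congr rfl fun j _ => ?_
  rcases hone j with ⟨-, -, h⟩ | h
  · simp_rw [h]
  · simp_rw [h]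
    simp

section cycles

variable {m n p k : ℕ} [NeZero k] {d lam lam' : Fin m → ℝ} {μ μ' : ℝ} {σ : Fin n → ℤˣ}

lemma prod_spin_cycle (f : ZMod k → Fin n) : ∏ t, spin (σ (f t)) * spin (σ (f (t + 1))) = 1 := by
  have h := Equiv.prod_comp (Equiv.addRight (1 : ZMod k)) fun t => spin (σ (f t))
  simp only [Equiv.coe_addRight] at h
  rw [Finset.prod_mul_distrib, h, ← Finset.prod_mul_distrib]
  exact Finset.prod_eq_one fun t _ => spin_mul_self _

lemma prod_stepEdges_mean (h : Admissible d lam lam' μ μ' n) (hk : 3 ≤ k)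
    (α : MixedCycle m n p k) (u : Fin p → ℝ) :
    ∏ e ∈ α.edges, edgeMoment d lam μ lam' μ' σ u e 1 =
      ∏ t, Sum.elim (fun l => lam l * lam' l / n) (fun j => μ / n * (μ' / n) * u j ^ 2)
        (α.c t) := by
  have hμ : 0 ≤ μ := h.cov_nonneg.trans h.cov_le
  rw [α.prod_edges hk, ← one_mul (∏ t, Sum.elim _ _ _), ← prod_spin_cycle (σ := σ) α.f,
    ← Finset.prod_mul_distrib]
  refine Finset.prod_congr rfl fun t _ => ?_
  rcases hc : α.c t with l | j
  · simp only [stepEdges, Finset.prod_singleton, Sum.elim_inl]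
    rw [edgeMoment_inl_one (h.one_lt l) (h.nonneg l) ((h.le l).trans (h.le_sqrt l))
      (h.two_mul_le l), pairSpin_mk]
    ring
  · simp only [stepEdges, Sum.elim_inr]
    rw [Finset.prod_pair (by simpa using α.f_ne_succ hk t), edgeMoment_inr_one,
      edgeMoment_inr_one]
    have h1 : √(μ / n) * √(μ / n) = μ / n := Real.mul_self_sqrt (div_nonneg hμ (by positivity))
    have h2 : √(μ' / n) * √(μ' / n) = μ' / n :=
      Real.mul_self_sqrt (div_nonneg h.cov_nonneg (by positivity))
    calc _ = spin (σ (α.f t)) * spin (σ (α.f (t + 1))) *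
          ((√(μ / n) * √(μ / n)) * (√(μ' / n) * √(μ' / n)) * u j ^ 2) := by ring
      _ = _ := by rw [h1, h2]

lemma cycleStat_eq (α : MixedCycle m n p k) (D : Data m n p) :
    cycleStat d lam μ α D = ∏ e, edgeStat d lam μ D e ^ (if e ∈ α.edges then 1 else 0) := by
  simp only [cycleStat, pow_ite, pow_one, pow_zero]
  rw [Finset.prod_ite_mem, Finset.univ_inter]

lemma cycleStat_mul_eq (α β : MixedCycle m n p k) (D : Data m n p) :
    cycleStat d lam μ α D * cycleStat d lam μ β D = ∏ e, edgeStat d lam μ D e ^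
      ((if e ∈ α.edges then 1 else 0) + (if e ∈ β.edges then 1 else 0)) := by
  rw [cycleStat_eq, cycleStat_eq, ← Finset.prod_mul_distrib]
  simp only [pow_add]

lemma indicator_diag (hk : 3 ≤ k) (α : MixedCycle m n p k) (l : Fin m) (s : Sym2 (Fin n))
    (hs : s.IsDiag) : (if (Sum.inl (l, s) : Edge m n p) ∈ α.edges then 1 else 0) = 0 :=
  if_neg fun h => α.layer_not_isDiag hk h hs

lemma integrable_cycleStat (hk : 3 ≤ k) (α : MixedCycle m n p k) :
    Integrable (cycleStat d lam μ α) (condLaw d lam' μ' p σ) := by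
  have : cycleStat d lam μ α = fun D => _ := funext fun D => cycleStat_eq α D
  rw [this]
  exact integrable_prod_edgeStat _ (indicator_diag hk α)

lemma integrable_cycleStat_mul (hk : 3 ≤ k) (α β : MixedCycle m n p k) :
    Integrable (fun D => cycleStat d lam μ α D * cycleStat d lam μ β D)
      (condLaw d lam' μ' p σ) := by
  simp_rw [cycleStat_mul_eq]
  exact integrable_prod_edgeStat _ fun l s hs => by
    rw [indicator_diag hk α l s hs, indicator_diag hk β l s hs]

lemma integral_cycleStat_mul (hk : 3 ≤ k) (α β : MixedCycle m n p k) :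
    ∫ D, cycleStat d lam μ α D * cycleStat d lam μ β D ∂(condLaw d lam' μ' p σ) =
      ∫ u : Fin p → ℝ, ∏ e ∈ α.edges ∪ β.edges, edgeMoment d lam μ lam' μ' σ u e
        ((if e ∈ α.edges then 1 else 0) + (if e ∈ β.edges then 1 else 0))
        ∂(Measure.pi fun _ => gaussianReal 0 1) := by
  simp_rw [cycleStat_mul_eq]
  rw [integral_prod_edgeStat _ fun l s hs => by
    rw [indicator_diag hk α l s hs, indicator_diag hk β l s hs]]
  congr 1
  ext u
  refine (Finset.prod_subset (Finset.subset_univ _) fun e _ he => ?_).symm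
  rw [Finset.mem_union, not_or] at he
  rw [if_neg he.1, if_neg he.2, edgeMoment_zero]

lemma integral_cycleStat (h : Admissible d lam lam' μ μ' n) (hk : 3 ≤ k)
    (α : MixedCycle m n p k) :
    ∫ D, cycleStat d lam μ α D ∂(condLaw d lam' μ' p σ) = cycleMean lam lam' μ μ' α := by
  simp_rw [cycleStat_eq]
  rw [integral_prod_edgeStat _ (indicator_diag hk α)]
  have h1 : ∀ u : Fin p → ℝ,
      ∏ e, edgeMoment d lam μ lam' μ' σ u e (if e ∈ α.edges then 1 else 0) =
      ∏ t, Sum.elim (fun l => lam l * lam' l / n) (fun j => μ / n * (μ' / n) * u j ^ 2)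
        (α.c t) := by
    intro u
    rw [← prod_stepEdges_mean (σ := σ) h hk α u]
    refine (Finset.prod_subset (Finset.subset_univ _) fun e _ he => ?_).symm.trans
      (Finset.prod_congr rfl fun e he => ?_)
    · rw [if_neg he, edgeMoment_zero]
    · rw [if_pos he]
  simp_rw [h1]
  rw [integral_prod_steps (fun _ _ _ => α.c_inj) (fun _ l => lam l * lam' l / n)
    (fun z => μ / n * (μ' / n) * z ^ 2), integral_const_mul, integral_sq_gaussian]
  simp [cycleMean, stepMean]

lemma edges_disjoint_of_nodes {α β : MixedCycle m n p k} (h : Disjoint α.nodes β.nodes) :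
    Disjoint α.edges β.edges := by
  rw [Finset.disjoint_left]
  rintro (⟨l, s⟩ | ⟨i, j⟩) h1 h2
  · obtain ⟨t, -, ht⟩ := MixedCycle.mem_edges_layer.1 h1
    obtain ⟨t', -, ht'⟩ := MixedCycle.mem_edges_layer.1 h2
    rw [ht] at ht'
    have h3 : α.f t = β.f t' ∨ α.f t = β.f (t' + 1) := by
      rcases Sym2.eq_iff.1 ht' with h | h
      · exact Or.inl h.1
      · exact Or.inr h.1
    refine Finset.disjoint_left.1 h (MixedCycle.mem_nodes_subject.2 ⟨t, rfl⟩) ?_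
    rcases h3 with h3 | h3 <;> exact MixedCycle.mem_nodes_subject.2 ⟨_, h3⟩
  · obtain ⟨t, ht, -⟩ := MixedCycle.mem_edges_cov.1 h1
    obtain ⟨t', ht', -⟩ := MixedCycle.mem_edges_cov.1 h2
    exact Finset.disjoint_left.1 h (MixedCycle.mem_nodes_cov.2 ⟨t, ht⟩)
      (MixedCycle.mem_nodes_cov.2 ⟨t', ht'⟩)

/-- Cycles without a common node are uncorrelated, although both depend on the labels: the product
of the labels around a cycle is one. -/
lemma integral_cycleStat_mul_of_disjoint (h : Admissible d lam lam' μ μ' n) (hk : 3 ≤ k)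
    {α β : MixedCycle m n p k} (hd : Disjoint α.nodes β.nodes) :
    ∫ D, cycleStat d lam μ α D * cycleStat d lam μ β D ∂(condLaw d lam' μ' p σ) =
      cycleMean lam lam' μ μ' α * cycleMean lam lam' μ μ' β := by
  have hE := edges_disjoint_of_nodes hd
  rw [integral_cycleStat_mul hk]
  have h1 : ∀ u : Fin p → ℝ, ∏ e ∈ α.edges ∪ β.edges, edgeMoment d lam μ lam' μ' σ u e
        ((if e ∈ α.edges then 1 else 0) + (if e ∈ β.edges then 1 else 0)) =
      ∏ t : ZMod k ⊕ ZMod k, Sum.elim (fun l => lam l * lam' l / n)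
        (fun j => μ / n * (μ' / n) * u j ^ 2) (Sum.elim α.c β.c t) := by
    intro u
    rw [Finset.prod_union hE, Fintype.prod_sum_type]
    simp only [Sum.elim_inl, Sum.elim_inr]
    rw [← prod_stepEdges_mean (σ := σ) h hk α u, ← prod_stepEdges_mean (σ := σ) h hk β u]
    congr 1
    · refine Finset.prod_congr rfl fun e he => ?_
      rw [if_pos he, if_neg (Finset.disjoint_left.1 hE he)]
    · refine Finset.prod_congr rfl fun e he => ?_
      rw [if_pos he, if_neg (Finset.disjoint_right.1 hE he)]
  simp_rw [h1]
  rw [integral_prod_steps (c := Sum.elim α.c β.c) ?_ (fun _ l => lam l * lam' l / n)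
    (fun z => μ / n * (μ' / n) * z ^ 2), integral_const_mul, integral_sq_gaussian,
    Fintype.prod_sum_type]
  · simp [cycleMean, stepMean]
  · rintro (t | t) (t' | t') j h1 h2 <;> simp only [Sum.elim_inl, Sum.elim_inr] at h1 h2
    · rw [α.c_inj h1 h2]
    · exact absurd (MixedCycle.mem_nodes_cov.2 ⟨t', h2⟩)
        (Finset.disjoint_left.1 hd (MixedCycle.mem_nodes_cov.2 ⟨t, h1⟩))
    · exact absurd (MixedCycle.mem_nodes_cov.2 ⟨t, h1⟩)
        (Finset.disjoint_left.1 hd (MixedCycle.mem_nodes_cov.2 ⟨t', h2⟩))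
    · rw [β.c_inj h1 h2]

/-- Averaged over the labels, the second moment of a cycle is at most twice the product of the
second moments of its steps. -/
lemma sum_integral_cycleStat_sq_le (h : Admissible d lam lam' μ μ' n) (hk : 3 ≤ k)
    (α : MixedCycle m n p k) :
    ∑ σ : Fin n → ℤˣ, ∫ D, cycleStat d lam μ α D * cycleStat d lam μ α D
        ∂(condLaw d lam' μ' p σ) ≤
      2 * 2 ^ n * ∏ t, stepVar lam μ μ' n (α.c t) := by
  have hμ : 0 ≤ μ := h.cov_nonneg.trans h.cov_le
  have hn : (0 : ℝ) < n := by linarith [h.one_le]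
  have hρ1 : ∀ l, lam' l / √(d l) ≤ 1 := fun l =>
    div_le_one_of_le₀ ((h.le l).trans (h.le_sqrt l)) (Real.sqrt_nonneg _)
  have hρ0 : ∀ l, 0 ≤ lam' l / √(d l) := fun l => div_nonneg (h.nonneg l) (Real.sqrt_nonneg _)
  have hd0 : ∀ l, 0 ≤ d l / n := fun l => div_nonneg (by linarith [h.one_lt l]) hn.le
  have hd1 : ∀ l, 0 ≤ 1 - 2 * d l / n := fun l => by
    have := (div_le_one hn).2 (h.two_mul_le l)
    linarith
  have hd2 : ∀ l, 2 * d l / n = 2 * (d l / n) := fun l => by ring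
  let x : Fin m ⊕ Fin p → ℝ := Sum.elim (fun l => lam' l / √(d l) * (1 - 2 * d l / n)) fun _ => 0
  have hx0 : ∀ c, 0 ≤ x c := by
    rintro (l | j)
    · exact mul_nonneg (hρ0 l) (hd1 l)
    · exact le_rfl
  have hx1 : ∀ c, x c ≤ 1 := by
    rintro (l | j)
    · refine mul_le_one₀ (hρ1 l) (hd1 l) ?_
      linarith [hd0 l, hd2 l]
    · exact zero_le_one
  have hσ : ∀ σ : Fin n → ℤˣ, ∫ D, cycleStat d lam μ α D * cycleStat d lam μ α D
        ∂(condLaw d lam' μ' p σ) ≤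
      (∏ t, stepVar lam μ μ' n (α.c t)) *
        ∏ t, (1 + x (α.c t) * (spin (σ (α.f t)) * spin (σ (α.f (t + 1))))) := by
    intro σ
    rw [integral_cycleStat_mul hk, Finset.union_self]
    have h1 : ∀ u : Fin p → ℝ, ∏ e ∈ α.edges, edgeMoment d lam μ lam' μ' σ u e
        ((if e ∈ α.edges then 1 else 0) + (if e ∈ α.edges then 1 else 0)) =
        ∏ t, Sum.elim (fun l => lam l ^ 2 / n * (1 - d l / n + lam' l / √(d l) *
            (1 - 2 * d l / n) * (spin (σ (α.f t)) * spin (σ (α.f (t + 1))))))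
          (fun j => (μ / n * (1 + μ' / n * u j ^ 2)) ^ 2) (α.c t) := by
      intro u
      rw [Finset.prod_congr rfl (g := fun e => edgeMoment d lam μ lam' μ' σ u e 2)
        fun e he => by rw [if_pos he], α.prod_edges hk]
      refine Finset.prod_congr rfl fun t _ => ?_
      rcases hc : α.c t with l | j
      · simp only [stepEdges, Finset.prod_singleton, Sum.elim_inl]
        rw [edgeMoment_inl_two (h.one_lt l) (h.nonneg l) ((h.le l).trans (h.le_sqrt l))
          (h.two_mul_le l), pairSpin_mk]
      · simp only [stepEdges, Sum.elim_inr]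
        rw [Finset.prod_pair (by simpa using α.f_ne_succ hk t),
          edgeMoment_inr_two hμ h.cov_nonneg, edgeMoment_inr_two hμ h.cov_nonneg]
        ring
    simp_rw [h1]
    rw [integral_prod_steps (fun _ _ _ => α.c_inj)
      (fun t l => lam l ^ 2 / n * (1 - d l / n + lam' l / √(d l) *
            (1 - 2 * d l / n) * (spin (σ (α.f t)) * spin (σ (α.f (t + 1))))))
      (fun z => (μ / n * (1 + μ' / n * z ^ 2)) ^ 2), ← Finset.prod_mul_distrib]
    have hs : ∀ t, |spin (σ (α.f t)) * spin (σ (α.f (t + 1)))| = 1 := fun t => by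
      rw [abs_mul, abs_spin, abs_spin, one_mul]
    refine Finset.prod_le_prod (fun t _ => ?_) fun t _ => ?_
    · rcases hc : α.c t with l | j
      · simp only [Sum.elim_inl]
        refine mul_nonneg (by positivity) ?_
        have h3 := abs_le.1 (le_of_eq (hs t))
        have h4 := mul_le_mul_of_nonneg_left h3.1 (hx0 (Sum.inl l))
        have h5 := mul_le_mul_of_nonneg_right (hρ1 l) (hd1 l)
        simp only [x, Sum.elim_inl] at h4
        linarith [hd0 l, hd2 l]
      · exact integral_nonneg fun z => by positivity
    · rcases hc : α.c t with l | j
      · simp only [Sum.elim_inl, stepVar, x]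
        refine mul_le_mul_of_nonneg_left ?_ (by positivity)
        linarith [hd0 l]
      · simp [stepVar, x]
  refine (Finset.sum_le_sum fun σ _ => hσ σ).trans ?_
  rw [← Finset.mul_sum, mul_comm]
  refine mul_le_mul_of_nonneg_right
    (sum_prod_one_add_spin_le α.f_inj (fun t => hx0 _) fun t => hx1 _)
    (Finset.prod_nonneg fun t _ => ?_)
  rcases hc : α.c t with l | j
  · simp only [stepVar, Sum.elim_inl]
    positivity
  · exact integral_nonneg fun z => by positivity

/-- A constant for which `momentConst lam μ / n` bounds all the edge moments of order one and two,
up to a factor depending on `u`. -/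
def momentConst (lam : Fin m → ℝ) (μ : ℝ) : ℝ := 1 + ∑ l, 2 * lam l ^ 2 + μ * (1 + μ)

lemma abs_edgeMoment_le (h : Admissible d lam lam' μ μ' n) (u : Fin p → ℝ) (e : Edge m n p)
    {r : ℕ} (hr : r = 1 ∨ r = 2) :
    |edgeMoment d lam μ lam' μ' σ u e r| ≤
      momentConst lam μ / n * Sum.elim (fun _ => 1) (fun e => 1 + u e.2 ^ 2) e := by
  have hμ : 0 ≤ μ := h.cov_nonneg.trans h.cov_le
  have hn : (0 : ℝ) < n := by linarith [h.one_le]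
  have hsum0 : 0 ≤ ∑ l, 2 * lam l ^ 2 := Finset.sum_nonneg fun _ _ => by positivity
  have hμ2 : 0 ≤ μ * (1 + μ) := by positivity
  rcases e with ⟨l, s⟩ | ⟨i, j⟩
  · have hC : 2 * lam l ^ 2 ≤ momentConst lam μ := by
      have := Finset.single_le_sum (f := fun l => 2 * lam l ^ 2) (fun _ _ => by positivity)
        (Finset.mem_univ l)
      simp only [momentConst]
      linarith
    have hll : lam l * lam' l ≤ lam l ^ 2 := by nlinarith [h.nonneg l, h.le l]
    have hll0 : 0 ≤ lam l * lam' l := by nlinarith [h.nonneg l, h.le l]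
    have hs := abs_pairSpin σ s
    rw [Sum.elim_inl, mul_one]
    rcases hr with rfl | rfl
    · rw [edgeMoment_inl_one (h.one_lt l) (h.nonneg l) ((h.le l).trans (h.le_sqrt l))
        (h.two_mul_le l), abs_mul, hs, mul_one, abs_of_nonneg (by positivity)]
      gcongr
      nlinarith [sq_nonneg (lam l)]
    · rw [edgeMoment_inl_two (h.one_lt l) (h.nonneg l) ((h.le l).trans (h.le_sqrt l))
        (h.two_mul_le l), abs_mul, abs_of_nonneg (by positivity)]
      have hd0 : 0 ≤ d l / n := div_nonneg (by linarith [h.one_lt l]) hn.le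
      have hd2 : 2 * d l / n = 2 * (d l / n) := by ring
      have hd1 : 0 ≤ 1 - 2 * d l / n := by
        have := (div_le_one hn).2 (h.two_mul_le l)
        linarith
      have hρ1 : lam' l / √(d l) ≤ 1 :=
        div_le_one_of_le₀ ((h.le l).trans (h.le_sqrt l)) (Real.sqrt_nonneg _)
      have hρ0 : 0 ≤ lam' l / √(d l) := div_nonneg (h.nonneg l) (Real.sqrt_nonneg _)
      have h1 : |1 - d l / n + lam' l / √(d l) * (1 - 2 * d l / n) * pairSpin σ s| ≤ 2 := by
        refine (abs_add_le _ _).trans ?_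
        rw [abs_mul, hs, mul_one, abs_of_nonneg (mul_nonneg hρ0 hd1),
          abs_of_nonneg (by linarith)]
        have := mul_le_one₀ hρ1 hd1 (by linarith)
        linarith
      calc _ ≤ lam l ^ 2 / n * 2 := mul_le_mul_of_nonneg_left h1 (by positivity)
        _ = 2 * lam l ^ 2 / n := by ring
        _ ≤ _ := by gcongr
  · have hC : μ * (1 + μ) ≤ momentConst lam μ := by
      simp only [momentConst]
      linarith
    have hmain : |edgeMoment d lam μ lam' μ' σ u (Sum.inr (i, j)) r| ≤
        μ * (1 + μ) / n * (1 + u j ^ 2) := by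
      rcases hr with rfl | rfl
      · rw [edgeMoment_inr_one, abs_mul, abs_mul, abs_mul, abs_spin, mul_one,
          abs_of_nonneg (Real.sqrt_nonneg _), abs_of_nonneg (Real.sqrt_nonneg _)]
        have h1 : √(μ / n) * √(μ' / n) ≤ μ / n := by
          calc √(μ / n) * √(μ' / n) ≤ √(μ / n) * √(μ / n) := by
                gcongr
                exact h.cov_le
            _ = μ / n := Real.mul_self_sqrt (by positivity)
        have h2 : |u j| ≤ 1 + u j ^ 2 := by rw [← sq_abs]; nlinarith [sq_nonneg (|u j| - 1)]
        calc _ ≤ μ / n * (1 + u j ^ 2) := by gcongr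
          _ ≤ _ := by
            gcongr
            nlinarith
      · rw [edgeMoment_inr_two hμ h.cov_nonneg, abs_of_nonneg
          (by have := h.cov_nonneg; positivity)]
        have h1 : μ' / n ≤ μ := (div_le_self h.cov_nonneg h.one_le).trans h.cov_le
        have h2 : 1 + μ' / n * u j ^ 2 ≤ (1 + μ) * (1 + u j ^ 2) := by
          have := mul_le_mul_of_nonneg_right h1 (sq_nonneg (u j))
          nlinarith [sq_nonneg (u j)]
        calc _ ≤ μ / n * ((1 + μ) * (1 + u j ^ 2)) := by gcongr
          _ = _ := by ring
    refine hmain.trans ?_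
    rw [Sum.elim_inr]
    gcongr

/-- A bound for Gaussian moments of the order met in pairs of cycles of length `k`. -/
def gaussConst (k : ℕ) : ℝ := 1 + 4 * k * ∫ z, (1 + z ^ 2) ^ (4 * k) ∂(gaussianReal 0 1)

lemma one_le_integral_gaussian (N : ℕ) : 1 ≤ ∫ z : ℝ, (1 + z ^ 2) ^ N ∂(gaussianReal 0 1) := by
  calc (1 : ℝ) = ∫ _z : ℝ, 1 ∂(gaussianReal 0 1) := by simp
    _ ≤ _ := integral_mono (integrable_const _) (integrable_one_add_sq_pow_gaussian N)
        fun z => one_le_pow₀ (by nlinarith [sq_nonneg z])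

/-- The mean of the product of two cycle statistics is at most of order `1 / n` to the number of
edges in the union, since each edge moment of order one or two is of order `1 / n`. -/
lemma abs_integral_cycleStat_mul_le (h : Admissible d lam lam' μ μ' n) (hk : 3 ≤ k)
    (α β : MixedCycle m n p k) :
    |∫ D, cycleStat d lam μ α D * cycleStat d lam μ β D ∂(condLaw d lam' μ' p σ)| ≤
      momentConst lam μ ^ (4 * k) * gaussConst k * (1 / n) ^ (α.edges ∪ β.edges).card := by
  have hμ : 0 ≤ μ := h.cov_nonneg.trans h.cov_le
  have hn : (0 : ℝ) < n := by linarith [h.one_le]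
  have hC1 : 1 ≤ momentConst lam μ := by
    have : 0 ≤ ∑ l, 2 * lam l ^ 2 := Finset.sum_nonneg fun _ _ => by positivity
    have : 0 ≤ μ * (1 + μ) := by positivity
    simp only [momentConst]
    linarith
  set T := α.edges ∪ β.edges with hT
  have hTc : T.card ≤ 4 * k := by
    have := Finset.card_union_le α.edges β.edges
    have := α.card_edges_le
    have := β.card_edges_le
    rw [hT]
    omega
  let g : Edge m n p → (Fin p → ℝ) → ℝ := fun e u =>
    Sum.elim (fun _ => 1) (fun e => 1 + u e.2 ^ 2) e
  have hg1 : ∀ e u, 1 ≤ g e u := by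
    rintro (e | e) u
    · exact le_rfl
    · simp only [g, Sum.elim_inr]
      nlinarith [sq_nonneg (u e.2)]
  have hgi : ∀ e, Integrable (fun u => g e u ^ (4 * k))
      (Measure.pi fun _ : Fin p => gaussianReal 0 1) := by
    rintro (e | e)
    · simp [g]
    · exact (measurePreserving_eval (fun _ : Fin p => gaussianReal 0 1) e.2).integrable_comp_of_integrable
        (integrable_one_add_sq_pow_gaussian (4 * k))
  have hge : ∀ e, ∫ u, g e u ^ (4 * k) ∂(Measure.pi fun _ : Fin p => gaussianReal 0 1) ≤
      ∫ z, (1 + z ^ 2) ^ (4 * k) ∂(gaussianReal 0 1) := by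
    rintro (e | e)
    · simpa [g] using one_le_integral_gaussian (4 * k)
    · have hmp := measurePreserving_eval (fun _ : Fin p => gaussianReal 0 1) e.2
      have := integral_map (φ := Function.eval e.2) (μ := Measure.pi fun _ : Fin p => gaussianReal 0 1)
        (f := fun z : ℝ => (1 + z ^ 2) ^ (4 * k)) hmp.measurable.aemeasurable
        (by fun_prop)
      rw [hmp.map_eq] at this
      rw [this]
      rfl
  -- the product of the factors is at most a power of the largest one
  have hprod : ∀ u, ∏ e ∈ T, g e u ≤ 1 + ∑ e ∈ T, g e u ^ (4 * k) := by
    intro u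
    have hs0 : ∀ e ∈ T, 0 ≤ g e u ^ (4 * k) := fun e _ => pow_nonneg (by linarith [hg1 e u]) _
    rcases T.eq_empty_or_nonempty with h0 | h0
    · simp [h0]
    · obtain ⟨e₀, he₀, hmax⟩ := T.exists_max_image (fun e => g e u) h0
      calc ∏ e ∈ T, g e u ≤ ∏ _e ∈ T, g e₀ u :=
            Finset.prod_le_prod (fun e _ => by linarith [hg1 e u]) fun e he => hmax e he
        _ = g e₀ u ^ T.card := by rw [Finset.prod_const]
        _ ≤ g e₀ u ^ (4 * k) := pow_le_pow_right₀ (hg1 _ _) hTc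
        _ ≤ ∑ e ∈ T, g e u ^ (4 * k) := Finset.single_le_sum hs0 he₀
        _ ≤ _ := by linarith
  rw [integral_cycleStat_mul hk, ← hT]
  have hbound : ∀ u : Fin p → ℝ, ‖∏ e ∈ T, edgeMoment d lam μ lam' μ' σ u e
      ((if e ∈ α.edges then 1 else 0) + (if e ∈ β.edges then 1 else 0))‖ ≤
      (momentConst lam μ / n) ^ T.card * (1 + ∑ e ∈ T, g e u ^ (4 * k)) := by
    intro u
    rw [Real.norm_eq_abs, Finset.abs_prod]
    calc _ ≤ ∏ e ∈ T, (momentConst lam μ / n * g e u) := by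
          refine Finset.prod_le_prod (fun _ _ => abs_nonneg _) fun e he => ?_
          refine abs_edgeMoment_le h u e ?_
          rw [hT, Finset.mem_union] at he
          split_ifs <;> simp_all
      _ = (momentConst lam μ / n) ^ T.card * ∏ e ∈ T, g e u := by
          rw [Finset.prod_mul_distrib, Finset.prod_const]
      _ ≤ _ := mul_le_mul_of_nonneg_left (hprod u) (by positivity)
  have hint : Integrable (fun u : Fin p → ℝ => (momentConst lam μ / n) ^ T.card *
      (1 + ∑ e ∈ T, g e u ^ (4 * k))) (Measure.pi fun _ : Fin p => gaussianReal 0 1) :=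
    ((integrable_const _).add (integrable_finsetSum _ fun e _ => hgi e)).const_mul _
  have h1 := norm_integral_le_of_norm_le hint (Eventually.of_forall hbound)
  rw [Real.norm_eq_abs] at h1
  refine h1.trans ?_
  rw [integral_const_mul, integral_add (integrable_const _)
    (integrable_finsetSum _ fun e _ => hgi e), integral_finsetSum _ fun e _ => hgi e]
  have h2 : ∑ e ∈ T, ∫ u, g e u ^ (4 * k) ∂(Measure.pi fun _ : Fin p => gaussianReal 0 1) ≤
      4 * k * ∫ z, (1 + z ^ 2) ^ (4 * k) ∂(gaussianReal 0 1) := by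
    refine (Finset.sum_le_card_nsmul _ _ _ fun e _ => hge e).trans ?_
    rw [nsmul_eq_mul]
    refine mul_le_mul_of_nonneg_right (by exact_mod_cast hTc) ?_
    linarith [one_le_integral_gaussian (4 * k)]
  have h3 : (momentConst lam μ / n) ^ T.card ≤ momentConst lam μ ^ (4 * k) * (1 / n) ^ T.card := by
    rw [div_eq_mul_one_div, mul_pow]
    gcongr
  have h4 : ∫ _u : Fin p → ℝ, (1 : ℝ) ∂(Measure.pi fun _ : Fin p => gaussianReal 0 1) = 1 := by
    simp
  rw [h4]
  calc _ ≤ (momentConst lam μ ^ (4 * k) * (1 / n) ^ T.card) * gaussConst k := by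
        have h5 : 0 ≤ ∑ e ∈ T, ∫ u, g e u ^ (4 * k) ∂(Measure.pi fun _ : Fin p => gaussianReal 0 1) :=
          Finset.sum_nonneg fun e _ => integral_nonneg fun u => pow_nonneg (by linarith [hg1 e u]) _
        refine mul_le_mul h3 ?_ (by linarith) (by positivity)
        simp only [gaussConst]
        linarith
    _ = _ := by ring

end cycles

/-! ### Variance of the cycle statistic -/

section statistic

variable {m n p k : ℕ} [NeZero k] {d lam lam' : Fin m → ℝ} {μ μ' : ℝ}

/-- The test statistic: the sum over all mixed cycles of length `k`. -/
def cycleSum (k : ℕ) [NeZero k] (d lam : Fin m → ℝ) (μ : ℝ) (D : Data m n p) : ℝ :=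
  ∑ α : MixedCycle m n p k, cycleStat d lam μ α D

lemma measurable_cycleSum : Measurable (cycleSum (n := n) (p := p) k d lam μ) :=
  Finset.measurable_sum _ fun _ _ => Finset.measurable_prod _ fun e _ => measurable_edgeStat e

instance : IsProbabilityMeasure (dataLaw d lam' μ' n p) := by
  constructor
  simp only [dataLaw, Measure.smul_apply, Measure.coe_finsetSum, Finset.sum_apply, measure_univ,
    Finset.sum_const, smul_eq_mul, nsmul_eq_mul, mul_one]
  rw [Finset.card_univ, Fintype.card_fun, Fintype.card_fin, Fintype.card_units_int, Nat.cast_pow,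
    Nat.cast_ofNat]
  exact ENNReal.inv_mul_cancel (by simp) (by finiteness)

lemma integrable_dataLaw {g : Data m n p → ℝ} (hg : ∀ σ, Integrable g (condLaw d lam' μ' p σ)) :
    Integrable g (dataLaw d lam' μ' n p) :=
  (integrable_finsetSum_measure.2 fun σ _ => hg σ).smul_measure (by simp)

lemma integral_dataLaw {g : Data m n p → ℝ} (hg : ∀ σ, Integrable g (condLaw d lam' μ' p σ)) :
    ∫ D, g D ∂(dataLaw d lam' μ' n p) =
      (2 ^ n)⁻¹ * ∑ σ : Fin n → ℤˣ, ∫ D, g D ∂(condLaw d lam' μ' p σ) := by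
  rw [dataLaw, integral_smul_measure, integral_finsetSum_measure fun σ _ => hg σ]
  simp

lemma integral_cycleSum (h : Admissible d lam lam' μ μ' n) (hk : 3 ≤ k) :
    ∫ D, cycleSum k d lam μ D ∂(dataLaw d lam' μ' n p) =
      ∑ α : MixedCycle m n p k, cycleMean lam lam' μ μ' α := by
  have hi : ∀ σ, Integrable (cycleSum (n := n) (p := p) k d lam μ) (condLaw d lam' μ' p σ) :=
    fun σ => integrable_finsetSum _ fun α _ => integrable_cycleStat hk α
  rw [integral_dataLaw hi]
  have h1 : ∀ σ : Fin n → ℤˣ, ∫ D, cycleSum k d lam μ D ∂(condLaw d lam' μ' p σ) =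
      ∑ α : MixedCycle m n p k, cycleMean lam lam' μ μ' α := fun σ => by
    simp only [cycleSum]
    rw [integral_finsetSum _ fun α _ => integrable_cycleStat hk α]
    exact Finset.sum_congr rfl fun α _ => integral_cycleStat h hk α
  simp only [h1, Finset.sum_const, Finset.card_univ, Fintype.card_fun, Fintype.card_fin,
    Fintype.card_units_int, nsmul_eq_mul, Nat.cast_pow, Nat.cast_ofNat]
  rw [inv_mul_cancel_left₀ (by positivity)]

lemma cycleMean_nonneg (h : Admissible d lam lam' μ μ' n) (α : MixedCycle m n p k) :
    0 ≤ cycleMean lam lam' μ μ' α := by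
  refine Finset.prod_nonneg fun t _ => ?_
  have hμ : 0 ≤ μ := h.cov_nonneg.trans h.cov_le
  have hμ' := h.cov_nonneg
  rcases α.c t with l | j
  · simp only [stepMean, Sum.elim_inl]
    have := h.nonneg l
    have := (h.nonneg l).trans (h.le l)
    positivity
  · simp only [stepMean, Sum.elim_inr]
    positivity

/-- The constant in the bound for the pairs of cycles that meet without having the same edges. -/
def overlapConst (k : ℕ) (lam : Fin m → ℝ) (μ : ℝ) : ℝ :=
  momentConst lam μ ^ (4 * k) * gaussConst k * (((4 * k) ^ k * (m + 4 * k) ^ k) ^ 2 : ℕ)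

/-- The variance bound: cycles without common nodes are uncorrelated, cycles which meet lose a
factor `1 / n`, and what remains is the sum of the second moments of the single cycles. -/
lemma integral_cycleSum_sq_le (h : Admissible d lam lam' μ μ' n) (hk : 3 ≤ k) :
    ∫ D, cycleSum k d lam μ D ^ 2 ∂(dataLaw d lam' μ' n p) ≤
      (∑ α : MixedCycle m n p k, cycleMean lam lam' μ μ' α) ^ 2 +
      (overlapConst k lam μ * (1 / n) * (1 + 1 / n) ^ (n + p) +
        4 * k ^ 2 * ∑ α : MixedCycle m n p k, ∏ t, stepVar lam μ μ' n (α.c t)) := by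
  classical
  have hn : (0 : ℝ) < n := by linarith [h.one_le]
  have hμ : 0 ≤ μ := h.cov_nonneg.trans h.cov_le
  set C := momentConst lam μ ^ (4 * k) * gaussConst k with hC
  have hC0 : 0 ≤ C := by
    have h1 : 0 ≤ momentConst lam μ := by
      have : 0 ≤ ∑ l, 2 * lam l ^ 2 := Finset.sum_nonneg fun _ _ => by positivity
      have : 0 ≤ μ * (1 + μ) := by positivity
      simp only [momentConst]
      linarith
    have h2 : 0 ≤ gaussConst k := by
      have := one_le_integral_gaussian (4 * k)
      simp only [gaussConst]
      positivity
    positivity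
  have hexp : ∀ D : Data m n p, cycleSum k d lam μ D ^ 2 =
      ∑ α : MixedCycle m n p k, ∑ β : MixedCycle m n p k,
        cycleStat d lam μ α D * cycleStat d lam μ β D := fun D => by
    rw [pow_two, cycleSum, Finset.sum_mul_sum]
  have hint : ∀ σ, Integrable (fun D => ∑ α : MixedCycle m n p k, ∑ β : MixedCycle m n p k,
      cycleStat d lam μ α D * cycleStat d lam μ β D) (condLaw d lam' μ' p σ) := fun σ =>
    integrable_finsetSum _ fun α _ => integrable_finsetSum _ fun β _ =>
      integrable_cycleStat_mul hk α β
  simp_rw [hexp]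
  rw [integral_dataLaw hint]
  let I : (Fin n → ℤˣ) → MixedCycle m n p k → ℝ := fun σ α =>
    ∫ D, cycleStat d lam μ α D * cycleStat d lam μ α D ∂(condLaw d lam' μ' p σ)
  have hI0 : ∀ σ α, 0 ≤ I σ α := fun σ α => integral_nonneg fun D => mul_self_nonneg _
  have hpair : ∀ σ (α β : MixedCycle m n p k),
      ∫ D, cycleStat d lam μ α D * cycleStat d lam μ β D ∂(condLaw d lam' μ' p σ) ≤
      cycleMean lam lam' μ μ' α * cycleMean lam lam' μ μ' β +
        (if α.edges = β.edges then I σ α else 0) +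
        C * (1 / n) * (1 / n) ^ (α.nodes ∪ β.nodes).card := by
    intro σ α β
    have hm : 0 ≤ cycleMean lam lam' μ μ' α * cycleMean lam lam' μ μ' β :=
      mul_nonneg (cycleMean_nonneg h α) (cycleMean_nonneg h β)
    have hc : 0 ≤ C * (1 / n) * (1 / n : ℝ) ^ (α.nodes ∪ β.nodes).card := by positivity
    by_cases hE : α.edges = β.edges
    · have : cycleStat d lam μ β = cycleStat d lam μ α := by
        funext D
        simp only [cycleStat, hE]
      rw [if_pos hE, this]
      linarith
    · rw [if_neg hE]
      by_cases hN : Disjoint α.nodes β.nodes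
      · rw [integral_cycleStat_mul_of_disjoint h hk hN]
        linarith
      · have h1 := le_of_abs_le (abs_integral_cycleStat_mul_le (σ := σ) h hk α β)
        have h2 := MixedCycle.card_nodes_union_lt hk hN hE
        have h3 : (1 / n : ℝ) ^ (α.edges ∪ β.edges).card ≤
            (1 / n : ℝ) ^ ((α.nodes ∪ β.nodes).card + 1) :=
          pow_le_pow_of_le_one (by positivity) ((div_le_one hn).2 h.one_le) h2
        have h4 := mul_le_mul_of_nonneg_left h3 hC0
        rw [pow_succ] at h4
        calc _ ≤ C * ((1 / n) ^ (α.nodes ∪ β.nodes).card * (1 / n)) := h1.trans h4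
          _ = C * (1 / n) * (1 / n) ^ (α.nodes ∪ β.nodes).card := by ring
          _ ≤ _ := by linarith
  have hσ : ∀ σ, ∫ D, ∑ α : MixedCycle m n p k, ∑ β : MixedCycle m n p k,
      cycleStat d lam μ α D * cycleStat d lam μ β D ∂(condLaw d lam' μ' p σ) ≤
      (∑ α : MixedCycle m n p k, cycleMean lam lam' μ μ' α) ^ 2 +
        2 * k ^ 2 * ∑ α, I σ α + overlapConst k lam μ * (1 / n) * (1 + 1 / n) ^ (n + p) := by
    intro σ
    rw [integral_finsetSum _ fun α _ => integrable_finsetSum _ fun β _ =>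
      integrable_cycleStat_mul hk α β]
    simp_rw [fun α : MixedCycle m n p k => integral_finsetSum Finset.univ
      (fun β _ => integrable_cycleStat_mul (d := d) (lam := lam) (μ := μ) (lam' := lam')
        (μ' := μ') (σ := σ) hk α β)]
    refine (Finset.sum_le_sum fun α _ => Finset.sum_le_sum fun β _ => hpair σ α β).trans ?_
    simp_rw [Finset.sum_add_distrib]
    refine add_le_add (add_le_add (le_of_eq ?_) ?_) ?_
    · rw [pow_two, Finset.sum_mul_sum]
    · rw [Finset.mul_sum]
      refine Finset.sum_le_sum fun α _ => ?_
      rw [← Finset.sum_filter, Finset.sum_const, nsmul_eq_mul]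
      refine mul_le_mul_of_nonneg_right ?_ (hI0 σ α)
      exact_mod_cast α.card_edges_eq_le hk
    · simp_rw [← Finset.mul_sum]
      have := MixedCycle.sum_pow_card_nodes_le (m := m) (n := n) (p := p) (k := k)
        (x := 1 / n) (by positivity)
      refine (mul_le_mul_of_nonneg_left this (by positivity)).trans (le_of_eq ?_)
      simp only [overlapConst, hC]
      ring
  have h2n : (0 : ℝ) < 2 ^ n := by positivity
  rw [inv_mul_le_iff₀ h2n]
  refine (Finset.sum_le_sum fun σ _ => hσ σ).trans ?_
  simp_rw [Finset.sum_add_distrib]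
  rw [← Finset.mul_sum, Finset.sum_comm]
  have h5 : ∑ α, ∑ σ, I σ α ≤
      ∑ α : MixedCycle m n p k, 2 * 2 ^ n * ∏ t, stepVar lam μ μ' n (α.c t) :=
    Finset.sum_le_sum fun α _ => sum_integral_cycleStat_sq_le h hk α
  rw [← Finset.mul_sum] at h5
  have h6 := mul_le_mul_of_nonneg_left h5 (show (0 : ℝ) ≤ 2 * k ^ 2 by positivity)
  simp only [Finset.sum_const, Finset.card_univ, Fintype.card_fun, Fintype.card_fin,
    Fintype.card_units_int, nsmul_eq_mul, Nat.cast_pow, Nat.cast_ofNat]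
  linarith

lemma memLp_cycleSum (hk : 3 ≤ k) :
    MemLp (cycleSum k d lam μ) 2 (dataLaw d lam' μ' n p) := by
  rw [memLp_two_iff_integrable_sq measurable_cycleSum.aestronglyMeasurable]
  refine integrable_dataLaw fun σ => ?_
  have hexp : ∀ D : Data m n p, cycleSum k d lam μ D ^ 2 =
      ∑ α : MixedCycle m n p k, ∑ β : MixedCycle m n p k,
        cycleStat d lam μ α D * cycleStat d lam μ β D := fun D => by
    rw [pow_two, cycleSum, Finset.sum_mul_sum]
  simp_rw [hexp]
  exact integrable_finsetSum _ fun α _ => integrable_finsetSum _ fun β _ =>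
      integrable_cycleStat_mul hk α β

/-! ### Asymptotics of the cycle statistic -/

/-- The subjects and the layers or covariates of a mixed cycle are chosen separately. -/
lemma sum_mixedCycle (w : Fin m ⊕ Fin p → ℝ) :
    ∑ α : MixedCycle m n p k, ∏ t, w (α.c t) =
      open Classical in
      (∑ f : ZMod k → Fin n, if Function.Injective f then (1 : ℝ) else 0) *
      ∑ c : ZMod k → Fin m ⊕ Fin p,
        if ∀ t t' j, c t = Sum.inr j → c t' = Sum.inr j → t = t' then ∏ t, w (c t) else 0 := by
  classical
  rw [Finset.sum_mul_sum, ← Fintype.sum_prod_type']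
  have := Finset.sum_subtype (Finset.univ.filter fun α : (ZMod k → Fin n) × (ZMod k → Fin m ⊕ Fin p)
    => IsMixedCycle α.1 α.2) (p := fun α => IsMixedCycle α.1 α.2) (F := inferInstance)
    (by simp) (fun α => ∏ t, w (α.2 t))
  refine Eq.trans this.symm ?_
  rw [Finset.sum_filter]
  refine Finset.sum_congr rfl fun α _ => ?_
  simp only [IsMixedCycle]
  by_cases h1 : Function.Injective α.1 <;> simp [h1]

lemma sum_stepVar_le (h : Admissible d lam lam' μ μ' n) :
    ∑ α : MixedCycle m n p k, ∏ t, stepVar lam μ μ' n (α.c t) ≤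
      (∑ l, lam l ^ 2 + μ ^ 2 * (p / n) *
        (1 + (1 + μ) ^ 2 * (∫ z, (1 + z ^ 2) ^ 2 ∂(gaussianReal 0 1)) / n)) ^ k := by
  classical
  have hn : (0 : ℝ) < n := by linarith [h.one_le]
  have hμ : 0 ≤ μ := h.cov_nonneg.trans h.cov_le
  have hw : ∀ c : Fin m ⊕ Fin p, 0 ≤ stepVar lam μ μ' n c := by
    rintro (l | j)
    · simp only [stepVar, Sum.elim_inl]
      positivity
    · exact integral_nonneg fun z => by positivity
  have hk : Fintype.card (ZMod k) = k := ZMod.card k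
  have h1 : (∑ f : ZMod k → Fin n, if Function.Injective f then (1 : ℝ) else 0) ≤ (n : ℝ) ^ k := by
    calc _ ≤ ∑ _f : ZMod k → Fin n, (1 : ℝ) := Finset.sum_le_sum fun f _ => by split_ifs <;> simp
      _ = _ := by simp [hk]
  have h2 : (∑ c : ZMod k → Fin m ⊕ Fin p,
        if ∀ t t' j, c t = Sum.inr j → c t' = Sum.inr j → t = t' then
          ∏ t, stepVar lam μ μ' n (c t) else 0) ≤
      (∑ c : Fin m ⊕ Fin p, stepVar lam μ μ' n c) ^ k := by
    calc _ ≤ ∑ c : ZMod k → Fin m ⊕ Fin p, ∏ t, stepVar lam μ μ' n (c t) :=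
          Finset.sum_le_sum fun c _ => by
            split_ifs
            · exact le_rfl
            · exact Finset.prod_nonneg fun t _ => hw _
      _ = ∏ _t : ZMod k, ∑ c : Fin m ⊕ Fin p, stepVar lam μ μ' n c := by
          rw [Finset.prod_univ_sum, Fintype.piFinset_univ]
      _ = _ := by rw [Finset.prod_const, Finset.card_univ, hk]
  rw [sum_mixedCycle]
  refine (mul_le_mul h1 h2 (Finset.sum_nonneg fun c _ => ?_) (by positivity)).trans ?_
  · split_ifs
    · exact Finset.prod_nonneg fun t _ => hw _
    · exact le_rfl
  rw [← mul_pow]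
  refine pow_le_pow_left₀ (mul_nonneg hn.le (Finset.sum_nonneg fun c _ => hw c)) ?_ k
  rw [Fintype.sum_sum_type]
  simp only [stepVar, Sum.elim_inl, Sum.elim_inr, Finset.sum_const, Finset.card_univ,
    Fintype.card_fin, nsmul_eq_mul]
  have h3 : ∫ z, (μ / n * (1 + μ' / n * z ^ 2)) ^ 2 ∂(gaussianReal 0 1) ≤
      (μ / n) ^ 2 * (1 + (1 + μ) ^ 2 * (∫ z, (1 + z ^ 2) ^ 2 ∂(gaussianReal 0 1)) / n) := by
    have hi := integrable_one_add_sq_pow_gaussian 2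
    have h4 : ∫ z, (μ / n) ^ 2 * (1 + (1 + μ) ^ 2 / n * (1 + z ^ 2) ^ 2) ∂(gaussianReal 0 1) =
        (μ / n) ^ 2 * (1 + (1 + μ) ^ 2 * (∫ z, (1 + z ^ 2) ^ 2 ∂(gaussianReal 0 1)) / n) := by
      rw [integral_const_mul, integral_add (integrable_const _) (hi.const_mul _),
        integral_const_mul]
      simp only [integral_const, probReal_univ, smul_eq_mul, mul_one]
      ring
    rw [← h4]
    refine integral_mono_of_nonneg (Eventually.of_forall fun z => by positivity)
      (((integrable_const _).add (hi.const_mul _)).const_mul _)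
      (Eventually.of_forall fun z => ?_)
    simp only [mul_pow]
    refine mul_le_mul_of_nonneg_left ?_ (by positivity)
    have h5 : μ' / n * z ^ 2 ≤ μ / n * z ^ 2 := by
      gcongr
      exact h.cov_le
    have h6 : (0 : ℝ) ≤ μ' / n * z ^ 2 := by
      have := h.cov_nonneg
      positivity
    have h7 : (1 / n : ℝ) ≤ 1 := (div_le_one hn).2 h.one_le
    have h8 : (0 : ℝ) ≤ 1 / n := by positivity
    have h9 : (1 + μ / n * z ^ 2) ^ 2 ≤ 1 + (1 / n) * ((1 + μ * z ^ 2) ^ 2 - 1) := by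
      have h10 : 0 ≤ (μ * z ^ 2) ^ 2 * ((1 / n) * (1 - 1 / n)) :=
        mul_nonneg (sq_nonneg _) (mul_nonneg h8 (by linarith))
      have h11 : μ / n * z ^ 2 = μ * z ^ 2 * (1 / n) := by ring
      rw [h11]
      nlinarith
    have h12 : (1 + μ * z ^ 2) ^ 2 - 1 ≤ (1 + μ) ^ 2 * (1 + z ^ 2) ^ 2 := by
      rw [← mul_pow]
      have : (1 + μ * z ^ 2) ^ 2 ≤ ((1 + μ) * (1 + z ^ 2)) ^ 2 := by
        refine pow_le_pow_left₀ (by positivity) ?_ 2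
        nlinarith [sq_nonneg z, mul_nonneg hμ (sq_nonneg z)]
      linarith
    calc (1 + μ' / n * z ^ 2) ^ 2 ≤ (1 + μ / n * z ^ 2) ^ 2 := by
          refine pow_le_pow_left₀ (by linarith) (by linarith) 2
      _ ≤ 1 + (1 / n) * ((1 + μ) ^ 2 * (1 + z ^ 2) ^ 2) :=
          h9.trans (by linarith [mul_le_mul_of_nonneg_left h12 h8])
      _ = _ := by ring
  calc (n : ℝ) * (∑ l, lam l ^ 2 / n + p * ∫ z, (μ / n * (1 + μ' / n * z ^ 2)) ^ 2
        ∂(gaussianReal 0 1))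
      ≤ n * (∑ l, lam l ^ 2 / n + p * ((μ / n) ^ 2 * (1 + (1 + μ) ^ 2 *
        (∫ z, (1 + z ^ 2) ^ 2 ∂(gaussianReal 0 1)) / n))) := by gcongr
    _ = _ := by
        rw [← Finset.sum_div]
        field_simp

/-- The loss from the distinctness of the subjects is the factor `1 - k / n`, and the one from the
distinctness of the covariates is the term `k * μ ^ 2 / n`. -/
lemma le_sum_cycleMean (hlam : ∀ l, 0 ≤ lam l) (hμ : 0 ≤ μ) (hn : (k : ℝ) ≤ n)
    (hp : (k : ℝ) ≤ p) :
    ((1 - k / n) * (∑ l, lam l ^ 2 + μ ^ 2 * (p / n) - k * μ ^ 2 / n)) ^ k ≤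
      ∑ α : MixedCycle m n p k, cycleMean lam lam μ μ α := by
  classical
  have hk0 : (0 : ℝ) < k := by exact_mod_cast Nat.pos_of_ne_zero (NeZero.ne k)
  have hn0 : (0 : ℝ) < n := by linarith
  have hk : Fintype.card (ZMod k) = k := ZMod.card k
  have hw : ∀ c : Fin m ⊕ Fin p, 0 ≤ stepMean lam lam μ μ n c := by
    rintro (l | j)
    · have := hlam l
      simp only [stepMean, Sum.elim_inl]
      positivity
    · simp only [stepMean, Sum.elim_inr]
      positivity
  have hsum : ∑ c : Fin m ⊕ Fin p, stepMean lam lam μ μ n c =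
      (∑ l, lam l ^ 2 + μ ^ 2 * (p / n)) / n := by
    rw [Fintype.sum_sum_type]
    simp only [stepMean, Sum.elim_inl, Sum.elim_inr, Finset.sum_const, Finset.card_univ,
      Fintype.card_fin, nsmul_eq_mul, ← Finset.sum_div, pow_two]
    field_simp
  have h1 := pow_le_sum_exclusive (ι := ZMod k) (C := Fin n) (fun _ => True) (fun _ => (1 : ℝ))
    (fun _ => zero_le_one) zero_le_one (fun _ _ => le_rfl) (by simpa [hk] using hn)
  have h2 := pow_le_sum_exclusive (ι := ZMod k) (fun c : Fin m ⊕ Fin p => c.isRight)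
    (stepMean lam lam μ μ n) hw (w₀ := μ / n * (μ / n)) (by positivity)
    (by rintro (l | j) <;> simp [stepMean]) (by
      rw [hsum, hk, le_div_iff₀ hn0]
      have h3 : 0 ≤ ∑ l, lam l ^ 2 := Finset.sum_nonneg fun _ _ => by positivity
      calc (k : ℝ) * (μ / n * (μ / n)) * n = μ ^ 2 * (k / n) := by field_simp
        _ ≤ μ ^ 2 * (p / n) := by gcongr
        _ ≤ _ := by linarith)
  rw [hk] at h1 h2
  simp only [Finset.sum_const, Finset.card_univ, Fintype.card_fin, nsmul_eq_mul, mul_one,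
    Finset.prod_const_one] at h1
  rw [hsum] at h2
  have e1 : ∀ f : ZMod k → Fin n, (∀ t t', f t = f t' → True → t = t') ↔ Function.Injective f :=
    fun f => ⟨fun h t t' e => h t t' e trivial, fun h t t' e _ => h e⟩
  have e2 : ∀ c : ZMod k → Fin m ⊕ Fin p,
      (∀ t t', c t = c t' → (c t).isRight = true → t = t') ↔
      ∀ t t' j, c t = Sum.inr j → c t' = Sum.inr j → t = t' := by
    intro c
    constructor
    · intro h t t' j h1 h2
      exact h t t' (h1.trans h2.symm) (by simp [h1])
    · intro h t t' h1 h2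
      obtain ⟨j, hj⟩ := Sum.isRight_iff.1 h2
      exact h t t' j hj (h1 ▸ hj)
  simp only [e1] at h1
  simp only [e2] at h2
  have h4 := sum_mixedCycle (m := m) (n := n) (p := p) (k := k) (stepMean lam lam μ μ n)
  simp only [cycleMean]
  rw [h4]
  refine le_trans (le_of_eq ?_) (mul_le_mul h1 h2 (pow_nonneg ?_ k) ?_)
  · rw [← mul_pow]
    congr 1
    field_simp
  · have h3 : 0 ≤ ∑ l, lam l ^ 2 := Finset.sum_nonneg fun _ _ => by positivity
    have : (∑ l, lam l ^ 2 + μ ^ 2 * (p / n)) / n - k * (μ / n * (μ / n)) =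
        (∑ l, lam l ^ 2 + μ ^ 2 * ((p - k) / n)) / n := by
      field_simp
      ring
    rw [this]
    have : (0 : ℝ) ≤ p - k := by linarith
    positivity
  · exact Finset.sum_nonneg fun f _ => by split_ifs <;> simp

end statistic

/-! ### Asymptotic singularity above the threshold -/

/-- Tests with arbitrarily small limiting errors can be combined into one sequence of tests with
vanishing errors: take a nearly optimal event for each `n`. -/
lemma asympMutuallySingular_of_tests {X : ℕ → Type*} [∀ n, MeasurableSpace (X n)]
    {Q P : ∀ n, Measure (X n)} [∀ n, IsProbabilityMeasure (Q n)]
    (h : ∀ ε : ℝ, 0 < ε → ∃ E : ∀ n, Set (X n), (∀ n, MeasurableSet (E n)) ∧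
      ∀ᶠ n in atTop, P n (E n) ≤ ENNReal.ofReal ε ∧ Q n (E n)ᶜ ≤ ENNReal.ofReal ε) :
    AsympMutuallySingular Q P := by
  let φ : ℕ → ENNReal := fun n => ⨅ E : {E : Set (X n) // MeasurableSet E}, P n E + Q n (E : Set (X n))ᶜ
  have hφtop : ∀ n, φ n ≠ ⊤ := fun n =>
    ne_top_of_le_ne_top ENNReal.one_ne_top
      ((iInf_le _ ⟨∅, MeasurableSet.empty⟩).trans (by simp))
  have hφ : Tendsto φ atTop (𝓝 0) := by
    rw [ENNReal.tendsto_nhds_zero]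
    intro δ hδ
    obtain ⟨ε, hε, hεδ⟩ : ∃ ε : ℝ, 0 < ε ∧ ENNReal.ofReal ε + ENNReal.ofReal ε ≤ δ := by
      by_cases htop : δ = ⊤
      · exact ⟨1, one_pos, by simp [htop]⟩
      · refine ⟨δ.toReal / 2, half_pos (ENNReal.toReal_pos hδ.ne' htop), ?_⟩
        rw [← ENNReal.ofReal_add (by positivity) (by positivity), add_halves,
          ENNReal.ofReal_toReal htop]
    obtain ⟨E, hE, hev⟩ := h ε hε
    filter_upwards [hev] with n hn
    exact (iInf_le _ ⟨E n, hE n⟩).trans ((add_le_add hn.1 hn.2).trans hεδ)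
  have hex : ∀ n, ∃ E : {E : Set (X n) // MeasurableSet E},
      P n E + Q n (E : Set (X n))ᶜ < φ n + ((n : ENNReal) + 1)⁻¹ := fun n =>
    iInf_lt_iff.1 (ENNReal.lt_add_right (hφtop n) (by simp))
  choose E hE using hex
  have hinv : Tendsto (fun n : ℕ => ((n : ENNReal) + 1)⁻¹) atTop (𝓝 0) := by
    have := (tendsto_add_atTop_iff_nat 1).2 ENNReal.tendsto_inv_nat_nhds_zero
    simpa using this
  have hsum : Tendsto (fun n => φ n + ((n : ENNReal) + 1)⁻¹) atTop (𝓝 0) := by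
    simpa using hφ.add hinv
  refine ⟨fun n => E n, fun n => (E n).2, ?_, ?_⟩
  · exact tendsto_of_tendsto_of_tendsto_of_le_of_le tendsto_const_nhds hsum (fun _ => zero_le)
      fun n => le_self_add.trans (hE n).le
  · have h1 : Tendsto (fun n => Q n (E n : Set (X n))ᶜ) atTop (𝓝 0) :=
      tendsto_of_tendsto_of_tendsto_of_le_of_le tendsto_const_nhds hsum (fun _ => zero_le)
        fun n => le_add_self.trans (hE n).le
    have h2 : ∀ n, Q n (E n : Set (X n)) = 1 - Q n (E n : Set (X n))ᶜ := fun n => by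
      rw [← prob_compl_eq_one_sub (E n).2.compl, compl_compl]
    simp_rw [h2]
    have := ENNReal.Tendsto.sub (tendsto_const_nhds (x := (1 : ENNReal)) (f := atTop)) h1
      (Or.inl ENNReal.one_ne_top)
    simpa using this

/-- Chebyshev's inequality for the cycle statistic. -/
lemma measure_cycleSum_le {m n p k : ℕ} [NeZero k] {d lam lam' : Fin m → ℝ} {μ μ' : ℝ}
    (h : Admissible d lam lam' μ μ' n) (hk : 3 ≤ k) {b : ℝ} (hb : 0 < b) :
    dataLaw d lam' μ' n p {D | b ≤ |cycleSum k d lam μ D -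
        ∑ α : MixedCycle m n p k, cycleMean lam lam' μ μ' α|} ≤
      ENNReal.ofReal ((overlapConst k lam μ * (1 / n) * Real.exp (1 + p / n) +
        4 * k ^ 2 * (∑ l, lam l ^ 2 + μ ^ 2 * (p / n) *
        (1 + (1 + μ) ^ 2 * (∫ z, (1 + z ^ 2) ^ 2 ∂(gaussianReal 0 1)) / n)) ^ k) / b ^ 2) := by
  have hn : (0 : ℝ) < n := by linarith [h.one_le]
  have hμ : 0 ≤ μ := h.cov_nonneg.trans h.cov_le
  have h1 := meas_ge_le_variance_div_sq (memLp_cycleSum (n := n) (p := p) (d := d) (lam := lam)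
    (μ := μ) (lam' := lam') (μ' := μ') hk) hb
  rw [integral_cycleSum h hk] at h1
  refine h1.trans (ENNReal.ofReal_le_ofReal ?_)
  rw [variance_eq_sub (memLp_cycleSum hk), integral_cycleSum h hk]
  refine div_le_div_of_nonneg_right ?_ (by positivity)
  have h2 := integral_cycleSum_sq_le (p := p) h hk
  have h3 := sum_stepVar_le (p := p) (k := k) h
  have h4 : (1 + 1 / n : ℝ) ^ (n + p) ≤ Real.exp (1 + p / n) := by
    have h5 : (1 + 1 / n : ℝ) ≤ Real.exp (1 / n) := by linarith [Real.add_one_le_exp (1 / n : ℝ)]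
    calc (1 + 1 / n : ℝ) ^ (n + p) ≤ Real.exp (1 / n) ^ (n + p) := by gcongr
      _ = Real.exp (1 + p / n) := by
          rw [← Real.exp_nat_mul]
          congr 1
          push_cast
          field_simp
  have h6 : 0 ≤ overlapConst k lam μ := by
    have h1 : 0 ≤ momentConst lam μ := by
      have : 0 ≤ ∑ l, 2 * lam l ^ 2 := Finset.sum_nonneg fun _ _ => by positivity
      have : 0 ≤ μ * (1 + μ) := by positivity
      simp only [momentConst]
      linarith
    have h2 : 0 ≤ gaussConst k := by
      have := one_le_integral_gaussian (4 * k)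
      simp only [gaussConst]
      positivity
    simp only [overlapConst]
    positivity
  have h7 := mul_le_mul_of_nonneg_left h4
    (show 0 ≤ overlapConst k lam μ * (1 / n) by positivity)
  have h8 := mul_le_mul_of_nonneg_left h3 (show (0 : ℝ) ≤ 4 * k ^ 2 by positivity)
  have h9 : ∫ D, cycleSum k d lam μ D ^ 2 ∂(dataLaw d lam' μ' n p) =
    ∫ D, (cycleSum k d lam μ ^ 2) D ∂(dataLaw d lam' μ' n p) := rfl
  rw [← h9]
  linarith

lemma tendsto_ratio_inv {p : ℕ → ℕ} {γ : ℝ} (hγ : 0 < γ)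
    (hp : Tendsto (fun n : ℕ => (n : ℝ) / (p n : ℝ)) atTop (𝓝 γ)) :
    Tendsto (fun n : ℕ => (p n : ℝ) / (n : ℝ)) atTop (𝓝 (1 / γ)) := by
  have := hp.inv₀ hγ.ne'
  simpa only [inv_div, one_div] using this

lemma tendsto_cov_atTop {p : ℕ → ℕ} {γ : ℝ} (hγ : 0 < γ)
    (hp : Tendsto (fun n : ℕ => (n : ℝ) / (p n : ℝ)) atTop (𝓝 γ)) :
    Tendsto (fun n : ℕ => (p n : ℝ)) atTop atTop := by
  have h1 := (tendsto_ratio_inv hγ hp).pos_mul_atTop (by positivity)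
    (tendsto_natCast_atTop_atTop (R := ℝ))
  refine h1.congr' ?_
  filter_upwards [eventually_gt_atTop 0] with n hn
  have : (n : ℝ) ≠ 0 := by exact_mod_cast hn.ne'
  field_simp

lemma le_sqrt_of_sub_nonneg {d lam : ℝ} (hd : 1 < d) (hb : 0 ≤ d - lam * √d) : lam ≤ √d := by
  have hs : 0 < √d := Real.sqrt_pos.2 (by linarith)
  have hss : √d * √d = d := Real.mul_self_sqrt (by linarith)
  by_contra! hcon
  nlinarith

theorem asympMutuallySingular_dataLaw {m : ℕ} {d lam : Fin m → ℝ} {μ γ : ℝ} {p : ℕ → ℕ}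
    (hd : ∀ l, 1 < d l) (hlam : ∀ l, 0 ≤ lam l) (hb : ∀ l, 0 ≤ d l - lam l * √(d l))
    (hμ : 0 ≤ μ) (hγ : 0 < γ)
    (hp : Tendsto (fun n : ℕ => (n : ℝ) / (p n : ℝ)) atTop (𝓝 γ))
    (hgt : 1 < (∑ l, lam l ^ 2) + μ ^ 2 / γ) :
    AsympMutuallySingular (fun n => dataLaw d lam μ n (p n)) (fun n => dataLaw d 0 0 n (p n)) := by
  set Λ := (∑ l, lam l ^ 2) + μ ^ 2 / γ with hΛ
  have hΛ0 : 0 < Λ := by linarith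
  refine asympMutuallySingular_of_tests fun ε hε => ?_
  -- `16 * k ^ 2 / Λ ^ k` is the limit of the Chebyshev bound for cycles of length `k`
  obtain ⟨k, hk3, hkε⟩ : ∃ k : ℕ, 3 ≤ k ∧ 16 * ((k : ℝ) ^ 2 / Λ ^ k) < ε := by
    have h1 := (tendsto_pow_const_div_const_pow_of_one_lt 2 hgt).const_mul 16
    rw [mul_zero] at h1
    obtain ⟨k, hk⟩ := ((eventually_ge_atTop 3).and (h1.eventually (gt_mem_nhds hε))).exists
    exact ⟨k, hk⟩
  have : NeZero k := ⟨by omega⟩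
  set M := ∫ z : ℝ, (1 + z ^ 2) ^ 2 ∂(gaussianReal 0 1)
  let B : ℕ → ℝ := fun n =>
    ((1 - k / n) * (∑ l, lam l ^ 2 + μ ^ 2 * (p n / n) - k * μ ^ 2 / n)) ^ k
  let V : ℕ → ℝ := fun n => overlapConst k lam μ * (1 / n) * Real.exp (1 + p n / n) +
    4 * k ^ 2 * (∑ l, lam l ^ 2 + μ ^ 2 * (p n / n) * (1 + (1 + μ) ^ 2 * M / n)) ^ k
  have hpn := tendsto_ratio_inv hγ hp
  have hdiv : ∀ c : ℝ, Tendsto (fun n : ℕ => c / (n : ℝ)) atTop (𝓝 0) := fun c =>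
    tendsto_const_div_atTop_nhds_zero_nat c
  have hB : Tendsto B atTop (𝓝 (Λ ^ k)) := by
    have h1 := (((hdiv k).const_sub 1).mul
      (((hpn.const_mul (μ ^ 2)).const_add (∑ l, lam l ^ 2)).sub (hdiv (k * μ ^ 2)))).pow k
    have h2 : ((1 - 0) * (∑ l, lam l ^ 2 + μ ^ 2 * (1 / γ) - 0)) ^ k = Λ ^ k := by
      rw [hΛ]
      congr 1
      ring
    rwa [h2] at h1
  have hV : Tendsto V atTop (𝓝 (4 * k ^ 2 * Λ ^ k)) := by
    have h1 := (((hdiv 1).const_mul (overlapConst k lam μ)).mul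
      ((Real.continuous_exp.tendsto _).comp (hpn.const_add 1))).add
      (((((hpn.const_mul (μ ^ 2)).mul ((hdiv ((1 + μ) ^ 2 * M)).const_add 1)).const_add
        (∑ l, lam l ^ 2)).pow k).const_mul (4 * (k : ℝ) ^ 2))
    have h2 : overlapConst k lam μ * 0 * Real.exp (1 + 1 / γ) + 4 * (k : ℝ) ^ 2 *
        (∑ l, lam l ^ 2 + μ ^ 2 * (1 / γ) * (1 + 0)) ^ k = 4 * k ^ 2 * Λ ^ k := by
      rw [hΛ, mul_zero, zero_mul, zero_add, add_zero, mul_one, mul_one_div]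
    rwa [h2] at h1
  have hratio : ∀ᶠ n in atTop, V n / (B n / 2) ^ 2 < ε := by
    have h1 := hV.div ((hB.div_const 2).pow 2) (by positivity)
    refine h1.eventually (gt_mem_nhds (lt_of_eq_of_lt ?_ hkε))
    field_simp
    ring
  have hBpos : ∀ᶠ n in atTop, 0 < B n := hB.eventually (lt_mem_nhds (by positivity))
  have hlarge : ∀ᶠ n : ℕ in atTop, ∀ l, 2 * d l ≤ n :=
    eventually_all.2 fun l => tendsto_natCast_atTop_atTop.eventually (eventually_ge_atTop _)
  have hlek : ∀ᶠ n : ℕ in atTop, (k : ℝ) ≤ n :=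
    tendsto_natCast_atTop_atTop.eventually (eventually_ge_atTop _)
  have hpk := (tendsto_cov_atTop hγ hp).eventually (eventually_ge_atTop (k : ℝ))
  refine ⟨fun n => {D | B n / 2 ≤ cycleSum k d lam μ D}, fun n =>
    measurableSet_le measurable_const measurable_cycleSum, ?_⟩
  filter_upwards [hratio, hBpos, hlarge, hlek, hpk, eventually_ge_atTop 1]
    with n hr hBn hln hkn hpkn hn1
  have hn1' : (1 : ℝ) ≤ n := by exact_mod_cast hn1
  have hA0 : Admissible d lam 0 μ 0 n :=
    ⟨hd, fun _ => le_rfl, hlam, fun l => le_sqrt_of_sub_nonneg (hd l) (hb l), hln, le_rfl, hμ, hn1'⟩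
  have hA1 : Admissible d lam lam μ μ n :=
    ⟨hd, hlam, fun _ => le_rfl, fun l => le_sqrt_of_sub_nonneg (hd l) (hb l), hln, hμ, le_rfl, hn1'⟩
  have hmean := le_sum_cycleMean (m := m) (n := n) (p := p n) (k := k) hlam hμ hkn hpkn
  have hzero : ∑ α : MixedCycle m n (p n) k, cycleMean lam 0 μ 0 α = 0 := by
    refine Finset.sum_eq_zero fun α _ => Finset.prod_eq_zero (Finset.mem_univ 0) ?_
    rcases α.c 0 with l | j <;> simp [stepMean]
  constructor
  · refine (measure_mono ?_).trans ((measure_cycleSum_le hA0 hk3 (half_pos hBn)).trans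
      (ENNReal.ofReal_le_ofReal hr.le))
    intro D hD
    simp only [Set.mem_ofPred_eq] at hD ⊢
    rw [hzero, sub_zero]
    exact hD.trans (le_abs_self _)
  · refine (measure_mono ?_).trans ((measure_cycleSum_le hA1 hk3 (half_pos hBn)).trans
      (ENNReal.ofReal_le_ofReal hr.le))
    intro D hD
    simp only [Set.mem_compl_iff, Set.mem_ofPred_eq, not_le] at hD ⊢
    rw [abs_sub_comm]
    refine le_trans ?_ (le_abs_self _)
    have : B n ≤ ∑ α : MixedCycle m n (p n) k, cycleMean lam lam μ μ α := hmean
    linarith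

/-! ### Densities of the conditional laws -/

lemma lintegral_pi_prod {ι : Type*} [Fintype ι] {Ω : ι → Type*} [∀ i, MeasurableSpace (Ω i)]
    {ν : ∀ i, Measure (Ω i)} [∀ i, IsProbabilityMeasure (ν i)] {f : ∀ i, Ω i → ENNReal}
    (hf : ∀ i, Measurable (f i)) :
    ∫⁻ x, ∏ i, f i (x i) ∂(Measure.pi ν) = ∏ i, ∫⁻ z, f i z ∂(ν i) := by
  rw [lintegral_prod_eq_prod_lintegral_of_indepFun Finset.univ
    (fun i (x : ∀ i, Ω i) => f i (x i))
    (iIndepFun_pi fun i => (hf i).aemeasurable)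
    fun i => (hf i).comp (measurable_pi_apply i)]
  refine Finset.prod_congr rfl fun i _ => ?_
  have hmp := measurePreserving_eval ν i
  conv_rhs => rw [← hmp.map_eq, lintegral_map (hf i) hmp.measurable]

/-- A product of measures with densities has the product density. -/
lemma pi_eq_withDensity {ι : Type*} [Fintype ι] {Ω : ι → Type*} [∀ i, MeasurableSpace (Ω i)]
    {ν ρ : ∀ i, Measure (Ω i)} [∀ i, IsProbabilityMeasure (ν i)]
    [∀ i, IsProbabilityMeasure (ρ i)] {f : ∀ i, Ω i → ENNReal} (hf : ∀ i, Measurable (f i))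
    (h : ∀ i, ρ i = (ν i).withDensity (f i)) :
    Measure.pi ρ = (Measure.pi ν).withDensity fun x => ∏ i, f i (x i) := by
  classical
  refine Measure.pi_eq fun s hs => ?_
  rw [withDensity_apply _ (MeasurableSet.univ_pi hs),
    ← lintegral_indicator (MeasurableSet.univ_pi hs)]
  have h1 : ∀ x, (Set.univ.pi s).indicator (fun x => ∏ i, f i (x i)) x =
      ∏ i, (s i).indicator (f i) (x i) := by
    intro x
    by_cases hx : x ∈ Set.univ.pi s
    · rw [Set.indicator_of_mem hx]
      exact Finset.prod_congr rfl fun i _ =>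
        (Set.indicator_of_mem (hx i (Set.mem_univ i)) _).symm
    · rw [Set.indicator_of_notMem hx]
      obtain ⟨i, hi⟩ : ∃ i, x i ∉ s i := by simpa using hx
      exact (Finset.prod_eq_zero (Finset.mem_univ i) (Set.indicator_of_notMem hi _)).symm
  simp_rw [h1]
  rw [lintegral_pi_prod fun i => (hf i).indicator (hs i)]
  refine Finset.prod_congr rfl fun i _ => ?_
  rw [lintegral_indicator (hs i), h i, withDensity_apply _ (hs i)]

/-- The density of `N(θ, 1)` with respect to `N(0, 1)`. -/
def gaussRatio (θ z : ℝ) : ENNReal := ENNReal.ofReal (Real.exp (θ * z - θ ^ 2 / 2))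

lemma measurable_gaussRatio (θ : ℝ) : Measurable (gaussRatio θ) := by
  unfold gaussRatio
  fun_prop

lemma gaussianReal_eq_withDensity (θ : ℝ) :
    gaussianReal θ 1 = (gaussianReal 0 1).withDensity (gaussRatio θ) := by
  rw [gaussianReal_of_var_ne_zero _ one_ne_zero, gaussianReal_of_var_ne_zero _ one_ne_zero,
    ← withDensity_mul _ (measurable_gaussianPDF _ _) (measurable_gaussRatio θ)]
  congr 1
  ext z
  simp only [Pi.mul_apply, gaussianPDF, gaussRatio]
  rw [← ENNReal.ofReal_mul (gaussianPDFReal_nonneg _ _ _)]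
  congr 1
  simp only [gaussianPDFReal, NNReal.coe_one]
  rw [mul_assoc _ (Real.exp _), ← Real.exp_add]
  congr 2
  ring

lemma lintegral_gaussRatio (θ : ℝ) : ∫⁻ z, gaussRatio θ z ∂(gaussianReal 0 1) = 1 := by
  have h := measure_univ (μ := gaussianReal θ 1)
  rwa [gaussianReal_eq_withDensity, withDensity_apply _ MeasurableSet.univ,
    Measure.restrict_univ] at h

lemma lintegral_gaussRatio_mul (θ θ' : ℝ) :
    ∫⁻ z, gaussRatio θ z * gaussRatio θ' z ∂(gaussianReal 0 1) =
      ENNReal.ofReal (Real.exp (θ * θ')) := by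
  have h : ∀ z, gaussRatio θ z * gaussRatio θ' z =
      ENNReal.ofReal (Real.exp (θ * θ')) * gaussRatio (θ + θ') z := by
    intro z
    simp only [gaussRatio]
    rw [← ENNReal.ofReal_mul (by positivity), ← ENNReal.ofReal_mul (by positivity),
      ← Real.exp_add, ← Real.exp_add]
    congr 2
    ring
  simp_rw [h]
  rw [lintegral_const_mul _ (measurable_gaussRatio _), lintegral_gaussRatio, mul_one]

lemma lintegral_exp_mul_gaussian (a : ℝ) :
    ∫⁻ z, ENNReal.ofReal (Real.exp (a * z)) ∂(gaussianReal 0 1) =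
      ENNReal.ofReal (Real.exp (a ^ 2 / 2)) := by
  have h : ∀ z, ENNReal.ofReal (Real.exp (a * z)) =
      ENNReal.ofReal (Real.exp (a ^ 2 / 2)) * gaussRatio a z := by
    intro z
    simp only [gaussRatio]
    rw [← ENNReal.ofReal_mul (by positivity), ← Real.exp_add]
    congr 2
    ring
  simp_rw [h]
  rw [lintegral_const_mul _ (measurable_gaussRatio _), lintegral_gaussRatio, mul_one]

/-- The density of the Bernoulli law of parameter `q` with respect to the one of parameter `r`. -/
def bernRatio (r q : ℝ) (b : Bool) : ENNReal :=
  ENNReal.ofReal (if b = true then q / r else (1 - q) / (1 - r))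

lemma bernoulliMeasure_true (q : unitInterval) :
    bernoulliMeasure true false q {true} = ENNReal.ofReal q := by
  rw [bernoulliMeasure_apply_of_mem_of_notMem _ (by measurability) (by simp) (by simp),
    ENNReal.ofReal, Real.toNNReal_of_nonneg q.2.1]
  rfl

lemma bernoulliMeasure_false (q : unitInterval) :
    bernoulliMeasure true false q {false} = ENNReal.ofReal (1 - q) := by
  rw [bernoulliMeasure_apply_of_notMem_of_mem _ (by measurability) (by simp) (by simp),
    ENNReal.ofReal, Real.toNNReal_of_nonneg (sub_nonneg.2 q.2.2)]
  rfl

lemma bernoulliMeasure_eq_withDensity {r : unitInterval} (h0 : 0 < (r : ℝ)) (h1 : (r : ℝ) < 1)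
    (q : unitInterval) :
    bernoulliMeasure true false q =
      (bernoulliMeasure true false r).withDensity (bernRatio r q) := by
  have h2 : (0 : ℝ) < 1 - r := by linarith
  have hq0 := q.2.1
  have hq1 : (0 : ℝ) ≤ 1 - q := by linarith [q.2.2]
  refine Measure.ext_of_singleton fun b => ?_
  rw [withDensity_apply _ (by measurability), lintegral_singleton]
  cases b
  · rw [bernoulliMeasure_false, bernoulliMeasure_false, bernRatio,
      ← ENNReal.ofReal_mul (by simp; positivity)]
    congr 1
    simp only [Bool.false_eq_true, if_false]
    field_simp
  · rw [bernoulliMeasure_true, bernoulliMeasure_true, bernRatio,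
      ← ENNReal.ofReal_mul (by simp; positivity)]
    congr 1
    simp only [if_true]
    field_simp

lemma lintegral_bernoulli (r : unitInterval) (g : Bool → ENNReal) :
    ∫⁻ b, g b ∂(bernoulliMeasure true false r) =
      g true * ENNReal.ofReal r + g false * ENNReal.ofReal (1 - r) := by
  rw [lintegral_fintype, Fintype.sum_bool, bernoulliMeasure_true, bernoulliMeasure_false]

lemma lintegral_bernRatio_mul {r : unitInterval} (h0 : 0 < (r : ℝ)) (h1 : (r : ℝ) < 1)
    (q q' : unitInterval) :
    ∫⁻ b, bernRatio r q b * bernRatio r q' b ∂(bernoulliMeasure true false r) =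
      ENNReal.ofReal (1 + (q - r) * (q' - r) / (r * (1 - r))) := by
  have h2 : (0 : ℝ) < 1 - r := by linarith
  have hq0 := q.2.1
  have hq1 : (0 : ℝ) ≤ 1 - q := by linarith [q.2.2]
  have hq0' := q'.2.1
  have hq1' : (0 : ℝ) ≤ 1 - q' := by linarith [q'.2.2]
  rw [lintegral_bernoulli]
  simp only [bernRatio, if_true, Bool.false_eq_true, if_false]
  rw [← ENNReal.ofReal_mul (by positivity), ← ENNReal.ofReal_mul (by positivity),
    ← ENNReal.ofReal_mul (by positivity), ← ENNReal.ofReal_mul (by positivity),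
    ← ENNReal.ofReal_add (by positivity) (by positivity)]
  congr 1
  field_simp
  ring

/-! ### The truncated second moment -/

/-- A mixture with densities `L t` gives small probability to the events which are rare under `P`,
if the second moment of the density is finite after discarding a rare set of parameters `t`. -/
lemma mixture_le_of_second_moment {X T : Type*} [MeasurableSpace X] [MeasurableSpace T]
    (P : Measure X) [SFinite P] (π : Measure T) [SFinite π] {L : T → X → ENNReal}
    (hL : Measurable (Function.uncurry L)) (hL1 : ∀ t, ∫⁻ x, L t x ∂P ≤ 1) {A : Set T}
    (hA : MeasurableSet A) {E : Set X} {K : ENNReal} (hK0 : K ≠ 0)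
    (hK : K ≠ ⊤) :
    ∫⁻ t, ∫⁻ x in E, L t x ∂P ∂π ≤
      π Aᶜ + K * P E + K⁻¹ * ∫⁻ t in A, ∫⁻ s in A, ∫⁻ x, L t x * L s x ∂P ∂π ∂π := by
  have hLx : ∀ t, Measurable (L t) := fun t => hL.comp measurable_prodMk_left
  have hLt : ∀ x, Measurable fun t => L t x := fun x => hL.comp measurable_prodMk_right
  let M : X → ENNReal := fun x => ∫⁻ t in A, L t x ∂π
  have hM : Measurable M := Measurable.lintegral_prod_left' hL
  have hswap : ∫⁻ t in A, ∫⁻ x in E, L t x ∂P ∂π = ∫⁻ x in E, M x ∂P :=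
    lintegral_lintegral_swap hL.aemeasurable
  have hsq : ∫⁻ x, M x * M x ∂P = ∫⁻ t in A, ∫⁻ s in A, ∫⁻ x, L t x * L s x ∂P ∂π ∂π := by
    have h1 : ∀ x, M x * M x = ∫⁻ t in A, L t x * M x ∂π := fun x => by
      rw [lintegral_mul_const _ (hLt x)]
    simp_rw [h1]
    rw [lintegral_lintegral_swap]
    · refine lintegral_congr fun t => ?_
      have h2 : ∀ x, L t x * M x = ∫⁻ s in A, L t x * L s x ∂π := fun x => by
        rw [lintegral_const_mul _ (hLt x)]
      simp_rw [h2]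
      rw [lintegral_lintegral_swap]
      refine Measurable.aemeasurable ?_
      exact ((hLx t).comp measurable_fst).mul (hL.comp measurable_swap)
    · refine Measurable.aemeasurable ?_
      exact (hL.comp measurable_swap).mul (hM.comp measurable_fst)
  have hpt : ∀ x, M x ≤ K + K⁻¹ * (M x * M x) := by
    intro x
    rcases le_total (M x) K with h | h
    · exact h.trans le_self_add
    · refine le_trans ?_ le_add_self
      rw [← mul_assoc]
      refine le_mul_of_one_le_left zero_le ?_
      calc (1 : ENNReal) = K⁻¹ * K := (ENNReal.inv_mul_cancel hK0 hK).symm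
        _ ≤ _ := by gcongr
  rw [← lintegral_add_compl _ hA, hswap]
  have h1 : ∫⁻ t in Aᶜ, ∫⁻ x in E, L t x ∂P ∂π ≤ π Aᶜ := by
    calc _ ≤ ∫⁻ _t in Aᶜ, 1 ∂π :=
          lintegral_mono fun t => (setLIntegral_le_lintegral _ _).trans (hL1 t)
      _ = π Aᶜ := by simp
  have h2 : ∫⁻ x in E, M x ∂P ≤ K * P E + K⁻¹ * ∫⁻ x, M x * M x ∂P := by
    calc ∫⁻ x in E, M x ∂P ≤ ∫⁻ x in E, (K + K⁻¹ * (M x * M x)) ∂P := lintegral_mono hpt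
      _ = K * P E + K⁻¹ * ∫⁻ x in E, M x * M x ∂P := by
          rw [lintegral_add_left measurable_const, lintegral_const_mul K⁻¹ (f := fun x => M x * M x)
            (hM.mul hM)]
          simp
      _ ≤ _ := by
          gcongr
          exact Measure.restrict_le_self
  rw [hsq] at h2
  calc _ ≤ (K * P E + K⁻¹ * ∫⁻ t in A, ∫⁻ s in A, ∫⁻ x, L t x * L s x ∂P ∂π ∂π) + π Aᶜ :=
        add_le_add h2 h1
    _ = _ := by ring

/-! ### The exponential moment of a sum of random signs -/

/-- `∫ exp (c z² / 2)` under the standard normal law, finite for `c < 1`. -/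
def gaussSqConst (c : ℝ) : ENNReal :=
  ∫⁻ z, ENNReal.ofReal (Real.exp (c * z ^ 2 / 2)) ∂(gaussianReal 0 1)

lemma gaussSqConst_lt_top {c : ℝ} (hc : c < 1) : gaussSqConst c < ⊤ := by
  rw [gaussSqConst, gaussianReal_of_var_ne_zero _ one_ne_zero,
    lintegral_withDensity_eq_lintegral_mul _ (measurable_gaussianPDF _ _) (by fun_prop)]
  have h1 : ∀ z : ℝ, (gaussianPDF 0 1 * fun z => ENNReal.ofReal (Real.exp (c * z ^ 2 / 2))) z =
      ENNReal.ofReal ((√(2 * Real.pi))⁻¹ * Real.exp (-((1 - c) / 2) * z ^ 2)) := by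
    intro z
    simp only [Pi.mul_apply, gaussianPDF]
    rw [← ENNReal.ofReal_mul (gaussianPDFReal_nonneg _ _ _)]
    congr 1
    simp only [gaussianPDFReal, NNReal.coe_one, mul_one, sub_zero]
    rw [mul_assoc, ← Real.exp_add]
    congr 2
    ring
  simp_rw [h1]
  exact ((integrable_exp_neg_mul_sq (by linarith)).const_mul _).lintegral_lt_top

/-- The Hubbard-Stratonovich identity linearizes the square; the labels then decouple and
`cosh x ≤ exp (x² / 2)`. -/
lemma sum_exp_sq_le {n : ℕ} (hn : 0 < n) {c : ℝ} (hc : 0 ≤ c) :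
    ∑ s : Fin n → ℤˣ, ENNReal.ofReal (Real.exp (c / n * (∑ i, spin (s i)) ^ 2 / 2)) ≤
      2 ^ n * gaussSqConst c := by
  have hn0 : (0 : ℝ) < n := by exact_mod_cast hn
  set a := √(c / n) with ha
  have ha2 : a ^ 2 = c / n := Real.sq_sqrt (by positivity)
  have h1 : ∀ s : Fin n → ℤˣ,
      ENNReal.ofReal (Real.exp (c / n * (∑ i, spin (s i)) ^ 2 / 2)) =
      ∫⁻ z, ENNReal.ofReal (Real.exp (a * (∑ i, spin (s i)) * z)) ∂(gaussianReal 0 1) := by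
    intro s
    rw [lintegral_exp_mul_gaussian, mul_pow, ha2]
  simp_rw [h1]
  rw [← lintegral_finsetSum _ fun s _ => by fun_prop, gaussSqConst,
    ← lintegral_const_mul _ (by fun_prop)]
  refine lintegral_mono fun z => ?_
  rw [← ENNReal.ofReal_sum_of_nonneg fun _ _ => by positivity]
  have h2 : (2 : ENNReal) ^ n = ENNReal.ofReal (2 ^ n) := by
    rw [ENNReal.ofReal_pow (by norm_num)]
    simp
  rw [h2, ← ENNReal.ofReal_mul (by positivity)]
  refine ENNReal.ofReal_le_ofReal ?_
  have h3 : ∑ s : Fin n → ℤˣ, Real.exp (a * (∑ i, spin (s i)) * z) =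
      (2 * Real.cosh (a * z)) ^ n := by
    calc _ = ∑ s : Fin n → ℤˣ, ∏ i, Real.exp (a * z * spin (s i)) := by
          refine Finset.sum_congr rfl fun s _ => ?_
          rw [← Real.exp_sum, ← Finset.mul_sum]
          congr 1
          ring
      _ = ∏ _i : Fin n, ∑ t : ℤˣ, Real.exp (a * z * spin t) := by
          rw [Finset.prod_univ_sum, Fintype.piFinset_univ]
      _ = _ := by
          rw [Finset.prod_const, Finset.card_univ, Fintype.card_fin, Real.cosh_eq]
          congr 1
          rw [show (Finset.univ : Finset ℤˣ) = {1, -1} from rfl, Finset.sum_pair (by decide)]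
          simp [spin]
          ring
  rw [h3, mul_pow]
  refine mul_le_mul_of_nonneg_left ?_ (by positivity)
  calc Real.cosh (a * z) ^ n ≤ Real.exp ((a * z) ^ 2 / 2) ^ n :=
        pow_le_pow_left₀ (Real.cosh_pos _).le (Real.cosh_le_exp_half_sq _) n
    _ = Real.exp (c * z ^ 2 / 2) := by
        rw [← Real.exp_nat_mul, mul_pow, ha2]
        congr 1
        field_simp

lemma spin_mul (s t : ℤˣ) : spin (s * t) = spin s * spin t := by simp [spin]

/-- Only the product of two independent label vectors matters, and it is again uniform. -/
lemma sum_sum_labels {n : ℕ} (F : ℝ → ENNReal) :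
    ∑ σ : Fin n → ℤˣ, ∑ τ : Fin n → ℤˣ, F (∑ i, spin (σ i) * spin (τ i)) =
      2 ^ n * ∑ s : Fin n → ℤˣ, F (∑ i, spin (s i)) := by
  have h : ∀ σ : Fin n → ℤˣ, ∑ τ : Fin n → ℤˣ, F (∑ i, spin (σ i) * spin (τ i)) =
      ∑ s : Fin n → ℤˣ, F (∑ i, spin (s i)) := fun σ => by
    rw [← Equiv.sum_comp (Equiv.mulLeft σ)]
    simp [spin_mul, ← mul_assoc, spin_mul_self]
  simp [h]

lemma sum_pairs_mul {n : ℕ} (s : Fin n → ℝ) :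
    (∑ i, s i) ^ 2 = ∑ i, s i ^ 2 + 2 * ∑ q : Pairs n, s q.1.1 * s q.1.2 := by
  have h1 : ∑ q : Pairs n, s q.1.1 * s q.1.2 =
      ∑ i, ∑ j, if i < j then s i * s j else 0 := by
    rw [← Fintype.sum_prod_type', ← Finset.sum_filter]
    exact (Finset.sum_subtype (p := fun e : Fin n × Fin n => e.1 < e.2) _ (by simp)
      fun e : Fin n × Fin n => s e.1 * s e.2).symm
  have h2 : ∑ i, ∑ j, (if j < i then s i * s j else 0) =
      ∑ i, ∑ j, if i < j then s i * s j else 0 := by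
    rw [Finset.sum_comm]
    simp_rw [mul_comm (s _) (s _)]
  have h3 : ∑ i, s i ^ 2 = ∑ i, ∑ j, if i = j then s i * s j else 0 := by
    simp [pow_two]
  rw [pow_two, Finset.sum_mul_sum, h1, two_mul, h3]
  nth_rewrite 2 [← h2]
  simp_rw [← Finset.sum_add_distrib]
  refine Finset.sum_congr rfl fun i _ => Finset.sum_congr rfl fun j _ => ?_
  rcases lt_trichotomy i j with h | h | h
  · simp [h, h.ne, h.not_gt]
  · simp [h]
  · simp [h, h.ne', h.not_gt]

/-! ### Contiguity below the threshold -/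

/-- The edge probability in the absence of communities. -/
def nullProb {m : ℕ} (d : Fin m → ℝ) (n : ℕ) (l : Fin m) : unitInterval := edgeProb (d l) 0 n 1 1

/-- The null law of the edge indicators and the covariate matrix. -/
def baseLaw {m : ℕ} (d : Fin m → ℝ) (n p : ℕ) :
    Measure ((Fin m → Pairs n → Bool) × (Fin n → Fin p → ℝ)) :=
  (Measure.pi fun l => Measure.pi fun _ : Pairs n => bernoulliMeasure true false (nullProb d n l)).prod
    (Measure.pi fun _ : Fin n => Measure.pi fun _ : Fin p => gaussianReal 0 1)

/-- The likelihood ratio of the data, given the labels `σ` and the vector `u`. -/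
def labelDensity {m n p : ℕ} (d lam : Fin m → ℝ) (μ : ℝ) (σ : Fin n → ℤˣ) (u : Fin p → ℝ)
    (y : (Fin m → Pairs n → Bool) × (Fin n → Fin p → ℝ)) : ENNReal :=
  (∏ l, ∏ q : Pairs n,
    bernRatio (nullProb d n l) (edgeProb (d l) (lam l) n (σ q.1.1) (σ q.1.2)) (y.1 l q)) *
  ∏ i, ∏ j, gaussRatio (√(μ / n) * spin (σ i) * u j) (y.2 i j)

/-- The data with the graphs built from the edge indicators. -/
def toData {m n p : ℕ} (y : (Fin m → Pairs n → Bool) × (Fin n → Fin p → ℝ)) : Data m n p :=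
  (fun l => graphOf (y.1 l), y.2)

section density

variable {m n p : ℕ} {d lam : Fin m → ℝ} {μ : ℝ} {σ τ : Fin n → ℤˣ}

instance : IsProbabilityMeasure (baseLaw d n p) := by
  unfold baseLaw; infer_instance

lemma measurable_toData : Measurable (toData (m := m) (n := n) (p := p)) :=
  Measurable.prodMk (measurable_pi_lambda _ fun l =>
    measurable_graphOf.comp ((measurable_pi_apply l).comp measurable_fst)) measurable_snd

lemma measurable_bernRatio (r q : ℝ) : Measurable (bernRatio r q) := Measurable.of_discrete

lemma measurable_labelDensity : Measurable
    fun z : (Fin p → ℝ) × ((Fin m → Pairs n → Bool) × (Fin n → Fin p → ℝ)) =>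
      labelDensity d lam μ σ z.1 z.2 := by
  unfold labelDensity
  refine Measurable.mul ?_ ?_
  · refine Finset.measurable_fun_prod _ fun l _ => Finset.measurable_fun_prod _ fun q _ => ?_
    exact (measurable_bernRatio _ _).comp (by fun_prop)
  · refine Finset.measurable_fun_prod _ fun i _ => Finset.measurable_fun_prod _ fun j _ => ?_
    unfold gaussRatio
    fun_prop

lemma edgeProb_zero (d : ℝ) (n : ℕ) (s t : ℤˣ) : edgeProb d 0 n s t = edgeProb d 0 n 1 1 := by
  simp [edgeProb]

lemma nullProb_val (hd : ∀ l, 1 < d l) (hn : ∀ l, 2 * d l ≤ n) (l : Fin m) :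
    (nullProb d n l : ℝ) = d l / n := by
  rw [nullProb, edgeProb_val (hd l) le_rfl (Real.sqrt_nonneg _) (hn l)]
  simp

lemma nullProb_mem (hd : ∀ l, 1 < d l) (hn : ∀ l, 2 * d l ≤ n) (l : Fin m) :
    0 < (nullProb d n l : ℝ) ∧ (nullProb d n l : ℝ) < 1 := by
  have h1 := hd l
  have h2 := hn l
  have h3 : (0 : ℝ) < n := by linarith
  rw [nullProb_val hd hn, div_lt_one h3]
  exact ⟨div_pos (by linarith) h3, by linarith⟩

/-- Given the labels and `u`, the data are a product measure with density `labelDensity`. -/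
lemma map_eq_withDensity (hd : ∀ l, 1 < d l) (hn : ∀ l, 2 * d l ≤ n) (u : Fin p → ℝ) :
    ((indicatorLaw d lam σ).prod (Measure.pi fun _ : Fin n => Measure.pi fun _ : Fin p =>
      gaussianReal 0 1)).map
      (fun y => (y.1, fun i j => √(μ / (n : ℝ)) * spin (σ i) * u j + y.2 i j)) =
    (baseLaw d n p).withDensity (labelDensity d lam μ σ u) := by
  have h1 : indicatorLaw d lam σ = (Measure.pi fun l => Measure.pi fun _ : Pairs n =>
      bernoulliMeasure true false (nullProb d n l)).withDensity
      fun x => ∏ l, ∏ q : Pairs n,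
        bernRatio (nullProb d n l) (edgeProb (d l) (lam l) n (σ q.1.1) (σ q.1.2)) (x l q) := by
    refine pi_eq_withDensity (f := fun l (x : Pairs n → Bool) => ∏ q : Pairs n,
        bernRatio (nullProb d n l) (edgeProb (d l) (lam l) n (σ q.1.1) (σ q.1.2)) (x q))
      (fun l => Measurable.of_discrete) fun l => ?_
    exact pi_eq_withDensity (f := fun (q : Pairs n) b =>
      bernRatio (nullProb d n l) (edgeProb (d l) (lam l) n (σ q.1.1) (σ q.1.2)) b)
      (fun q => measurable_bernRatio _ _) fun q =>
        bernoulliMeasure_eq_withDensity (nullProb_mem hd hn l).1 (nullProb_mem hd hn l).2 _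
  have h2 : (Measure.pi fun _ : Fin n => Measure.pi fun _ : Fin p => gaussianReal 0 1).map
      (fun (R : Fin n → Fin p → ℝ) i j => √(μ / (n : ℝ)) * spin (σ i) * u j + R i j) =
      (Measure.pi fun _ : Fin n => Measure.pi fun _ : Fin p => gaussianReal 0 1).withDensity
      fun R => ∏ i, ∏ j, gaussRatio (√(μ / n) * spin (σ i) * u j) (R i j) := by
    have h3 : ∀ i, (Measure.pi fun _ : Fin p => gaussianReal 0 1).map
        (fun (x : Fin p → ℝ) j => √(μ / (n : ℝ)) * spin (σ i) * u j + x j) =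
        Measure.pi fun j => gaussianReal (√(μ / n) * spin (σ i) * u j) 1 := fun i => by
      have hj := Measure.pi_map_pi (μ := fun _ : Fin p => gaussianReal 0 1)
        (f := fun j (z : ℝ) => √(μ / (n : ℝ)) * spin (σ i) * u j + z)
        fun j => (measurable_const_add _).aemeasurable
      simp only [gaussianReal_map_const_add, zero_add] at hj
      exact hj
    have hm : ∀ i, Measurable fun (x : Fin p → ℝ) j =>
        √(μ / (n : ℝ)) * spin (σ i) * u j + x j := fun i => by fun_prop
    have h4 := Measure.pi_map_pi (μ := fun _ : Fin n => Measure.pi fun _ : Fin p =>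
      gaussianReal 0 1) (f := fun i (x : Fin p → ℝ) j => √(μ / (n : ℝ)) * spin (σ i) * u j + x j)
      fun i => (hm i).aemeasurable
    rw [h4]
    simp_rw [h3]
    refine pi_eq_withDensity (f := fun i (x : Fin p → ℝ) =>
      ∏ j, gaussRatio (√(μ / n) * spin (σ i) * u j) (x j)) (fun i => ?_) fun i => ?_
    · exact Finset.measurable_fun_prod _ fun j _ =>
        (measurable_gaussRatio _).comp (measurable_pi_apply j)
    · exact pi_eq_withDensity (fun j => measurable_gaussRatio _) fun j =>
        gaussianReal_eq_withDensity _
  have h5 : (fun y : (Fin m → Pairs n → Bool) × (Fin n → Fin p → ℝ) =>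
      (y.1, fun i j => √(μ / (n : ℝ)) * spin (σ i) * u j + y.2 i j)) =
      Prod.map id fun (R : Fin n → Fin p → ℝ) i j =>
        √(μ / (n : ℝ)) * spin (σ i) * u j + R i j := rfl
  have hG : Measurable fun x : Fin m → Pairs n → Bool => ∏ l, ∏ q : Pairs n,
      bernRatio (nullProb d n l) (edgeProb (d l) (lam l) n (σ q.1.1) (σ q.1.2)) (x l q) :=
    Measurable.of_discrete
  have hH : Measurable fun R : Fin n → Fin p → ℝ =>
      ∏ i, ∏ j, gaussRatio (√(μ / n) * spin (σ i) * u j) (R i j) :=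
    Finset.measurable_fun_prod _ fun i _ => Finset.measurable_fun_prod _ fun j _ =>
      (measurable_gaussRatio _).comp (by fun_prop)
  rw [h5, ← Measure.map_prod_map _ _ measurable_id (by fun_prop), Measure.map_id, h2, h1,
    prod_withDensity hG hH]
  rfl

lemma lintegral_indicatorLaw_prod_noiseLaw
    {g : (Fin m → Pairs n → Bool) × ((Fin p → ℝ) × (Fin n → Fin p → ℝ)) → ENNReal}
    (hg : Measurable g) :
    ∫⁻ ω, g ω ∂((indicatorLaw d lam σ).prod (noiseLaw n p)) =
      ∫⁻ u, ∫⁻ x, ∫⁻ R, g (x, (u, R))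
        ∂(Measure.pi fun _ : Fin n => Measure.pi fun _ : Fin p => gaussianReal 0 1)
        ∂(indicatorLaw d lam σ) ∂(Measure.pi fun _ : Fin p => gaussianReal 0 1) := by
  have hx : ∀ x, Measurable fun w : (Fin p → ℝ) × (Fin n → Fin p → ℝ) => g (x, w) := fun x =>
    hg.comp measurable_prodMk_left
  have hxu : Measurable fun z : ((Fin m → Pairs n → Bool) × (Fin p → ℝ)) × (Fin n → Fin p → ℝ) =>
      g (z.1.1, (z.1.2, z.2)) := hg.comp (by fun_prop)
  rw [lintegral_prod _ hg.aemeasurable]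
  have h1 : ∀ x, ∫⁻ w, g (x, w) ∂(noiseLaw n p) = ∫⁻ u, ∫⁻ R, g (x, (u, R))
        ∂(Measure.pi fun _ : Fin n => Measure.pi fun _ : Fin p => gaussianReal 0 1)
        ∂(Measure.pi fun _ : Fin p => gaussianReal 0 1) := fun x => by
    rw [noiseLaw, lintegral_prod _ (hx x).aemeasurable]
  simp_rw [h1]
  exact lintegral_lintegral_swap (Measurable.lintegral_prod_right' hxu).aemeasurable

lemma condLaw_apply (hd : ∀ l, 1 < d l) (hn : ∀ l, 2 * d l ≤ n) {E : Set (Data m n p)}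
    (hE : MeasurableSet E) :
    condLaw d lam μ p σ E = ∫⁻ u : Fin p → ℝ, ∫⁻ y in toData ⁻¹' E,
      labelDensity d lam μ σ u y ∂(baseLaw d n p) ∂(Measure.pi fun _ => gaussianReal 0 1) := by
  have hE' : MeasurableSet (toData ⁻¹' E) := measurable_toData hE
  have hS : MeasurableSet (dataOf μ σ ⁻¹' E) := measurable_dataOf hE
  rw [condLaw_eq_map, Measure.map_apply measurable_dataOf hE, ← lintegral_indicator_one hS,
    lintegral_indicatorLaw_prod_noiseLaw (measurable_one.indicator hS)]
  refine lintegral_congr fun u => Eq.symm ?_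
  have hmap : Measurable fun y : (Fin m → Pairs n → Bool) × (Fin n → Fin p → ℝ) =>
      (y.1, fun i j => √(μ / (n : ℝ)) * spin (σ i) * u j + y.2 i j) := by fun_prop
  rw [← withDensity_apply _ hE', ← map_eq_withDensity hd hn, Measure.map_apply hmap hE',
    ← lintegral_indicator_one (hmap hE'),
    lintegral_prod _ (measurable_one.indicator (hmap hE')).aemeasurable]
  rfl

lemma dataLaw_null_apply {E : Set (Data m n p)} (hE : MeasurableSet E) :
    dataLaw d 0 0 n p E = baseLaw d n p (toData ⁻¹' E) := by
  have h : ∀ σ : Fin n → ℤˣ, condLaw d 0 0 p σ E = baseLaw d n p (toData ⁻¹' E) := by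
    intro σ
    have h1 : dataOf (m := m) (p := p) 0 σ = toData ∘ Prod.map id Prod.snd := by
      funext ω
      simp [dataOf, toData]
    have h2 : indicatorLaw d 0 σ = Measure.pi fun l => Measure.pi fun _ : Pairs n =>
        bernoulliMeasure true false (nullProb d n l) := by
      unfold indicatorLaw nullProb
      simp only [Pi.zero_apply, edgeProb_zero _ _ (σ _) (σ _)]
    have h3 : (noiseLaw n p).map Prod.snd =
        Measure.pi fun _ : Fin n => Measure.pi fun _ : Fin p => gaussianReal 0 1 := by
      rw [noiseLaw, Measure.map_snd_prod, measure_univ, one_smul]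
    rw [condLaw_eq_map, h1, ← Measure.map_map measurable_toData (by fun_prop),
      ← Measure.map_prod_map _ _ measurable_id measurable_snd, Measure.map_id, h2, h3,
      Measure.map_apply measurable_toData hE]
    rfl
  simp only [dataLaw, Measure.smul_apply, Measure.coe_finsetSum, Finset.sum_apply, h,
    Finset.sum_const, smul_eq_mul, nsmul_eq_mul]
  rw [Finset.card_univ, Fintype.card_fun, Fintype.card_fin, Fintype.card_units_int, Nat.cast_pow,
    Nat.cast_ofNat, ← mul_assoc, ENNReal.inv_mul_cancel (by simp) (by finiteness), one_mul]

lemma lintegral_labelDensity_mul (u v : Fin p → ℝ) :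
    ∫⁻ y, labelDensity d lam μ σ u y * labelDensity d lam μ τ v y ∂(baseLaw d n p) =
      (∏ l, ∏ q : Pairs n, ∫⁻ b,
        bernRatio (nullProb d n l) (edgeProb (d l) (lam l) n (σ q.1.1) (σ q.1.2)) b *
        bernRatio (nullProb d n l) (edgeProb (d l) (lam l) n (τ q.1.1) (τ q.1.2)) b
        ∂(bernoulliMeasure true false (nullProb d n l))) *
      ∏ i, ∏ j, ENNReal.ofReal
        (Real.exp ((√(μ / n) * spin (σ i) * u j) * (√(μ / n) * spin (τ i) * v j))) := by
  have h1 : ∀ y, labelDensity d lam μ σ u y * labelDensity d lam μ τ v y =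
      (∏ l, ∏ q : Pairs n,
        (bernRatio (nullProb d n l) (edgeProb (d l) (lam l) n (σ q.1.1) (σ q.1.2)) (y.1 l q) *
        bernRatio (nullProb d n l) (edgeProb (d l) (lam l) n (τ q.1.1) (τ q.1.2)) (y.1 l q))) *
      ∏ i, ∏ j, (gaussRatio (√(μ / n) * spin (σ i) * u j) (y.2 i j) *
        gaussRatio (√(μ / n) * spin (τ i) * v j) (y.2 i j)) := fun y => by
    simp only [labelDensity, Finset.prod_mul_distrib]
    ring
  have hg : ∀ i j, Measurable fun z : ℝ => gaussRatio (√(μ / n) * spin (σ i) * u j) z *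
      gaussRatio (√(μ / n) * spin (τ i) * v j) z := fun i j =>
    (measurable_gaussRatio _).mul (measurable_gaussRatio _)
  have hg2 : ∀ i, Measurable fun x : Fin p → ℝ =>
      ∏ j, (gaussRatio (√(μ / n) * spin (σ i) * u j) (x j) *
        gaussRatio (√(μ / n) * spin (τ i) * v j) (x j)) := fun i =>
    Finset.measurable_fun_prod _ fun j _ => (hg i j).comp (measurable_pi_apply j)
  simp_rw [h1]
  rw [baseLaw, lintegral_prod_mul (f := fun x : Fin m → Pairs n → Bool => ∏ l, ∏ q : Pairs n,
        (bernRatio (nullProb d n l) (edgeProb (d l) (lam l) n (σ q.1.1) (σ q.1.2)) (x l q) *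
        bernRatio (nullProb d n l) (edgeProb (d l) (lam l) n (τ q.1.1) (τ q.1.2)) (x l q)))
    (g := fun R : Fin n → Fin p → ℝ => ∏ i, ∏ j,
      (gaussRatio (√(μ / n) * spin (σ i) * u j) (R i j) *
        gaussRatio (√(μ / n) * spin (τ i) * v j) (R i j)))
    Measurable.of_discrete.aemeasurable
    (Finset.measurable_fun_prod _ fun i _ =>
      (hg2 i).comp (measurable_pi_apply i)).aemeasurable]
  congr 1
  · rw [lintegral_pi_prod (f := fun l (x : Pairs n → Bool) => ∏ q : Pairs n,
        (bernRatio (nullProb d n l) (edgeProb (d l) (lam l) n (σ q.1.1) (σ q.1.2)) (x q) *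
        bernRatio (nullProb d n l) (edgeProb (d l) (lam l) n (τ q.1.1) (τ q.1.2)) (x q)))
      fun l => Measurable.of_discrete]
    refine Finset.prod_congr rfl fun l _ => ?_
    rw [lintegral_pi_prod (f := fun (q : Pairs n) b =>
        (bernRatio (nullProb d n l) (edgeProb (d l) (lam l) n (σ q.1.1) (σ q.1.2)) b *
        bernRatio (nullProb d n l) (edgeProb (d l) (lam l) n (τ q.1.1) (τ q.1.2)) b))
      fun q => Measurable.of_discrete]
  · rw [lintegral_pi_prod hg2]
    refine Finset.prod_congr rfl fun i _ => ?_
    rw [lintegral_pi_prod (hg i)]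
    exact Finset.prod_congr rfl fun j _ => lintegral_gaussRatio_mul _ _

lemma sum_pairs_spin_le (σ τ : Fin n → ℤˣ) :
    ∑ q : Pairs n, spin (σ q.1.1) * spin (σ q.1.2) * (spin (τ q.1.1) * spin (τ q.1.2)) ≤
      (∑ i, spin (σ i) * spin (τ i)) ^ 2 / 2 := by
  have h := sum_pairs_mul fun i => spin (σ i) * spin (τ i)
  have h0 : 0 ≤ ∑ i, (spin (σ i) * spin (τ i)) ^ 2 := Finset.sum_nonneg fun _ _ => sq_nonneg _
  have h1 : ∑ q : Pairs n, spin (σ q.1.1) * spin (σ q.1.2) * (spin (τ q.1.1) * spin (τ q.1.2)) =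
      ∑ q : Pairs n, spin (σ q.1.1) * spin (τ q.1.1) * (spin (σ q.1.2) * spin (τ q.1.2)) :=
    Finset.sum_congr rfl fun q _ => by ring
  rw [h1]
  linarith

/-- The second moment of the likelihood ratio, for two label vectors with given overlap. -/
lemma lintegral_labelDensity_mul_le (hd : ∀ l, 1 < d l) (hlam : ∀ l, 0 ≤ lam l)
    (hle : ∀ l, lam l ≤ √(d l)) (hμ : 0 ≤ μ) (hn : ∀ l, 2 * d l ≤ n) (u v : Fin p → ℝ) :
    ∫⁻ y, labelDensity d lam μ σ u y * labelDensity d lam μ τ v y ∂(baseLaw d n p) ≤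
      ENNReal.ofReal (Real.exp ((∑ l, lam l ^ 2 / (n - d l)) *
        (∑ i, spin (σ i) * spin (τ i)) ^ 2 / 2)) *
      ENNReal.ofReal (Real.exp (μ / n * (∑ i, spin (σ i) * spin (τ i)) * ∑ j, u j * v j)) := by
  rw [lintegral_labelDensity_mul]
  refine mul_le_mul' ?_ (le_of_eq ?_)
  · have h1 : ∀ l (q : Pairs n), ∫⁻ b,
        bernRatio (nullProb d n l) (edgeProb (d l) (lam l) n (σ q.1.1) (σ q.1.2)) b *
        bernRatio (nullProb d n l) (edgeProb (d l) (lam l) n (τ q.1.1) (τ q.1.2)) b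
        ∂(bernoulliMeasure true false (nullProb d n l)) ≤
        ENNReal.ofReal (Real.exp (lam l ^ 2 / (n - d l) *
          (spin (σ q.1.1) * spin (σ q.1.2) * (spin (τ q.1.1) * spin (τ q.1.2))))) := by
      intro l q
      rw [lintegral_bernRatio_mul (nullProb_mem hd hn l).1 (nullProb_mem hd hn l).2]
      refine ENNReal.ofReal_le_ofReal (le_of_eq_of_le ?_ (Real.add_one_le_exp _))
      rw [edgeProb_val (hd l) (hlam l) (hle l) (hn l), edgeProb_val (hd l) (hlam l) (hle l) (hn l),
        nullProb_val hd hn]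
      have h1 := hd l
      have h2 := hn l
      have h3 : (0 : ℝ) < n := by linarith
      have h4 : (0 : ℝ) < n - d l := by linarith
      have h5 : 0 < √(d l) := Real.sqrt_pos.2 (by linarith)
      have h6 : √(d l) ^ 2 = d l := Real.sq_sqrt (by linarith)
      have h7 : 1 - d l / n = (n - d l) / n := by field_simp
      rw [h7, add_comm]
      congr 1
      generalize spin (σ q.1.1) * spin (σ q.1.2) = a
      generalize spin (τ q.1.1) * spin (τ q.1.2) = b
      have h8 : d l / n * (1 + lam l / √(d l) * a) - d l / n = d l / n * (lam l / √(d l) * a) := by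
        ring
      have h9 : d l / n * (1 + lam l / √(d l) * b) - d l / n = d l / n * (lam l / √(d l) * b) := by
        ring
      rw [h8, h9]
      field_simp
      rw [h6]
      ring
    refine (Finset.prod_le_prod' fun l _ => Finset.prod_le_prod' fun q _ => h1 l q).trans ?_
    simp_rw [← ENNReal.ofReal_prod_of_nonneg fun _ _ => (Real.exp_pos _).le, ← Real.exp_sum]
    rw [← ENNReal.ofReal_prod_of_nonneg fun _ _ => (Real.exp_pos _).le, ← Real.exp_sum]
    refine ENNReal.ofReal_le_ofReal (Real.exp_le_exp.2 ?_)
    rw [mul_div_assoc, Finset.sum_mul]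
    refine Finset.sum_le_sum fun l _ => ?_
    rw [← Finset.mul_sum]
    refine mul_le_mul_of_nonneg_left (sum_pairs_spin_le σ τ) (div_nonneg (sq_nonneg _) ?_)
    linarith [hd l, hn l]
  · simp_rw [← ENNReal.ofReal_prod_of_nonneg fun _ _ => (Real.exp_pos _).le, ← Real.exp_sum]
    rw [← ENNReal.ofReal_prod_of_nonneg fun _ _ => (Real.exp_pos _).le, ← Real.exp_sum]
    congr 2
    have h1 : √(μ / n) * √(μ / n) = μ / n := Real.mul_self_sqrt (by positivity)
    rw [mul_assoc, Finset.sum_mul_sum, Finset.mul_sum]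
    refine Finset.sum_congr rfl fun i _ => ?_
    rw [Finset.mul_sum]
    refine Finset.sum_congr rfl fun j _ => ?_
    have h2 : √(μ / n) * spin (σ i) * u j * (√(μ / n) * spin (τ i) * v j) =
        √(μ / n) * √(μ / n) * (spin (σ i) * spin (τ i) * (u j * v j)) := by ring
    rw [h2, h1]

lemma lintegral_exp_inner (a : ℝ) (u : Fin p → ℝ) :
    ∫⁻ v : Fin p → ℝ, ENNReal.ofReal (Real.exp (a * ∑ j, u j * v j))
      ∂(Measure.pi fun _ => gaussianReal 0 1) =
      ENNReal.ofReal (Real.exp (a ^ 2 * (∑ j, u j ^ 2) / 2)) := by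
  have h1 : ∀ v : Fin p → ℝ, ENNReal.ofReal (Real.exp (a * ∑ j, u j * v j)) =
      ∏ j, ENNReal.ofReal (Real.exp (a * u j * v j)) := fun v => by
    rw [← ENNReal.ofReal_prod_of_nonneg fun _ _ => (Real.exp_pos _).le, ← Real.exp_sum,
      Finset.mul_sum]
    simp_rw [mul_assoc]
  simp_rw [h1]
  rw [lintegral_pi_prod (f := fun j z => ENNReal.ofReal (Real.exp (a * u j * z)))
    fun j => by fun_prop]
  simp_rw [lintegral_exp_mul_gaussian]
  rw [← ENNReal.ofReal_prod_of_nonneg fun _ _ => (Real.exp_pos _).le, ← Real.exp_sum]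
  congr 2
  rw [Finset.mul_sum, Finset.sum_div]
  exact Finset.sum_congr rfl fun j _ => by ring

/-- The likelihood ratio of the data given `u` alone, averaged over the labels. -/
def meanDensity (d lam : Fin m → ℝ) (μ : ℝ) (u : Fin p → ℝ)
    (y : (Fin m → Pairs n → Bool) × (Fin n → Fin p → ℝ)) : ENNReal :=
  (2 ^ n)⁻¹ * ∑ σ : Fin n → ℤˣ, labelDensity d lam μ σ u y

lemma measurable_labelDensity_right (u : Fin p → ℝ) : Measurable (labelDensity d lam μ σ u) := by
  have h := (measurable_labelDensity (d := d) (lam := lam) (μ := μ) (σ := σ) (p := p)).comp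
    (measurable_prodMk_left (x := u))
  exact h

lemma measurable_meanDensity :
    Measurable (Function.uncurry (meanDensity (n := n) (p := p) d lam μ)) :=
  (Finset.measurable_fun_sum _ fun _ _ => measurable_labelDensity).const_mul _

lemma lintegral_meanDensity_mul_le (hd : ∀ l, 1 < d l) (hlam : ∀ l, 0 ≤ lam l)
    (hle : ∀ l, lam l ≤ √(d l)) (hμ : 0 ≤ μ) (hn : ∀ l, 2 * d l ≤ n) (u v : Fin p → ℝ) :
    ∫⁻ y, meanDensity d lam μ u y * meanDensity d lam μ v y ∂(baseLaw d n p) ≤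
      (2 ^ n)⁻¹ * ((2 ^ n)⁻¹ * ∑ σ : Fin n → ℤˣ, ∑ τ : Fin n → ℤˣ,
        ENNReal.ofReal (Real.exp ((∑ l, lam l ^ 2 / (n - d l)) *
          (∑ i, spin (σ i) * spin (τ i)) ^ 2 / 2)) *
        ENNReal.ofReal (Real.exp (μ / n * (∑ i, spin (σ i) * spin (τ i)) * ∑ j, u j * v j))) := by
  have hm : ∀ σ τ : Fin n → ℤˣ, Measurable fun y : (Fin m → Pairs n → Bool) × (Fin n → Fin p → ℝ) =>
      labelDensity d lam μ σ u y * labelDensity d lam μ τ v y := fun σ τ =>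
    (measurable_labelDensity_right u).mul (measurable_labelDensity_right v)
  have hm2 : ∀ σ : Fin n → ℤˣ, Measurable fun y : (Fin m → Pairs n → Bool) × (Fin n → Fin p → ℝ) =>
      ∑ τ, labelDensity d lam μ σ u y * labelDensity d lam μ τ v y := fun σ =>
    Finset.measurable_fun_sum _ fun τ _ => hm σ τ
  have hm3 : Measurable fun y : (Fin m → Pairs n → Bool) × (Fin n → Fin p → ℝ) =>
      ∑ σ, ∑ τ, labelDensity d lam μ σ u y * labelDensity d lam μ τ v y :=
    Finset.measurable_fun_sum _ fun σ _ => hm2 σ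
  have h2 : ∀ y : (Fin m → Pairs n → Bool) × (Fin n → Fin p → ℝ),
      meanDensity d lam μ u y * meanDensity d lam μ v y =
      (2 ^ n)⁻¹ * ((2 ^ n)⁻¹ * ∑ σ, ∑ τ,
        labelDensity d lam μ σ u y * labelDensity d lam μ τ v y) := fun y => by
    rw [← Finset.sum_mul_sum, meanDensity, meanDensity, mul_mul_mul_comm, mul_assoc]
  simp_rw [h2]
  rw [lintegral_const_mul _ (hm3.const_mul _), lintegral_const_mul _ hm3,
    lintegral_finsetSum _ fun σ _ => hm2 σ]
  refine mul_le_mul_right (mul_le_mul_right (Finset.sum_le_sum fun σ _ => ?_) _) _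
  rw [lintegral_finsetSum _ fun τ _ => hm σ τ]
  exact Finset.sum_le_sum fun τ _ => lintegral_labelDensity_mul_le hd hlam hle hμ hn u v

/-- Gaussian integration over `v` turns the covariate term into a quadratic term in the overlap
`S` of the labels. -/
lemma lintegral_exp_overlap_le (hn0 : 0 < n) {b c D : ℝ} (hc : n * D + μ ^ 2 * b / n ≤ c)
    {u : Fin p → ℝ} (hu : ∑ j, u j ^ 2 ≤ b) (S : ℝ) :
    ∫⁻ v : Fin p → ℝ, ENNReal.ofReal (Real.exp (D * S ^ 2 / 2)) *
        ENNReal.ofReal (Real.exp (μ / n * S * ∑ j, u j * v j))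
        ∂(Measure.pi fun _ => gaussianReal 0 1) ≤
      ENNReal.ofReal (Real.exp (c / n * S ^ 2 / 2)) := by
  have hnr : (0 : ℝ) < n := by exact_mod_cast hn0
  rw [lintegral_const_mul _ (by fun_prop), lintegral_exp_inner,
    ← ENNReal.ofReal_mul (Real.exp_pos _).le, ← Real.exp_add]
  refine ENNReal.ofReal_le_ofReal (Real.exp_le_exp.2 ?_)
  have h4 : D + μ ^ 2 * b / n ^ 2 ≤ c / n := by
    rw [le_div_iff₀ hnr]
    refine le_trans (le_of_eq ?_) hc
    field_simp
  have h5 : (μ / n * S) ^ 2 * ∑ j, u j ^ 2 ≤ (μ / n * S) ^ 2 * b :=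
    mul_le_mul_of_nonneg_left hu (sq_nonneg _)
  have h6 : (D + μ ^ 2 * b / n ^ 2) * S ^ 2 ≤ c / n * S ^ 2 :=
    mul_le_mul_of_nonneg_right h4 (sq_nonneg _)
  have h7 : (μ / n * S) ^ 2 * b = μ ^ 2 * b / n ^ 2 * S ^ 2 := by ring
  linarith

/-- Restricting `u` to a ball is enough to bound the second moment of the mixture: the second
copy `v` of the vector may be integrated over the whole space. -/
lemma truncated_second_moment_le (hd : ∀ l, 1 < d l) (hlam : ∀ l, 0 ≤ lam l)
    (hle : ∀ l, lam l ≤ √(d l)) (hμ : 0 ≤ μ) (hn : ∀ l, 2 * d l ≤ n) (hn0 : 0 < n) {b c : ℝ}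
    (hc0 : 0 ≤ c) (hc : n * (∑ l, lam l ^ 2 / (n - d l)) + μ ^ 2 * b / n ≤ c) :
    ∫⁻ u in {u : Fin p → ℝ | ∑ j, u j ^ 2 ≤ b}, ∫⁻ v in {u : Fin p → ℝ | ∑ j, u j ^ 2 ≤ b}, ∫⁻ y,
      meanDensity d lam μ u y * meanDensity d lam μ v y ∂(baseLaw d n p)
      ∂(Measure.pi fun _ => gaussianReal 0 1) ∂(Measure.pi fun _ => gaussianReal 0 1) ≤
    gaussSqConst c := by
  have hA : MeasurableSet {u : Fin p → ℝ | ∑ j, u j ^ 2 ≤ b} :=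
    measurableSet_le (by fun_prop) measurable_const
  have h2n : ((2 : ENNReal) ^ n)⁻¹ * 2 ^ n = 1 :=
    ENNReal.inv_mul_cancel (by simp) (by finiteness)
  have hu : ∀ u ∈ {u : Fin p → ℝ | ∑ j, u j ^ 2 ≤ b},
      ∫⁻ v in {u : Fin p → ℝ | ∑ j, u j ^ 2 ≤ b}, ∫⁻ y,
        meanDensity d lam μ u y * meanDensity d lam μ v y ∂(baseLaw d n p)
        ∂(Measure.pi fun _ => gaussianReal 0 1) ≤ gaussSqConst c := by
    intro u hub
    have hm : ∀ S D : ℝ, Measurable fun v : Fin p → ℝ => ENNReal.ofReal (Real.exp (D * S ^ 2 / 2)) *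
        ENNReal.ofReal (Real.exp (μ / n * S * ∑ j, u j * v j)) := fun S D => by fun_prop
    refine (lintegral_mono fun v =>
      lintegral_meanDensity_mul_le hd hlam hle hμ hn u v).trans
        ((setLIntegral_le_lintegral _ _).trans ?_)
    rw [lintegral_const_mul _ ((Finset.measurable_fun_sum _ fun σ _ =>
        Finset.measurable_fun_sum _ fun τ _ => hm _ _).const_mul _),
      lintegral_const_mul _ (Finset.measurable_fun_sum _ fun σ _ =>
        Finset.measurable_fun_sum _ fun τ _ => hm _ _),
      lintegral_finsetSum _ fun σ _ => Finset.measurable_fun_sum _ fun τ _ => hm _ _]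
    simp_rw [lintegral_finsetSum _ fun τ _ => hm _ _]
    calc _ ≤ (2 ^ n)⁻¹ * ((2 ^ n)⁻¹ * ∑ σ : Fin n → ℤˣ, ∑ τ : Fin n → ℤˣ,
          ENNReal.ofReal (Real.exp (c / n * (∑ i, spin (σ i) * spin (τ i)) ^ 2 / 2))) :=
          mul_le_mul_right (mul_le_mul_right (Finset.sum_le_sum fun σ _ =>
            Finset.sum_le_sum fun τ _ => lintegral_exp_overlap_le hn0 hc hub _) _) _
      _ = (2 ^ n)⁻¹ * ((2 ^ n)⁻¹ * (2 ^ n * ∑ s : Fin n → ℤˣ,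
          ENNReal.ofReal (Real.exp (c / n * (∑ i, spin (s i)) ^ 2 / 2)))) := by
          rw [sum_sum_labels fun S => ENNReal.ofReal (Real.exp (c / n * S ^ 2 / 2))]
      _ ≤ (2 ^ n)⁻¹ * (2 ^ n * gaussSqConst c) := by
          rw [← mul_assoc (2 ^ n)⁻¹ (2 ^ n), h2n, one_mul]
          exact mul_le_mul_right (sum_exp_sq_le hn0 hc0) _
      _ = gaussSqConst c := by rw [← mul_assoc, h2n, one_mul]
  refine (setLIntegral_mono' hA hu).trans ?_
  rw [setLIntegral_const]
  exact mul_le_of_le_one_right zero_le prob_le_one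

lemma lintegral_labelDensity (hd : ∀ l, 1 < d l) (hn : ∀ l, 2 * d l ≤ n) (u : Fin p → ℝ) :
    ∫⁻ y, labelDensity d lam μ σ u y ∂(baseLaw d n p) = 1 := by
  rw [← setLIntegral_univ, ← withDensity_apply _ MeasurableSet.univ, ← map_eq_withDensity hd hn,
    Measure.map_apply (by fun_prop) MeasurableSet.univ, Set.preimage_univ, measure_univ]

lemma lintegral_meanDensity_le (hd : ∀ l, 1 < d l) (hn : ∀ l, 2 * d l ≤ n) (u : Fin p → ℝ) :
    ∫⁻ y, meanDensity d lam μ u y ∂(baseLaw d n p) ≤ 1 := by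
  simp only [meanDensity]
  rw [lintegral_const_mul _ (Finset.measurable_fun_sum _ fun σ _ =>
      measurable_labelDensity_right u),
    lintegral_finsetSum _ fun σ _ => measurable_labelDensity_right u]
  simp only [lintegral_labelDensity hd hn]
  simp only [Finset.sum_const, Finset.card_univ, Fintype.card_fun, Fintype.card_fin,
    Fintype.card_units_int, nsmul_eq_mul, Nat.cast_pow, Nat.cast_ofNat, mul_one]
  exact (ENNReal.inv_mul_cancel (by simp) (by finiteness)).le

lemma dataLaw_apply (hd : ∀ l, 1 < d l) (hn : ∀ l, 2 * d l ≤ n) {E : Set (Data m n p)}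
    (hE : MeasurableSet E) :
    dataLaw d lam μ n p E = ∫⁻ u : Fin p → ℝ, ∫⁻ y in toData ⁻¹' E,
      meanDensity d lam μ u y ∂(baseLaw d n p) ∂(Measure.pi fun _ => gaussianReal 0 1) := by
  simp only [dataLaw, Measure.smul_apply, Measure.coe_finsetSum, Finset.sum_apply, smul_eq_mul]
  simp_rw [condLaw_apply hd hn hE]
  have hm : ∀ σ : Fin n → ℤˣ, Measurable fun u : Fin p → ℝ => ∫⁻ y in toData ⁻¹' E,
      labelDensity d lam μ σ u y ∂(baseLaw d n p) := fun σ =>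
    Measurable.lintegral_prod_right' measurable_labelDensity
  rw [← lintegral_finsetSum _ fun σ _ => hm σ,
    ← lintegral_const_mul _ (Finset.measurable_fun_sum _ fun σ _ => hm σ)]
  refine lintegral_congr fun u => ?_
  simp only [meanDensity]
  rw [lintegral_const_mul _ (Finset.measurable_fun_sum _ fun σ _ =>
      measurable_labelDensity_right u),
    lintegral_finsetSum _ fun σ _ => measurable_labelDensity_right u]

/-- The quantitative form of contiguity: for a large constant `K` the last term is small uniformly
in `n`, and the first two are small for large `n` when `E` is rare under the null law. -/
lemma dataLaw_apply_le (hd : ∀ l, 1 < d l) (hlam : ∀ l, 0 ≤ lam l)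
    (hle : ∀ l, lam l ≤ √(d l)) (hμ : 0 ≤ μ) (hn : ∀ l, 2 * d l ≤ n) (hn0 : 0 < n) {b c : ℝ}
    (hc0 : 0 ≤ c) (hc : n * (∑ l, lam l ^ 2 / (n - d l)) + μ ^ 2 * b / n ≤ c)
    {E : Set (Data m n p)} (hE : MeasurableSet E) {K : ENNReal} (hK0 : K ≠ 0) (hK : K ≠ ⊤) :
    dataLaw d lam μ n p E ≤
      Measure.pi (fun _ : Fin p => gaussianReal 0 1) {u | ∑ j, u j ^ 2 ≤ b}ᶜ +
        K * dataLaw d 0 0 n p E + K⁻¹ * gaussSqConst c := by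
  have hA : MeasurableSet {u : Fin p → ℝ | ∑ j, u j ^ 2 ≤ b} :=
    measurableSet_le (by fun_prop) measurable_const
  rw [dataLaw_apply hd hn hE, dataLaw_null_apply hE]
  refine (mixture_le_of_second_moment (baseLaw d n p) _ measurable_meanDensity
    (lintegral_meanDensity_le hd hn) hA hK0 hK).trans (add_le_add_right (mul_le_mul_right ?_ _) _)
  exact truncated_second_moment_le hd hlam hle hμ hn hn0 hc0 hc

end density

/-- Chebyshev's inequality for the squared norm of a standard normal vector. -/
lemma measure_sum_sq_gt_le {p : ℕ} (hp : 0 < p) {ε : ℝ} (hε : 0 < ε) :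
    Measure.pi (fun _ : Fin p => gaussianReal 0 1) {u | ∑ j, u j ^ 2 ≤ (1 + ε) * p}ᶜ ≤
      ENNReal.ofReal (Var[fun z : ℝ => z ^ 2; gaussianReal 0 1] / ε ^ 2 / p) := by
  have hp0 : (0 : ℝ) < p := by exact_mod_cast hp
  have hL2 : MemLp (fun z : ℝ => z ^ 2) 2 (gaussianReal 0 1) := by
    rw [memLp_two_iff_integrable_sq (by fun_prop)]
    refine Integrable.mono' (integrable_one_add_sq_pow_gaussian 2) (by fun_prop)
      (Eventually.of_forall fun z => ?_)
    rw [Real.norm_of_nonneg (by positivity)]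
    exact pow_le_pow_left₀ (sq_nonneg z) (by linarith) 2
  have hcomp : ∀ j : Fin p, MemLp (fun u : Fin p → ℝ => u j ^ 2) 2
      (Measure.pi fun _ => gaussianReal 0 1) := fun j =>
    hL2.comp_measurePreserving (measurePreserving_eval (fun _ : Fin p => gaussianReal 0 1) j)
  have hmem : MemLp (∑ j : Fin p, fun u : Fin p → ℝ => u j ^ 2) 2
      (Measure.pi fun _ => gaussianReal 0 1) := memLp_finsetSum' _ fun j _ => hcomp j
  have hvar := variance_sum_pi (μ := fun _ : Fin p => gaussianReal 0 1)
    (X := fun _ (z : ℝ) => z ^ 2) fun _ => hL2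
  have hmean : ∫ u : Fin p → ℝ, (∑ j : Fin p, fun u : Fin p → ℝ => u j ^ 2) u
      ∂(Measure.pi fun _ => gaussianReal 0 1) = p := by
    simp only [Finset.sum_apply]
    rw [integral_finsetSum _ fun j _ => (hcomp j).integrable (by norm_num)]
    have h1 : ∀ j : Fin p, ∫ u : Fin p → ℝ, u j ^ 2 ∂(Measure.pi fun _ => gaussianReal 0 1) = 1 := by
      intro j
      have hmp := measurePreserving_eval (fun _ : Fin p => gaussianReal 0 1) j
      rw [← integral_sq_gaussian]
      conv_rhs => rw [← hmp.map_eq]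
      rw [integral_map hmp.measurable.aemeasurable (by fun_prop)]
    simp [h1]
  have hcheb := meas_ge_le_variance_div_sq hmem (c := ε * p) (by positivity)
  rw [hmean, hvar] at hcheb
  refine (measure_mono fun u hu => ?_).trans (hcheb.trans (ENNReal.ofReal_le_ofReal (le_of_eq ?_)))
  · simp only [Set.mem_compl_iff, Set.mem_ofPred_eq, not_le, Finset.sum_apply] at hu ⊢
    refine le_trans ?_ (le_abs_self _)
    linarith
  · simp only [Finset.sum_const, Finset.card_univ, Fintype.card_fin, nsmul_eq_mul]
    field_simp

theorem contiguous_dataLaw {m : ℕ} {d lam : Fin m → ℝ} {μ γ : ℝ} {p : ℕ → ℕ}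
    (hd : ∀ l, 1 < d l) (hlam : ∀ l, 0 ≤ lam l) (hb : ∀ l, 0 ≤ d l - lam l * √(d l))
    (hμ : 0 ≤ μ) (hγ : 0 < γ)
    (hp : Tendsto (fun n : ℕ => (n : ℝ) / (p n : ℝ)) atTop (𝓝 γ))
    (hlt : (∑ l, lam l ^ 2) + μ ^ 2 / γ < 1) :
    Contiguous (fun n => dataLaw d lam μ n (p n)) (fun n => dataLaw d 0 0 n (p n)) := by
  intro E hE hP
  set x := μ ^ 2 / γ with hx
  have hx0 : 0 ≤ x := by positivity
  have hle : ∀ l, lam l ≤ √(d l) := fun l => le_sqrt_of_sub_nonneg (hd l) (hb l)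
  -- room for the truncation level `(1 + ε) p` and for a constant `c < 1`
  obtain ⟨ε, hε, hε1⟩ : ∃ ε : ℝ, 0 < ε ∧ (∑ l, lam l ^ 2) + (1 + ε) * x < 1 := by
    refine ⟨(1 - ((∑ l, lam l ^ 2) + x)) / (1 + x), div_pos (by linarith) (by linarith), ?_⟩
    have h1 : (1 - ((∑ l, lam l ^ 2) + x)) / (1 + x) * x < 1 - ((∑ l, lam l ^ 2) + x) := by
      rw [div_mul_eq_mul_div, div_lt_iff₀ (by linarith)]
      nlinarith
    linarith
  obtain ⟨c, hc, hc1⟩ := exists_between hε1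
  have hc0 : 0 ≤ c := by
    have : 0 ≤ ∑ l, lam l ^ 2 := Finset.sum_nonneg fun _ _ => sq_nonneg _
    nlinarith
  have hpn := tendsto_ratio_inv hγ hp
  have hlim : Tendsto (fun n : ℕ => n * (∑ l, lam l ^ 2 / (n - d l)) +
      μ ^ 2 * ((1 + ε) * p n) / n) atTop (𝓝 ((∑ l, lam l ^ 2) + (1 + ε) * x)) := by
    refine Tendsto.add ?_ ?_
    · simp_rw [Finset.mul_sum]
      refine tendsto_finsetSum _ fun l _ => ?_
      have h1 : Tendsto (fun n : ℕ => lam l ^ 2 / (1 - d l / (n : ℝ))) atTop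
          (𝓝 (lam l ^ 2 / (1 - 0))) :=
        tendsto_const_nhds.div ((tendsto_const_div_atTop_nhds_zero_nat (d l)).const_sub 1)
          (by norm_num)
      rw [sub_zero, div_one] at h1
      refine h1.congr' ?_
      filter_upwards [eventually_gt_atTop 0] with n hn
      have hn0 : (n : ℝ) ≠ 0 := by exact_mod_cast hn.ne'
      rw [show 1 - d l / (n : ℝ) = (n - d l) / n by field_simp, div_div_eq_mul_div]
      ring
    · have h1 := hpn.const_mul (μ ^ 2 * (1 + ε))
      have h2 : μ ^ 2 * (1 + ε) * (1 / γ) = (1 + ε) * x := by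
        rw [hx]
        ring
      rw [h2] at h1
      refine h1.congr fun n => ?_
      ring
  have hev := hlim.eventually (gt_mem_nhds hc)
  have hlarge : ∀ᶠ n : ℕ in atTop, ∀ l, 2 * d l ≤ n :=
    eventually_all.2 fun l => tendsto_natCast_atTop_atTop.eventually (eventually_ge_atTop _)
  have hpp := tendsto_cov_atTop hγ hp
  have hbad : Tendsto (fun n => Measure.pi (fun _ : Fin (p n) => gaussianReal 0 1)
      {u | ∑ j, u j ^ 2 ≤ (1 + ε) * p n}ᶜ) atTop (𝓝 0) := by
    have h1 : Tendsto (fun n => ENNReal.ofReal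
        (Var[fun z : ℝ => z ^ 2; gaussianReal 0 1] / ε ^ 2 / p n)) atTop (𝓝 0) := by
      have := ENNReal.tendsto_ofReal (hpp.const_div_atTop
        (Var[fun z : ℝ => z ^ 2; gaussianReal 0 1] / ε ^ 2))
      rwa [ENNReal.ofReal_zero] at this
    refine tendsto_of_tendsto_of_tendsto_of_le_of_le' tendsto_const_nhds h1
      (Eventually.of_forall fun _ => zero_le) ?_
    filter_upwards [hpp.eventually (eventually_gt_atTop 0)] with n hn
    exact measure_sum_sq_gt_le (by exact_mod_cast hn) hε
  rw [ENNReal.tendsto_nhds_zero]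
  intro δ hδ
  have hδ2 : 0 < δ / 2 := ENNReal.half_pos hδ.ne'
  obtain ⟨N, hN, hN0⟩ : ∃ N : ℕ, (N : ENNReal)⁻¹ * gaussSqConst c ≤ δ / 2 ∧ N ≠ 0 := by
    have h1 := ENNReal.Tendsto.mul_const (b := gaussSqConst c) ENNReal.tendsto_inv_nat_nhds_zero
      (Or.inr (gaussSqConst_lt_top hc1).ne)
    rw [zero_mul] at h1
    exact ((ENNReal.tendsto_nhds_zero.1 h1 _ hδ2).and (eventually_ne_atTop 0)).exists
  have hsum : Tendsto (fun n => Measure.pi (fun _ : Fin (p n) => gaussianReal 0 1)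
      {u | ∑ j, u j ^ 2 ≤ (1 + ε) * p n}ᶜ + N * dataLaw d 0 0 n (p n) (E n)) atTop (𝓝 0) := by
    have h1 := ENNReal.Tendsto.const_mul (a := (N : ENNReal)) hP (Or.inr (by simp))
    simpa using hbad.add h1
  filter_upwards [hev, hlarge, eventually_gt_atTop 0, ENNReal.tendsto_nhds_zero.1 hsum _ hδ2]
    with n h1 h2 h3 h4
  refine (dataLaw_apply_le hd hlam hle hμ h2 h3 hc0 h1.le (hE n)
    (K := N) (by exact_mod_cast hN0) (by simp)).trans ?_
  calc _ ≤ δ / 2 + δ / 2 := add_le_add h4 hN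
    _ = δ := ENNReal.add_halves δ

end

end ContextualSBM

theorem theorem2p1 (m : ℕ) (d lam : Fin m → ℝ) (μ γ : ℝ) (p : ℕ → ℕ)
    (hd : ∀ k, 1 < d k)
    (hlam : ∀ k, 0 ≤ lam k)
    (hb : ∀ k, 0 ≤ d k - lam k * √(d k))
    (hμ : 0 ≤ μ)
    (hγ : 0 < γ)
    (hp : Tendsto (fun n : ℕ => (n : ℝ) / (p n : ℝ)) atTop (𝓝 γ)) :
    ((∑ k, lam k ^ 2) + μ ^ 2 / γ < 1 →
      ContextualSBM.Contiguous
        (fun n => ContextualSBM.dataLaw d lam μ n (p n))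
        (fun n => ContextualSBM.dataLaw d 0 0 n (p n))) ∧
    (1 < (∑ k, lam k ^ 2) + μ ^ 2 / γ →
      ContextualSBM.AsympMutuallySingular
        (fun n => ContextualSBM.dataLaw d lam μ n (p n))
        (fun n => ContextualSBM.dataLaw d 0 0 n (p n))) :=
  ⟨ContextualSBM.contiguous_dataLaw hd hlam hb hμ hγ hp,
    ContextualSBM.asympMutuallySingular_dataLaw hd hlam hb hμ hγ hp⟩
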